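/- Structures are finite, ordered and non-empty: a signature $\mathbf R=\{R_1,\dots,R_{k-1},<\}$ consists of finitely many relation names of positive arity, and $<$ is interpreted as a linear order on the domain. A structure $\mathfrak A$ with $n$ elements is encoded by the binary string $\mathrm{enc}(\mathfrak A)=0^n\,1\,\mathrm{enc}(R_1^{\mathfrak A})\cdots\mathrm{enc}(R_{k-1}^{\mathfrak A})$, where $\mathrm{enc}(R_i^{\mathfrak A})$ lists, in lexicographic order of the tuples, one bit per tuple telling whether it belongs to $R_i^{\mathfrak A}$. *The logic.* For a second-order variable $X$, a positive literal is a formula $X(\bar x)$ and a negative literal is a formula $\exists\bar v\,\neg X(\bar u,\bar v)$ ($\bar v$ possibly empty), with tuples of first-order variables. A Horn clause over $\mathbf R$ is a formula $\forall\bar x\,(\varphi_1\vee\cdots\vee\varphi_n)$ in which each $\varphi_i$ is a positive literal, a negative literal or a first-order formula over $\mathbf R$ (without second-order variables), and at most one $\varphi_i$ is a positive literal. A Horn formula is a conjunction of Horn clauses, and $\exists\mathrm{Horn}$ is the set of formulae $\exists\bar x\,\psi$ with $\psi$ a Horn formula. The formulae of $\Sigma\mathrm{QSO}(\exists\mathrm{Horn})$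 over $\mathbf R$ are given by $\alpha::=\varphi\mid s\mid(\alpha+\alpha)\mid\Sigma x.\,\alpha\mid\Sigma X.\,\alpha$ with $\varphi\in\exists\mathrm{Horn}$ over $\mathbf R$ and $s\in\mathbb N$. Here $\varphi$ has value $1$ if it holds and $0$ otherwise, $s$ and $+$ have their usual meaning, $\Sigma x.\,\alpha$ sums the value of $\alpha$ over all elements for $x$, and $\Sigma X.\,\alpha$ sums it over all relations of the arity of $X$ on the domain. A sentence $\alpha$ (no free first- or second-order variables) over $\mathbf R$ defines the function $f_\alpha:\{0,1\}^*\to\mathbb N$ with $f_\alpha(\mathrm{enc}(\mathfrak A))=[\![\alpha]\!](\mathfrak A)$ for every $\mathbf R$-structure $\mathfrak A$, and $f_\alpha(w)=0$ if $w$ encodes no $\mathbf R$-structure. We also write $\Sigma\mathrm{QSO}(\exists\mathrm{Horn})$ for the class of all functions $f_\alpha$, over all signatures $\mathbf R$. *The problem.* A propositional Horn clause is a disjunction of literals with at most one positive literal, and a propositional Horn formula is a non-empty conjunction of such clauses. A disjunction of Horn formulae is represented by a structure over $\{P(\cdot,\cdot),N(\cdot,\cdot),V(\cdot),NC(\cdot),D(\cdot,\cdot),<\}$: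 $V(x)$ says that $x$ is a propositional variable, $P(c,x)$ (resp. $N(c,x)$) that $x$ (resp. $\neg x$) is a disjunct of the clause $c$, $NC(c)$ that $c$ is a clause without positive literals, and $D(d,c)$ that $c$ is a clause of the disjunct $d$; here the clauses (resp. disjuncts) are the elements $c$ (resp. $d$) occurring in a pair of $D$, $P$ and $N$ relate only clauses to variables, each clause has at most one $x$ with $P(c,x)$, and $NC$ holds exactly for the clauses without such an $x$. For $w\in\{0,1\}^*$, $\#\mathrm{DisjHornSAT}(w)$ is the number of satisfying assignments, over the set of variables given by $V$, of the disjunction of Horn formulae represented by the structure that $w$ encodes, and $0$ if $w$ does not encode a structure representing a disjunction of Horn formulae. A function $f:\{0,1\}^*\to\mathbb N$ is parsimoniously reducible to $g:\{0,1\}^*\to\mathbb N$ if there is a polynomial-time computable $h:\{0,1\}^*\to\{0,1\}^*$ with $f(x)=g(h(x))$ for every $x\in\{0,1\}^*$. **Theorem.** $\#\mathrm{DisjHornSAT}$ is complete for $\Sigma\mathrm{QSO}(\exists\mathrm{Horn})$ under parsimonious reductions: $\#\mathrm{DisjHornSAT}$ belongs to $\Sigma\mathrm{QSO}(\exists\mathrm{Horn})$,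 and every function in $\Sigma\mathrm{QSO}(\exists\mathrm{Horn})$ is parsimoniously reducible to $\#\mathrm{DisjHornSAT}$. -/

import Mathlib

/-! ### Signatures and finite ordered structures -/

/-- A relational signature.  The order symbol `<` belongs to every signature and is not listed;
`arity i` is the arity of the `i`-th relation name different from `<`. -/
structure Signature where
  numRel : ℕ
  arity : Fin numRel → ℕ
  arity_pos : ∀ i, 0 < arity i

/-- A finite ordered structure over `R`: a non-empty finite domain, a linear order on it
interpreting `<`, and a relation for every other relation name. -/
structure OrdStruct (R : Signature) where
  A : Type
  [fintypeA : Fintype A]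
  [orderA : LinearOrder A]
  [nonemptyA : Nonempty A]
  rel : (i : Fin R.numRel) → Set (Fin (R.arity i) → A)

attribute [instance] OrdStruct.fintypeA OrdStruct.orderA OrdStruct.nonemptyA

/-- All `k`-tuples over a list `l`, in the lexicographic order given by the positions in `l`. -/
def tuples {A : Type} (l : List A) : (k : ℕ) → List (Fin k → A)
  | 0 => [Fin.elim0]
  | k + 1 => l.flatMap fun a => (tuples l k).map fun t => (Fin.cons a t : Fin (k + 1) → A)

open Classical in
/-- The encoding of a structure with `n` elements: `0ⁿ 1 enc(R₁) ⋯ enc(R_{k-1})`, where `enc(Rᵢ)`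
lists the membership bits of all tuples in lexicographic order. -/
noncomputable def OrdStruct.enc {R : Signature} (S : OrdStruct R) : List Bool :=
  List.replicate (Fintype.card S.A) false ++ true ::
    (List.finRange R.numRel).flatMap fun i =>
      (tuples (Finset.univ.sort (fun a b : S.A => a ≤ b)) (R.arity i)).map
        fun t => decide (t ∈ S.rel i)

open Classical in
/-- The function on strings that sends `enc(S)` to `val S`, and strings that do not encode an
`R`-structure to `0`. -/
noncomputable def onStrings {R : Signature} (val : OrdStruct R → ℕ) (w : List Bool) : ℕ :=
  if h : ∃ S : OrdStruct R, S.enc = w then val h.choose else 0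

/-! ### Second-order logic -/

/-- First-order variables. -/
abbrev FVar : Type := ℕ

/-- Second-order variables: infinitely many of each arity. -/
structure SVar where
  arity : ℕ
  index : ℕ
  deriving DecidableEq

/-- Second-order formulae over a signature. -/
inductive SO (R : Signature) : Type
  | eq (x y : FVar)
  | lt (x y : FVar)
  | rel (i : Fin R.numRel) (u : Fin (R.arity i) → FVar)
  | top
  | app (X : SVar) (u : Fin X.arity → FVar)
  | neg (φ : SO R)
  | disj (φ ψ : SO R)
  | ex (x : FVar) (φ : SO R)
  | exSO (X : SVar) (φ : SO R)

/-- First-order assignments. -/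
abbrev FAssign (A : Type) : Type := FVar → A

/-- Second-order assignments. -/
abbrev SAssign (A : Type) : Type := (X : SVar) → Set (Fin X.arity → A)

/-- `(S, v, V) ⊨ φ`. -/
def SO.Sat {R : Signature} (S : OrdStruct R) : SO R → FAssign S.A → SAssign S.A → Prop
  | .eq x y, v, _ => v x = v y
  | .lt x y, v, _ => v x < v y
  | .rel i u, v, _ => (fun j => v (u j)) ∈ S.rel i
  | .top, _, _ => True
  | .app X u, v, V => (fun j => v (u j)) ∈ V X
  | .neg φ, v, V => ¬ φ.Sat S v V
  | .disj φ ψ, v, V => φ.Sat S v V ∨ ψ.Sat S v V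
  | .ex x φ, v, V => ∃ a : S.A, φ.Sat S (Function.update v x a) V
  | .exSO X φ, v, V => ∃ B : Set (Fin X.arity → S.A), φ.Sat S v (Function.update V X B)

def SO.freeFO {R : Signature} : SO R → Set FVar
  | .eq x y => {x, y}
  | .lt x y => {x, y}
  | .rel _ u => Set.range u
  | .top => ∅
  | .app _ u => Set.range u
  | .neg φ => φ.freeFO
  | .disj φ ψ => φ.freeFO ∪ ψ.freeFO
  | .ex x φ => φ.freeFO \ {x}
  | .exSO _ φ => φ.freeFO

def SO.freeSO {R : Signature} : SO R → Set SVar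
  | .eq _ _ => ∅
  | .lt _ _ => ∅
  | .rel _ _ => ∅
  | .top => ∅
  | .app X _ => {X}
  | .neg φ => φ.freeSO
  | .disj φ ψ => φ.freeSO ∪ ψ.freeSO
  | .ex _ φ => φ.freeSO
  | .exSO X φ => φ.freeSO \ {X}

/-! Derived connectives. -/

def SO.conj {R : Signature} (φ ψ : SO R) : SO R := .neg (.disj (.neg φ) (.neg ψ))

def SO.all {R : Signature} (x : FVar) (φ : SO R) : SO R := .neg (.ex x (.neg φ))

/-- `∃ x₁ ⋯ ∃ xₙ φ`. -/
def SO.exs {R : Signature} (xs : List FVar) (φ : SO R) : SO R := xs.foldr SO.ex φ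

/-- `∀ x₁ ⋯ ∀ xₙ φ`. -/
def SO.alls {R : Signature} (xs : List FVar) (φ : SO R) : SO R := xs.foldr SO.all φ

/-- `φ₁ ∨ ⋯ ∨ φₙ`. -/
def SO.bigOr {R : Signature} : List (SO R) → SO R
  | [] => .neg .top
  | [φ] => φ
  | φ :: ψ :: l => .disj φ (SO.bigOr (ψ :: l))

/-- `φ₁ ∧ ⋯ ∧ φₙ`. -/
def SO.bigAnd {R : Signature} : List (SO R) → SO R
  | [] => .top
  | [φ] => φ
  | φ :: ψ :: l => SO.conj φ (SO.bigAnd (ψ :: l))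

/-! ### The Horn fragments -/

/-- First-order formulae over the signature: no second-order variable occurs. -/
def SO.IsFO {R : Signature} : SO R → Prop
  | .eq _ _ => True
  | .lt _ _ => True
  | .rel _ _ => True
  | .top => True
  | .app _ _ => False
  | .neg φ => φ.IsFO
  | .disj φ ψ => φ.IsFO ∧ ψ.IsFO
  | .ex _ φ => φ.IsFO
  | .exSO _ _ => False

/-- Positive literals `X(x̄)`. -/
def SO.IsPosLit {R : Signature} (φ : SO R) : Prop :=
  ∃ (X : SVar) (u : Fin X.arity → FVar), φ = .app X u

/-- Negative literals `∃ v̄ ¬ X(ū, v̄)`, where `v̄` may be empty. -/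
def SO.IsNegLit {R : Signature} (φ : SO R) : Prop :=
  ∃ (X : SVar) (w : Fin X.arity → FVar) (us vs : List FVar),
    List.ofFn w = us ++ vs ∧ φ = SO.exs vs (.neg (.app X w))

/-- Horn clauses `∀ x̄ (φ₁ ∨ ⋯ ∨ φₙ)`: each `φᵢ` is a positive literal, a negative literal or a
first-order formula, and at most one `φᵢ` is a positive literal. -/
def SO.IsHornClause {R : Signature} (φ : SO R) : Prop :=
  ∃ (xs : List FVar) (l : List (SO R)),
    φ = SO.alls xs (SO.bigOr l) ∧
    (∀ ψ ∈ l, ψ.IsPosLit ∨ ψ.IsNegLit ∨ ψ.IsFO) ∧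
    l.Pairwise (fun ψ χ => ¬ (ψ.IsPosLit ∧ χ.IsPosLit))

/-- Horn formulae: conjunctions of Horn clauses. -/
def SO.IsHorn {R : Signature} (φ : SO R) : Prop :=
  ∃ l : List (SO R), φ = SO.bigAnd l ∧ ∀ ψ ∈ l, ψ.IsHornClause

/-- The fragment `∃Horn`: formulae `∃ x̄ ψ` with `ψ` a Horn formula. -/
def ExistsHorn (R : Signature) : Set (SO R) :=
  {φ | ∃ (xs : List FVar) (ψ : SO R), ψ.IsHorn ∧ φ = SO.exs xs ψ}

/-! ### Quantitative second-order logic -/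

/-- Quantitative second-order formulae over a signature. -/
inductive QSO (R : Signature) : Type
  | form (φ : SO R)
  | const (s : ℕ)
  | add (α β : QSO R)
  | mul (α β : QSO R)
  | sumFO (x : FVar) (α : QSO R)
  | prodFO (x : FVar) (α : QSO R)
  | sumSO (X : SVar) (α : QSO R)
  | prodSO (X : SVar) (α : QSO R)

open Classical in
/-- `⟦α⟧(S, v, V)`. -/
noncomputable def QSO.eval {R : Signature} (S : OrdStruct R) :
    QSO R → FAssign S.A → SAssign S.A → ℕ
  | .form φ, v, V => if φ.Sat S v V then 1 else 0
  | .const s, _, _ => s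
  | .add α β, v, V => α.eval S v V + β.eval S v V
  | .mul α β, v, V => α.eval S v V * β.eval S v V
  | .sumFO x α, v, V => ∑ a : S.A, α.eval S (Function.update v x a) V
  | .prodFO x α, v, V => ∏ a : S.A, α.eval S (Function.update v x a) V
  | .sumSO X α, v, V =>
      ∑ B : Set (Fin X.arity → S.A), α.eval S v (Function.update V X B)
  | .prodSO X α, v, V =>
      ∏ B : Set (Fin X.arity → S.A), α.eval S v (Function.update V X B)

def QSO.freeFO {R : Signature} : QSO R → Set FVar
  | .form φ => φ.freeFO
  | .const _ => ∅
  | .add α β => α.freeFO ∪ β.freeFO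
  | .mul α β => α.freeFO ∪ β.freeFO
  | .sumFO x α => α.freeFO \ {x}
  | .prodFO x α => α.freeFO \ {x}
  | .sumSO _ α => α.freeFO
  | .prodSO _ α => α.freeFO

def QSO.freeSO {R : Signature} : QSO R → Set SVar
  | .form φ => φ.freeSO
  | .const _ => ∅
  | .add α β => α.freeSO ∪ β.freeSO
  | .mul α β => α.freeSO ∪ β.freeSO
  | .sumFO _ α => α.freeSO
  | .prodFO _ α => α.freeSO
  | .sumSO X α => α.freeSO \ {X}
  | .prodSO X α => α.freeSO \ {X}

/-- Sentences: no free first-order or second-order variable. -/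
def QSO.IsSentence {R : Signature} (α : QSO R) : Prop := α.freeFO = ∅ ∧ α.freeSO = ∅

/-- `⟦α⟧(S)` for a sentence `α`: the value under an arbitrary assignment
(see `QSO.value_eq` for the independence of the choice). -/
noncomputable def QSO.value {R : Signature} (α : QSO R) (S : OrdStruct R) : ℕ :=
  α.eval S (fun _ => Classical.arbitrary S.A) (fun _ => ∅)

/-- The fragment `ΣQSO(L)`: `α ::= φ | s | α + α | Σx.α | ΣX.α` with `φ ∈ L`. -/
def QSO.IsSigma {R : Signature} (L : Set (SO R)) : QSO R → Prop
  | .form φ => φ ∈ L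
  | .const _ => True
  | .add α β => α.IsSigma L ∧ β.IsSigma L
  | .mul _ _ => False
  | .sumFO _ α => α.IsSigma L
  | .prodFO _ _ => False
  | .sumSO _ α => α.IsSigma L
  | .prodSO _ _ => False

/-- The class of functions on strings defined by the sentences of `ΣQSO(L)`, over all
signatures. -/
def SigmaQSOClass (L : (R : Signature) → Set (SO R)) : Set (List Bool → ℕ) :=
  {f | ∃ (R : Signature) (α : QSO R), α.IsSigma (L R) ∧ α.IsSentence ∧ f = onStrings α.value}

/-! ### Well-definedness of the functions on strings -/

/-- Isomorphisms of ordered structures. -/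
structure OrdStruct.Iso {R : Signature} (S T : OrdStruct R) where
  toOrderIso : S.A ≃o T.A
  map_rel : ∀ i (t : Fin (R.arity i) → S.A),
    t ∈ S.rel i ↔ (fun j => toOrderIso (t j)) ∈ T.rel i

theorem tuples_map {A B : Type} (f : A → B) (l : List A) (k : ℕ) :
    tuples (l.map f) k = (tuples l k).map (fun t j => f (t j)) := by
  induction k with
  | zero =>
    simp only [tuples, List.map_cons, List.map_nil, List.cons.injEq, and_true]
    funext j; exact j.elim0
  | succ k ih =>
    simp only [tuples, List.flatMap_map, List.map_flatMap, ih, List.map_map]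
    congr 1; funext a; congr 1; funext t; funext j
    refine Fin.cases ?_ (fun i => ?_) j <;> simp

theorem mem_tuples {A : Type} {l : List A} (hl : ∀ a, a ∈ l) {k : ℕ} (t : Fin k → A) :
    t ∈ tuples l k := by
  induction k with
  | zero =>
    simp only [tuples, List.mem_singleton]
    funext j; exact j.elim0
  | succ k ih =>
    simp only [tuples, List.mem_flatMap, List.mem_map]
    exact ⟨t 0, hl _, Fin.tail t, ih _, Fin.cons_self_tail t⟩

theorem replicate_false_append_inj {m n : ℕ} {x y : List Bool}
    (h : List.replicate m false ++ true :: x = List.replicate n false ++ true :: y) :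
    m = n ∧ x = y := by
  induction m generalizing n with
  | zero => cases n with
    | zero => simpa using h
    | succ n => simp [List.replicate_succ] at h
  | succ m ih => cases n with
    | zero => simp [List.replicate_succ] at h
    | succ n =>
      simp only [List.replicate_succ, List.cons_append, List.cons.injEq, true_and] at h
      have := ih h
      exact ⟨by rw [this.1], this.2⟩

theorem flatMap_inj_of_length {ι B : Type} {f g : ι → List B} (hl : ∀ i, (f i).length = (g i).length)
    {l : List ι} (h : l.flatMap f = l.flatMap g) : ∀ i ∈ l, f i = g i := by
  induction l with
  | nil => simp
  | cons a l ih =>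
    simp only [List.flatMap_cons] at h
    have := List.append_inj h (hl a)
    intro i hi
    rcases List.mem_cons.1 hi with rfl | hi
    · exact this.1
    · exact ih this.2 i hi

/-- The encoding determines the structure up to isomorphism. -/
theorem OrdStruct.iso_of_enc_eq {R : Signature} {S T : OrdStruct R} (h : S.enc = T.enc) :
    Nonempty (S.Iso T) := by
  classical
  obtain ⟨hn, hr⟩ := replicate_false_append_inj h
  let e : S.A ≃o T.A :=
    (Fintype.orderIsoFinOfCardEq S.A hn).symm.trans (Fintype.orderIsoFinOfCardEq T.A rfl)
  have hsort : (Finset.univ.sort (fun a b : S.A => a ≤ b)).map e =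
      Finset.univ.sort (fun a b : T.A => a ≤ b) := by
    refine List.Perm.eq_of_pairwise (le := fun a b : T.A => a ≤ b)
      (fun a b _ _ h1 h2 => le_antisymm h1 h2) ?_ (Finset.pairwise_sort _ _) ?_
    · rw [List.pairwise_map]
      exact (Finset.pairwise_sort _ _).imp (fun hab => e.monotone hab)
    · rw [List.perm_ext_iff_of_nodup ((Finset.sort_nodup _ _).map e.injective)
        (Finset.sort_nodup _ _)]
      intro a
      simpa using ⟨e.symm a, e.apply_symm_apply a⟩
  rw [← hsort] at hr
  have key := flatMap_inj_of_length (fun i => by simp [tuples_map]) hr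
  refine ⟨⟨e, fun i t => ?_⟩⟩
  have hi := key i (List.mem_finRange i)
  rw [tuples_map, List.map_map, List.map_inj_left] at hi
  have := hi t (mem_tuples (by simp) t)
  simpa using this

theorem SO.sat_iso {R : Signature} {S T : OrdStruct R} (e : S.Iso T) (φ : SO R) :
    ∀ (v : FAssign S.A) (V : SAssign S.A) (w : FAssign T.A) (W : SAssign T.A),
      (∀ x ∈ φ.freeFO, w x = e.toOrderIso (v x)) →
      (∀ X ∈ φ.freeSO, ∀ t, t ∈ V X ↔ (fun j => e.toOrderIso (t j)) ∈ W X) →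
      (φ.Sat S v V ↔ φ.Sat T w W) := by
  induction φ with
  | eq x y =>
    intro v V w W hv _
    simp [SO.Sat, hv x (by simp [SO.freeFO]), hv y (by simp [SO.freeFO])]
  | lt x y =>
    intro v V w W hv _
    simp [SO.Sat, hv x (by simp [SO.freeFO]), hv y (by simp [SO.freeFO])]
  | rel i u =>
    intro v V w W hv _
    have : ∀ j, w (u j) = e.toOrderIso (v (u j)) := fun j => hv _ (by simp [SO.freeFO])
    simp [SO.Sat, this, e.map_rel]
  | top => intro v V w W _ _; simp [SO.Sat]
  | app X u =>
    intro v V w W hv hV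
    have : ∀ j, w (u j) = e.toOrderIso (v (u j)) := fun j => hv _ (by simp [SO.freeFO])
    simp [SO.Sat, this, hV X (by simp [SO.freeSO])]
  | neg φ ih =>
    intro v V w W hv hV
    simp only [SO.Sat]
    exact not_congr (ih v V w W hv hV)
  | disj φ ψ ih1 ih2 =>
    intro v V w W hv hV
    simp only [SO.Sat]
    exact or_congr
      (ih1 v V w W (fun x hx => hv x (Or.inl hx)) (fun X hX => hV X (Or.inl hX)))
      (ih2 v V w W (fun x hx => hv x (Or.inr hx)) (fun X hX => hV X (Or.inr hX)))
  | ex x φ ih =>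
    intro v V w W hv hV
    simp only [SO.Sat]
    refine e.toOrderIso.toEquiv.exists_congr fun a => ih _ _ _ _ (fun y hy => ?_) hV
    by_cases hxy : y = x
    · subst hxy; simp
    · simp [hxy, hv y ⟨hy, hxy⟩]
  | exSO X φ ih =>
    intro v V w W hv hV
    simp only [SO.Sat]
    refine (Equiv.Set.congr (Equiv.arrowCongr (Equiv.refl (Fin X.arity))
      e.toOrderIso.toEquiv)).exists_congr fun B => ih _ _ _ _ hv (fun Y hY t => ?_)
    by_cases hXY : Y = X
    · subst hXY
      simp only [Function.update_self, Equiv.Set.congr_apply]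
      exact (Function.Injective.mem_set_image (Equiv.injective _)).symm
    · simp [hXY, hV Y ⟨hY, hXY⟩]

theorem QSO.eval_iso {R : Signature} {S T : OrdStruct R} (e : S.Iso T) (α : QSO R) :
    ∀ (v : FAssign S.A) (V : SAssign S.A) (w : FAssign T.A) (W : SAssign T.A),
      (∀ x ∈ α.freeFO, w x = e.toOrderIso (v x)) →
      (∀ X ∈ α.freeSO, ∀ t, t ∈ V X ↔ (fun j => e.toOrderIso (t j)) ∈ W X) →
      α.eval S v V = α.eval T w W := by
  have hF : ∀ (x : FVar) (F : Set FVar) (v : FAssign S.A) (w : FAssign T.A) (a : S.A),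
      (∀ y ∈ F \ {x}, w y = e.toOrderIso (v y)) → ∀ y ∈ F,
        Function.update w x (e.toOrderIso a) y = e.toOrderIso (Function.update v x a y) := by
    intro x F v w a hv y hy
    by_cases hxy : y = x
    · subst hxy; simp
    · simp [hxy, hv y ⟨hy, hxy⟩]
  have hS : ∀ (X : SVar) (F : Set SVar) (V : SAssign S.A) (W : SAssign T.A)
      (B : Set (Fin X.arity → S.A)),
      (∀ Y ∈ F \ {X}, ∀ t, t ∈ V Y ↔ (fun j => e.toOrderIso (t j)) ∈ W Y) → ∀ Y ∈ F, ∀ t,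
        t ∈ Function.update V X B Y ↔ (fun j => e.toOrderIso (t j)) ∈
          Function.update W X (Equiv.Set.congr (Equiv.arrowCongr (Equiv.refl (Fin X.arity))
            e.toOrderIso.toEquiv) B) Y := by
    intro X F V W B hV Y hY t
    by_cases hXY : Y = X
    · subst hXY
      simp only [Function.update_self, Equiv.Set.congr_apply]
      exact (Function.Injective.mem_set_image (Equiv.injective _)).symm
    · simp [hXY, hV Y ⟨hY, hXY⟩]
  induction α with
  | form φ =>
    intro v V w W hv hV
    have h := φ.sat_iso e v V w W hv hV
    by_cases hs : φ.Sat S v V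
    · simp [QSO.eval, hs, h.1 hs]
    · simp [QSO.eval, hs, mt h.2 hs]
  | const s => intro v V w W _ _; simp [QSO.eval]
  | add α β ih1 ih2 =>
    intro v V w W hv hV
    simp only [QSO.eval]
    rw [ih1 v V w W (fun x hx => hv x (Or.inl hx)) (fun X hX => hV X (Or.inl hX)),
      ih2 v V w W (fun x hx => hv x (Or.inr hx)) (fun X hX => hV X (Or.inr hX))]
  | mul α β ih1 ih2 =>
    intro v V w W hv hV
    simp only [QSO.eval]
    rw [ih1 v V w W (fun x hx => hv x (Or.inl hx)) (fun X hX => hV X (Or.inl hX)),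
      ih2 v V w W (fun x hx => hv x (Or.inr hx)) (fun X hX => hV X (Or.inr hX))]
  | sumFO x α ih =>
    intro v V w W hv hV
    simp only [QSO.eval]
    exact Fintype.sum_equiv e.toOrderIso.toEquiv _ _ fun a =>
      ih _ _ _ _ (hF x _ v w a hv) hV
  | prodFO x α ih =>
    intro v V w W hv hV
    simp only [QSO.eval]
    exact Fintype.prod_equiv e.toOrderIso.toEquiv _ _ fun a =>
      ih _ _ _ _ (hF x _ v w a hv) hV
  | sumSO X α ih =>
    intro v V w W hv hV
    simp only [QSO.eval]
    exact Fintype.sum_equiv (Equiv.Set.congr (Equiv.arrowCongr (Equiv.refl (Fin X.arity))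
      e.toOrderIso.toEquiv)) _ _ fun B => ih _ _ _ _ hv (hS X _ V W B hV)
  | prodSO X α ih =>
    intro v V w W hv hV
    simp only [QSO.eval]
    exact Fintype.prod_equiv (Equiv.Set.congr (Equiv.arrowCongr (Equiv.refl (Fin X.arity))
      e.toOrderIso.toEquiv)) _ _ fun B => ih _ _ _ _ hv (hS X _ V W B hV)

/-- The value of a sentence does not depend on the assignment. -/
theorem QSO.value_eq {R : Signature} {α : QSO R} (hα : α.IsSentence) (S : OrdStruct R)
    (v : FAssign S.A) (V : SAssign S.A) : α.value S = α.eval S v V :=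
  QSO.eval_iso ⟨OrderIso.refl S.A, fun _ _ => Iff.rfl⟩ α _ _ _ _
    (by simp [hα.1]) (by simp [hα.2])

theorem onStrings_enc {R : Signature} {val : OrdStruct R → ℕ}
    (hval : ∀ S T : OrdStruct R, S.Iso T → val S = val T) (S : OrdStruct R) :
    onStrings val S.enc = val S := by
  have h : ∃ T : OrdStruct R, T.enc = S.enc := ⟨S, rfl⟩
  rw [onStrings, dif_pos h]
  obtain ⟨e⟩ := OrdStruct.iso_of_enc_eq h.choose_spec
  exact hval _ _ e

/-- The string function of a sentence `α` sends `enc(S)` to `⟦α⟧(S)`. -/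
theorem QSO.onStrings_value_enc {R : Signature} {α : QSO R} (hα : α.IsSentence)
    (S : OrdStruct R) : onStrings α.value S.enc = α.value S :=
  onStrings_enc (fun _ _ e => QSO.eval_iso e α _ _ _ _ (by simp [hα.1]) (by simp [hα.2])) S

/-! ### Disjunctions of Horn formulae and `#DisjHornSAT` -/

/-- A propositional clause over the variables `X`: the disjunction of the variables in `pos` and
the negations of the variables in `neg`. -/
@[ext]
structure PropClause (X : Type) where
  pos : Set X
  neg : Set X

/-- A Horn clause has at most one positive literal. -/
def PropClause.IsHorn {X : Type} (C : PropClause X) : Prop := C.pos.Subsingleton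

/-- Truth of a clause under the assignment that makes exactly the variables in `τ` true. -/
def PropClause.Holds {X : Type} (C : PropClause X) (τ : Set X) : Prop :=
  (∃ x ∈ C.pos, x ∈ τ) ∨ ∃ x ∈ C.neg, x ∉ τ

/-- The number of satisfying assignments of `⋁_{φ ∈ Φ} ⋀_{C ∈ φ} C` over the (finite) set of
variables `X`. -/
noncomputable def numSat {X : Type} (Φ : Set (Set (PropClause X))) : ℕ :=
  Nat.card {τ : Set X // ∃ φ ∈ Φ, ∀ C ∈ φ, C.Holds τ}

/-- The vocabulary `{P(·,·), N(·,·), V(·), NC(·), D(·,·), <}`. -/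
def dhSig : Signature where
  numRel := 5
  arity := ![2, 2, 1, 1, 2]
  arity_pos := by decide

namespace DisjHorn

variable (S : OrdStruct dhSig)

/-- The variable `x` occurs positively in the clause `c`. -/
def P (c x : S.A) : Prop := ![c, x] ∈ S.rel (0 : Fin 5)

/-- The variable `x` occurs negatively in the clause `c`. -/
def N (c x : S.A) : Prop := ![c, x] ∈ S.rel (1 : Fin 5)

/-- `x` is a propositional variable. -/
def V (x : S.A) : Prop := ![x] ∈ S.rel (2 : Fin 5)

/-- `c` is a clause without positive literals. -/
def NC (c : S.A) : Prop := ![c] ∈ S.rel (3 : Fin 5)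

/-- `c` is a clause of the disjunct `d`. -/
def D (d c : S.A) : Prop := ![d, c] ∈ S.rel (4 : Fin 5)

/-- The clause represented by the element `c`. -/
def clauseOf (c : S.A) : PropClause {x : S.A // V S x} where
  pos := {x | P S c x}
  neg := {x | N S c x}

/-- The formula represented by the structure: the disjunction, over the elements `d` that have a
clause, of the conjunction of the clauses of `d`. -/
def formulaOf : Set (Set (PropClause {x : S.A // V S x})) :=
  {φ | ∃ d, (∃ c, D S d c) ∧ φ = {C | ∃ c, D S d c ∧ C = clauseOf S c}}

/-- The structure encodes a disjunction of Horn formulae. -/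
structure IsInstance : Prop where
  pos_typed : ∀ c x, P S c x → (∃ d, D S d c) ∧ V S x
  neg_typed : ∀ c x, N S c x → (∃ d, D S d c) ∧ V S x
  negative : ∀ c, NC S c ↔ (∃ d, D S d c) ∧ ∀ x, ¬ P S c x
  horn : ∀ φ ∈ formulaOf S, ∀ C ∈ φ, C.IsHorn

open Classical in
/-- The number of satisfying assignments of the disjunction of Horn formulae encoded by the
structure (and `0` if it does not encode one). -/
noncomputable def count : ℕ := if IsInstance S then numSat (formulaOf S) else 0

theorem numSat_formulaOf : numSat (formulaOf S) = Nat.card {τ : Set {x : S.A // V S x} //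
    ∃ d, (∃ c, D S d c) ∧ ∀ c, D S d c → (clauseOf S c).Holds τ} := by
  unfold numSat
  congr 1
  congr 1
  funext τ
  refine propext ⟨?_, ?_⟩
  · rintro ⟨_, ⟨d, hd, rfl⟩, h⟩
    exact ⟨d, hd, fun c hc => h _ ⟨c, hc, rfl⟩⟩
  · rintro ⟨d, hd, h⟩
    refine ⟨_, ⟨d, hd, rfl⟩, ?_⟩
    rintro _ ⟨c, hc, rfl⟩
    exact h c hc

/-- The count is invariant under isomorphism. -/
theorem count_iso {S T : OrdStruct dhSig} (e : S.Iso T) : count S = count T := by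
  set f := e.toOrderIso with hf
  have h2 : ∀ a b : S.A, (fun j => f (![a, b] j)) = ![f a, f b] := by
    intro a b; funext j; fin_cases j <;> rfl
  have h1 : ∀ a : S.A, (fun j => f (![a] j)) = ![f a] := by
    intro a; funext j; fin_cases j; rfl
  have hP : ∀ c x, P S c x ↔ P T (f c) (f x) := fun c x =>
    (e.map_rel (0 : Fin 5) ![c, x]).trans (iff_of_eq
      (congrArg (fun t : Fin 2 → T.A => t ∈ T.rel (0 : Fin 5)) (h2 c x)))
  have hN : ∀ c x, N S c x ↔ N T (f c) (f x) := fun c x =>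
    (e.map_rel (1 : Fin 5) ![c, x]).trans (iff_of_eq
      (congrArg (fun t : Fin 2 → T.A => t ∈ T.rel (1 : Fin 5)) (h2 c x)))
  have hV : ∀ x, V S x ↔ V T (f x) := fun x =>
    (e.map_rel (2 : Fin 5) ![x]).trans (iff_of_eq
      (congrArg (fun t : Fin 1 → T.A => t ∈ T.rel (2 : Fin 5)) (h1 x)))
  have hNC : ∀ x, NC S x ↔ NC T (f x) := fun x =>
    (e.map_rel (3 : Fin 5) ![x]).trans (iff_of_eq
      (congrArg (fun t : Fin 1 → T.A => t ∈ T.rel (3 : Fin 5)) (h1 x)))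
  have hD : ∀ d c, D S d c ↔ D T (f d) (f c) := fun d c =>
    (e.map_rel (4 : Fin 5) ![d, c]).trans (iff_of_eq
      (congrArg (fun t : Fin 2 → T.A => t ∈ T.rel (4 : Fin 5)) (h2 d c)))
  have hinst : ∀ U : OrdStruct dhSig, IsInstance U ↔
      (∀ c x, P U c x → (∃ d, D U d c) ∧ V U x) ∧ (∀ c x, N U c x → (∃ d, D U d c) ∧ V U x) ∧
      (∀ c, NC U c ↔ (∃ d, D U d c) ∧ ∀ x, ¬ P U c x) ∧
      (∀ d c, D U d c → ∀ x, V U x → ∀ y, V U y → P U c x → P U c y → x = y) := by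
    intro U
    constructor
    · rintro ⟨a, b, c, h⟩
      refine ⟨a, b, c, fun d k hk x hx y hy hpx hpy => ?_⟩
      have := h _ ⟨d, ⟨k, hk⟩, rfl⟩ _ ⟨k, hk, rfl⟩ (x := ⟨x, hx⟩) hpx (y := ⟨y, hy⟩) hpy
      exact congrArg Subtype.val this
    · rintro ⟨a, b, c, h⟩
      refine ⟨a, b, c, ?_⟩
      rintro _ ⟨d, -, rfl⟩ _ ⟨k, hk, rfl⟩ x hx y hy
      exact Subtype.ext (h d k hk x.1 x.2 y.1 y.2 hx hy)
  have hI : IsInstance S ↔ IsInstance T := by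
    rw [hinst, hinst]
    simp only [hP, hN, hV, hNC, hD, f.surjective.forall, f.surjective.exists, f.injective.eq_iff]
  have hc : numSat (formulaOf S) = numSat (formulaOf T) := by
    rw [numSat_formulaOf, numSat_formulaOf]
    let g : {x : S.A // V S x} ≃ {x : T.A // V T x} := f.toEquiv.subtypeEquiv hV
    refine Nat.card_congr ((Equiv.Set.congr g).subtypeEquiv fun τ => ?_)
    have hH : ∀ c, (clauseOf S c).Holds τ ↔ (clauseOf T (f c)).Holds (Equiv.Set.congr g τ) := by
      intro c
      simp only [PropClause.Holds, g.surjective.exists, Equiv.Set.congr_apply,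
        g.injective.mem_set_image]
      exact or_congr (exists_congr fun x => and_congr_left fun _ => hP c x.1)
        (exists_congr fun x => and_congr_left fun _ => hN c x.1)
    simp only [hH, hD, f.surjective.forall, f.surjective.exists]
  classical
  simp only [count, hI, hc]

end DisjHorn

/-- `#DisjHornSAT`: the number of satisfying assignments of the disjunction of Horn formulae that
a string encodes (and `0` on strings that do not encode one). -/
noncomputable def sharpDisjHornSAT : List Bool → ℕ := onStrings DisjHorn.count

/-- `#DisjHornSAT` sends `enc(S)` to the number of satisfying assignments for `S`. -/
theorem sharpDisjHornSAT_enc (S : OrdStruct dhSig) :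
    sharpDisjHornSAT S.enc = DisjHorn.count S :=
  onStrings_enc (fun _ _ e => DisjHorn.count_iso e) S

/-! ### Parsimonious reductions and completeness -/

/-- `h` is computable in polynomial time by a (multi-stack) Turing machine. -/
def PolyTimeComputable (h : List Bool → List Bool) : Prop :=
  Nonempty (Turing.TM2ComputableInPolyTime (id : List Bool → List Bool) id h)

def ParsimoniouslyReducible (f g : List Bool → ℕ) : Prop :=
  ∃ h : List Bool → List Bool, PolyTimeComputable h ∧ ∀ x, f x = g (h x)

/-- `g` is complete for the class `C` under parsimonious reductions. -/
def ParsimoniouslyComplete (C : Set (List Bool → ℕ)) (g : List Bool → ℕ) : Prop :=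
  g ∈ C ∧ ∀ f ∈ C, ParsimoniouslyReducible f g

/-! Membership. Sum over the set `T` of true variables and state, for an existentially chosen
disjunct `d`, that all clauses of `d` hold. The obstacle is that "some `x` with `N(c,x)` is false"
is an existential over a conjunction, hence not a negative literal. A second relation `W` is
therefore summed as well, and Horn clauses force `W(c,x)` to be equivalent to `N(c,x) → T(x)`. The
condition becomes the negative literal `∃x ¬W(c,x)`, and since `T` determines `W`, the extra sum
does not change the count (`sat_fSat`, `value_qsoCount`).

Hardness, normal form. By induction on `α`, the value of `α` is the number of families of relations
satisfying a disjunction of existentially quantified Horn formulae, called branches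
(`exists_nform`). `ΣX` makes `X` one more counted relation. `Σx` makes `x` existential and records
it in a counted unary relation forced to be `{x}`, so that different values of `x` give different
families. A sum is a disjoint union: a counted nullary relation tells the summands apart, and the
relations of the other summand are forced to be empty. All these constraints are Horn.

Hardness, grounding. Over a fixed structure, a propositional variable is a counted relation with a
tuple, a disjunct is a branch with values for its existential variables, and a clause is a Horn
clause with values for its existential and universal variables. Instances with a true first-order
part are dropped; a literal `∃v ¬X(u,v)` turns into several negated variables. The models of the
resulting disjunction of propositional Horn formulae are exactly the families counted
(`card_models`). Since a disjunct is represented only if it owns a clause, each branch first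
receives a clause without first-order part (`exists_closed_branches`).

Hardness, complexity. Variables, clauses and disjuncts are numbered in mixed radix below `M * (M * n
^ K)`, and membership in each relation of the output is decided by quantifiers bounded by `n`. The
output is thus written by a fixed program of nested bounded loops. Such programs are compiled to
stack programs with unary registers and these to Turing machines, with polynomial step bounds
(`OExp.polyTimeComputable`). Strings that encode no structure are sent to the empty string, where
both functions vanish. -/

/-! ### Structured programs over stacks of bits -/

/-- Structured programs acting on stacks of bits indexed by `ι`. -/
inductive StackProg (ι : Type) : Type
  | skip
  | push (k : ι) (a : Bool)
  | seq (p q : StackProg ι)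
  | pop (k : ι) (body : Option Bool → StackProg ι)
  | loop (k : ι) (body : Bool → StackProg ι)

namespace StackProg

variable {ι : Type}

/-- `p.Runs s s' t`: started with the stacks `s`, the program `p` ends after `t` steps with the
stacks `s'`. -/
inductive Runs [DecidableEq ι] :
    StackProg ι → (ι → List Bool) → (ι → List Bool) → ℕ → Prop
  | skip (s) : Runs skip s s 1
  | push (k a s) : Runs (push k a) s (Function.update s k (a :: s k)) 1
  | seq {p q s s' s'' t t'} : Runs p s s' t → Runs q s' s'' t' → Runs (seq p q) s s'' (t + t')
  | pop {k body s s' t} :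
      Runs (body (s k).head?) (Function.update s k (s k).tail) s' t → Runs (pop k body) s s' (1 + t)
  | loop_nil {k body s} : s k = [] → Runs (loop k body) s s 1
  | loop_cons {k body s s' s'' t t' a l} : s k = a :: l →
      Runs (body a) (Function.update s k l) s' t → Runs (loop k body) s' s'' t' →
      Runs (loop k body) s s'' (1 + t + t')

/-- The labels of the machine that runs a program. -/
def Lab : StackProg ι → Type
  | skip => Unit
  | push _ _ => Unit
  | seq p q => p.Lab ⊕ q.Lab
  | pop _ body => Option (Σ o, (body o).Lab)
  | loop _ body => Option (Σ b, (body b).Lab)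

instance fintypeLab : (p : StackProg ι) → Fintype p.Lab
  | skip => inferInstanceAs (Fintype Unit)
  | push _ _ => inferInstanceAs (Fintype Unit)
  | seq p q =>
    have := p.fintypeLab
    have := q.fintypeLab
    inferInstanceAs (Fintype (p.Lab ⊕ q.Lab))
  | pop _ body =>
    have := fun o => (body o).fintypeLab
    inferInstanceAs (Fintype (Option (Σ o, (body o).Lab)))
  | loop _ body =>
    have := fun o => (body o).fintypeLab
    inferInstanceAs (Fintype (Option (Σ b, (body b).Lab)))

/-- The label at which a program starts. -/
def start : (p : StackProg ι) → p.Lab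
  | skip => ()
  | push _ _ => ()
  | seq p _ => Sum.inl p.start
  | pop _ _ => none
  | loop _ _ => none

/-- The machine code of a program, with labels embedded by `emb` and control passing to `exit` at
the end. -/
def code {K Λ : Type} (f : ι → K) : (p : StackProg ι) → (p.Lab → Λ) → Λ → p.Lab →
    Turing.TM2.Stmt (fun _ : K => Bool) Λ (Option Bool)
  | skip, _, exit, _ => .goto fun _ => exit
  | push k a, _, exit, _ => .push (f k) (fun _ => a) (.goto fun _ => exit)
  | seq p q, emb, exit, l =>
    match l with
    | Sum.inl l => p.code f (fun l => emb (Sum.inl l)) (emb (Sum.inr q.start)) l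
    | Sum.inr l => q.code f (fun l => emb (Sum.inr l)) exit l
  | pop k body, emb, exit, l =>
    match l with
    | none => .pop (f k) (fun _ o => o) (.goto fun o => emb (some ⟨o, (body o).start⟩))
    | some ⟨o, l⟩ => (body o).code f (fun l => emb (some ⟨o, l⟩)) exit l
  | loop k body, emb, exit, l =>
    match l with
    | none => .pop (f k) (fun _ o => o)
        (.goto fun o => o.elim exit fun b => emb (some ⟨b, (body b).start⟩))
    | some ⟨b, l⟩ => (body b).code f (fun l => emb (some ⟨b, l⟩)) (emb none) l

/-- The stacks used by a program. -/
def usedStacks [DecidableEq ι] : StackProg ι → Finset ι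
  | skip => ∅
  | push k _ => {k}
  | seq p q => p.usedStacks ∪ q.usedStacks
  | pop k body => insert k (Finset.univ.biUnion fun o => (body o).usedStacks)
  | loop k body => insert k (Finset.univ.biUnion fun b => (body b).usedStacks)

theorem iterate_flip_bind_add {C : Type} {g : C → Option C} {a b c : C} {m n : ℕ}
    (h : (flip bind g)^[m] (some a) = some b) (h' : (flip bind g)^[n] (some b) = some c) :
    (flip bind g)^[m + n] (some a) = some c := by
  rw [Nat.add_comm, Function.iterate_add_apply, h, h']

/-- A machine has finitely many stacks while `ι` may be infinite, so configurations are restricted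
to a finite set `U` containing the stacks in use. -/
theorem update_restrict [DecidableEq ι] {U : Finset ι} (s : ι → List Bool) {k : ι} (hk : k ∈ U)
    (l : List Bool) : (fun i : {i // i ∈ U} => Function.update s k l i) =
      Function.update (fun i : {i // i ∈ U} => s i) ⟨k, hk⟩ l := by
  funext i
  by_cases h : i = ⟨k, hk⟩
  · subst h; simp
  · rw [Function.update_of_ne h, Function.update_of_ne (fun h' => h (Subtype.ext h'))]

/-- The machine code simulates the program. -/
theorem Runs.simulate [DecidableEq ι] {U : Finset ι} {f : ι → {i // i ∈ U}}
    (hf : ∀ k (hk : k ∈ U), f k = ⟨k, hk⟩) {p : StackProg ι} {s s' : ι → List Bool} {t : ℕ}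
    (h : p.Runs s s' t) : ∀ {Λ : Type} (M : Λ → Turing.TM2.Stmt (fun _ => Bool) Λ (Option Bool))
      (emb : p.Lab → Λ) (exit : Λ), p.usedStacks ⊆ U → (∀ l, M (emb l) = p.code f emb exit l) →
      ∀ v, ∃ v', (flip bind (Turing.TM2.step M))^[t]
        (some ⟨some (emb p.start), v, fun i => s i⟩) = some ⟨some exit, v', fun i => s' i⟩ := by
  -- The whole machine `M`, the embedding of labels and the exit label stay universally quantified:
  -- subprograms run inside the same machine with other exits. The internal state `v` is arbitrary
  -- at entry because every branching is preceded by a pop that overwrites it.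
  induction h with
  | skip s =>
    intro Λ M emb exit _ hM v
    exact ⟨v, by simp [flip, hM, code]⟩
  | push k a s =>
    intro Λ M emb exit hU hM v
    have hk : k ∈ U := hU (by simp [usedStacks])
    refine ⟨v, ?_⟩
    rw [update_restrict s hk]
    simp [flip, hM, code, hf k hk]
  | @seq p q s s' s'' t t' _ _ ih1 ih2 =>
    intro Λ M emb exit hU hM v
    obtain ⟨v1, h1⟩ := ih1 M (fun l => emb (Sum.inl l)) (emb (Sum.inr q.start))
      (fun x hx => hU (Finset.mem_union_left _ hx)) (fun l => hM (Sum.inl l)) v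
    obtain ⟨v2, h2⟩ := ih2 M (fun l => emb (Sum.inr l)) exit
      (fun x hx => hU (Finset.mem_union_right _ hx)) (fun l => hM (Sum.inr l)) v1
    exact ⟨v2, iterate_flip_bind_add h1 h2⟩
  | @pop k body s s' t _ ih =>
    intro Λ M emb exit hU hM v
    have hk : k ∈ U := hU (by simp [usedStacks])
    obtain ⟨v1, h1⟩ := ih M (fun l => emb (some ⟨_, l⟩)) exit
      (fun x hx => hU (Finset.mem_insert_of_mem (Finset.mem_biUnion.2 ⟨_, Finset.mem_univ _, hx⟩)))
      (fun l => hM (some ⟨_, l⟩)) (s k).head?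
    refine ⟨v1, iterate_flip_bind_add (m := 1) ?_ h1⟩
    have h0 : M (emb none) = .pop (f k) (fun _ o => o)
      (.goto fun o => emb (some ⟨o, (body o).start⟩)) := hM none
    rw [update_restrict s hk]
    simp [flip, h0, start, hf k hk]
  | @loop_nil k body s hs =>
    intro Λ M emb exit hU hM v
    have hk : k ∈ U := hU (by simp [usedStacks])
    -- The failing pop leaves `none` in the internal state.
    refine ⟨none, ?_⟩
    have h0 : M (emb none) = .pop (f k) (fun _ o => o)
      (.goto fun o => o.elim exit fun b => emb (some ⟨b, (body b).start⟩)) := hM none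
    have : (Function.update (fun i : {i // i ∈ U} => s i) ⟨k, hk⟩ []) =
        fun i : {i // i ∈ U} => s i := by
      rw [← update_restrict s hk, ← hs, Function.update_eq_self]
    simp [flip, h0, start, hf k hk, hs, this]
  | @loop_cons k body s s' s'' t t' a l hs _ _ ih1 ih2 =>
    intro Λ M emb exit hU hM v
    have hk : k ∈ U := hU (by simp [usedStacks])
    obtain ⟨v1, h1⟩ := ih1 M (fun l => emb (some ⟨_, l⟩)) (emb none)
      (fun x hx => hU (Finset.mem_insert_of_mem (Finset.mem_biUnion.2 ⟨_, Finset.mem_univ _, hx⟩)))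
      (fun l => hM (some ⟨_, l⟩)) (some a)
    obtain ⟨v2, h2⟩ := ih2 M emb exit hU hM v1
    refine ⟨v2, iterate_flip_bind_add (iterate_flip_bind_add (m := 1) ?_ h1) h2⟩
    have h0 : M (emb none) = .pop (f k) (fun _ o => o)
      (.goto fun o => o.elim exit fun b => emb (some ⟨b, (body b).start⟩)) := hM none
    rw [update_restrict s hk]
    simp [flip, h0, start, hf k hk, hs]

/-- The machine running a program with input stack `inp` and output stack `out`. -/
def machine [DecidableEq ι] (p : StackProg ι) (inp out : ι) : Turing.FinTM2 where
  K := {i // i ∈ insert inp (insert out p.usedStacks)}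
  k₀ := ⟨inp, by simp⟩
  k₁ := ⟨out, by simp⟩
  Γ _ := Bool
  Λ := Option p.Lab
  main := some p.start
  σ := Option Bool
  initialState := none
  Γk₀Fin := inferInstanceAs (Fintype Bool)
  m l :=
    match l with
    -- The code only mentions stacks in use, so the `else` value is never reached.
    | some l => p.code (fun k => if h : k ∈ insert inp (insert out p.usedStacks) then ⟨k, h⟩
        else ⟨inp, by simp⟩) some none l
    -- A halting configuration must carry the initial internal state; resetting it costs the one
    -- step added to the time bound.
    | none => .load (fun _ => none) .halt

/-- A function computed by a program within polynomially many steps is computable in polynomial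
time. -/
theorem polyTimeComputable [DecidableEq ι] (p : StackProg ι) (inp out : ι)
    (h : List Bool → List Bool) (q : Polynomial ℕ)
    (hp : ∀ w : List Bool, ∃ t ≤ q.eval w.length,
      p.Runs (Function.update (fun _ => []) inp w) (Function.update (fun _ => []) out (h w)) t) :
    PolyTimeComputable h := by
  choose t ht hrun using hp
  refine ⟨{ tm := p.machine inp out
            inputAlphabet := Equiv.refl Bool
            outputAlphabet := Equiv.refl Bool
            time := q + 1
            outputsFun := fun w => ⟨⟨t w + 1, ?_⟩, by simpa using ht w⟩ }⟩
  obtain ⟨v, hv⟩ := (hrun w).simulate (U := insert inp (insert out p.usedStacks))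
    (f := fun k => if h : k ∈ insert inp (insert out p.usedStacks) then ⟨k, h⟩ else ⟨inp, by simp⟩)
    (fun k hk => by simp only [hk, dif_pos]) (p.machine inp out).m some none
    (fun x hx => by simp [hx]) (fun l => rfl) none
  have hin : Turing.initList (p.machine inp out) w =
      ⟨some (some p.start), none, fun i => Function.update (fun _ => []) inp w i.1⟩ := by
    unfold Turing.initList
    congr 1
    funext ⟨k, hk⟩
    by_cases h' : k = inp
    · subst h'
      rw [Function.update_self]
      exact dif_pos rfl
    · rw [Function.update_of_ne h']
      exact dif_neg fun h'' => h' (congrArg Subtype.val h'')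
  have hout : Turing.haltList (p.machine inp out) (h w) =
      ⟨none, none, fun i => Function.update (fun _ => []) out (h w) i.1⟩ := by
    unfold Turing.haltList
    congr 1
    funext ⟨k, hk⟩
    by_cases h' : k = out
    · subst h'
      rw [Function.update_self]
      exact dif_pos rfl
    · rw [Function.update_of_ne h']
      exact dif_neg fun h'' => h' (congrArg Subtype.val h'')
  have key := iterate_flip_bind_add (n := 1) (c := Turing.haltList (p.machine inp out) (h w)) hv
    (by rw [hout]; rfl)
  simp only [id, Equiv.invFun_as_coe, Equiv.refl_symm, Option.map_some]
  erw [List.map_id, List.map_id, hin]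
  exact key

end StackProg

/-! ### Step bounds for stack programs -/

namespace StackProg

variable {ι : Type} [DecidableEq ι]

/-- `p` leads from `s` to `s'` within `T` steps. -/
def RunsIn (p : StackProg ι) (s s' : ι → List Bool) (T : ℕ) : Prop := ∃ t ≤ T, p.Runs s s' t

theorem RunsIn.mono {p : StackProg ι} {s s' : ι → List Bool} {T T' : ℕ} (h : p.RunsIn s s' T)
    (hT : T ≤ T') : p.RunsIn s s' T' :=
  let ⟨t, ht, hr⟩ := h
  ⟨t, ht.trans hT, hr⟩

theorem RunsIn.cast {p : StackProg ι} {s s' s'' : ι → List Bool} {T : ℕ} (h : p.RunsIn s s' T)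
    (e : s' = s'') : p.RunsIn s s'' T := e ▸ h

theorem runsIn_skip (s : ι → List Bool) : skip.RunsIn s s 1 := ⟨1, le_rfl, .skip s⟩

theorem runsIn_push (k : ι) (a : Bool) (s : ι → List Bool) :
    (push k a).RunsIn s (Function.update s k (a :: s k)) 1 := ⟨1, le_rfl, .push k a s⟩

theorem RunsIn.seq {p q : StackProg ι} {s s' s'' : ι → List Bool} {T T' : ℕ}
    (h : p.RunsIn s s' T) (h' : q.RunsIn s' s'' T') : (p.seq q).RunsIn s s'' (T + T') :=
  let ⟨_, ht, hr⟩ := h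
  let ⟨_, ht', hr'⟩ := h'
  ⟨_, add_le_add ht ht', .seq hr hr'⟩

theorem RunsIn.pop {k : ι} {body : Option Bool → StackProg ι} {s s' : ι → List Bool} {T : ℕ}
    {o : Option Bool} {l : List Bool} (ho : (s k).head? = o) (hl : (s k).tail = l)
    (h : (body o).RunsIn (Function.update s k l) s' T) : (pop k body).RunsIn s s' (1 + T) := by
  subst ho hl
  obtain ⟨t, ht, hr⟩ := h
  exact ⟨1 + t, by omega, .pop hr⟩

/-- `f i` is the configuration after `i` rounds, so the loop stack must then hold the last part of
`l`. A round costs one pop and at most `C` steps for the body, and the last, failing pop costs one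
more. -/
theorem RunsIn.loop {k : ι} {body : Bool → StackProg ι} {C : ℕ} : ∀ (l : List Bool)
    (f : ℕ → ι → List Bool), (∀ i ≤ l.length, f i k = l.drop i) →
    (∀ (i : ℕ) (h : i < l.length),
      (body l[i]).RunsIn (Function.update (f i) k (l.drop (i + 1))) (f (i + 1)) C) →
    (loop k body).RunsIn (f 0) (f l.length) (l.length * (C + 1) + 1)
  | [], f, h0, _ => ⟨1, by simp, .loop_nil (by simpa using h0 0 (by simp))⟩
  | a :: l, f, h0, hb => by
    obtain ⟨t', ht', hr'⟩ := RunsIn.loop l (fun i => f (i + 1))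
      (fun i hi => by simpa using h0 (i + 1) (by simpa using hi))
      (fun i hi => hb (i + 1) (Nat.succ_lt_succ hi))
    obtain ⟨t, ht, hr⟩ := hb 0 (by simp)
    refine ⟨1 + t + t', ?_, .loop_cons (h0 0 (by simp)) hr hr'⟩
    simp only [List.length_cons, Nat.add_mul]
    omega

/-- Move the content of one stack to another one, reversing it. -/
def move (k k' : ι) : StackProg ι := loop k fun b => push k' b

theorem runsIn_move {k k' : ι} (hk : k ≠ k') (s : ι → List Bool) :
    (move k k').RunsIn s
      (Function.update (Function.update s k []) k' ((s k).reverse ++ s k'))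
      (2 * (s k).length + 1) := by
  have := RunsIn.loop (k := k) (body := fun b => push k' b) (C := 1) (s k)
    (fun i => Function.update (Function.update s k ((s k).drop i)) k'
      (((s k).take i).reverse ++ s k'))
    (fun i _ => by simp [hk])
    (fun i hi => by
      refine (runsIn_push _ _ _).cast ?_
      funext z
      by_cases h1 : z = k'
      · subst h1
        simp only [ne_eq, hk.symm, not_false_eq_true, Function.update_of_ne, Function.update_self]
        rw [List.take_add_one, List.getElem?_eq_getElem hi, Option.toList_some,
          List.reverse_append, List.reverse_singleton, List.singleton_append, List.cons_append]
      · by_cases h2 : z = k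
        · subst h2; simp [h1]
        · simp [h1, h2])
  simp only [List.drop_zero, Function.update_eq_self, List.take_zero, List.reverse_nil,
    List.nil_append, List.drop_length, List.take_length] at this
  exact this.mono (by omega)

/-- Empty a stack. -/
def clear (k : ι) : StackProg ι := loop k fun _ => skip

theorem runsIn_clear (k : ι) (s : ι → List Bool) :
    (clear k).RunsIn s (Function.update s k []) (2 * (s k).length + 1) := by
  have := RunsIn.loop (k := k) (body := fun _ => skip) (C := 1) (s k)
    (fun i => Function.update s k ((s k).drop i))
    (fun i _ => by simp)
    (fun i hi => (runsIn_skip _).cast (by simp))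
  simp only [List.drop_zero, Function.update_eq_self, List.drop_length] at this
  exact this.mono (by omega)

end StackProg

theorem Polynomial.eval_mono_nat (q : Polynomial ℕ) {a b : ℕ} (h : a ≤ b) :
    q.eval a ≤ q.eval b := by
  rw [Polynomial.eval_eq_sum, Polynomial.eval_eq_sum, Polynomial.sum, Polynomial.sum]
  exact Finset.sum_le_sum fun i _ => Nat.mul_le_mul_left _ (Nat.pow_le_pow_left h i)

/-! ### A language of bounded loops -/

/-- Arithmetic expressions over registers. -/
inductive AExp : Type
  | var (x : ℕ)
  | const (k : ℕ)
  | add (a b : AExp)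
  | mul (a b : AExp)

/-- The value of an arithmetic expression. -/
def AExp.eval (E : ℕ → ℕ) : AExp → ℕ
  | .var x => E x
  | .const k => k
  | .add a b => a.eval E + b.eval E
  | .mul a b => a.eval E * b.eval E

/-- Tests on registers and on an input string. -/
inductive BExp : Type
  | lt (a b : AExp)
  | bit (a : AExp)
  | not (b : BExp)
  | or (b c : BExp)
  | ex (x : ℕ) (a : AExp) (b : BExp)

/-- Truth of a test on the input `w` and the registers `E`. -/
def BExp.Holds (w : List Bool) : BExp → (ℕ → ℕ) → Prop
  | .lt a b, E => a.eval E < b.eval E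
  | .bit a, E => w.getD (a.eval E) false = true
  | .not b, E => ¬ b.Holds w E
  | .or b c, E => b.Holds w E ∨ c.Holds w E
  | .ex x a b, E => ∃ i < a.eval E, b.Holds w (Function.update E x i)

/-- Programs that write a string. -/
inductive OExp : Type
  | bit (b : BExp)
  | seq (p q : OExp)
  | guard (b : BExp) (p : OExp)
  | loop (x : ℕ) (a : AExp) (p : OExp)

open Classical in
/-- The string written by a program. -/
noncomputable def OExp.eval (w : List Bool) : OExp → (ℕ → ℕ) → List Bool
  | .bit b, E => [decide (b.Holds w E)]
  | .seq p q, E => p.eval w E ++ q.eval w E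
  | .guard b p, E => if b.Holds w E then p.eval w E else []
  | .loop x a p, E => (List.range (a.eval E)).flatMap fun i => p.eval w (Function.update E x i)

/-- The stacks of the machines that run such programs. -/
inductive Stk : Type
  | inp | out | bits | aux | flag | copy | rev
  | var (x : ℕ)
  | tmp (j : ℕ)
  deriving DecidableEq

open StackProg

/-- The stacks `s` hold the registers `E` in unary, and the temporary stacks from `d` on are
empty. -/
structure Holding (s : Stk → List Bool) (E : ℕ → ℕ) (d : ℕ) : Prop where
  var : ∀ x, s (.var x) = List.replicate (E x) true
  copy : s .copy = []
  tmp : ∀ j, d ≤ j → s (.tmp j) = []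

/-- Stacks other than those handled by `Holding`. -/
def Stk.Free (d : ℕ) : Stk → Prop
  | .var _ => False
  | .copy => False
  | .tmp j => j < d
  | _ => True

theorem Holding.update {s : Stk → List Bool} {E : ℕ → ℕ} {d d' : ℕ} (h : Holding s E d) {c : Stk}
    (hc : c.Free d') (hd : d ≤ d') (l : List Bool) : Holding (Function.update s c l) E d' where
  var x := by
    rw [Function.update_of_ne (by rintro rfl; exact hc)]
    exact h.var x
  copy := by
    rw [Function.update_of_ne (by rintro rfl; exact hc)]
    exact h.copy
  tmp j hj := by
    rw [Function.update_of_ne (by rintro rfl; exact absurd hc (by simpa [Stk.Free] using hj))]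
    exact h.tmp j (hd.trans hj)

theorem Stk.Free.mono {d d' : ℕ} (hd : d ≤ d') {c : Stk} (h : c.Free d) : c.Free d' := by
  cases c <;> simp_all [Stk.Free]
  omega

/-- Push the unary value of an expression on the stack `c`. -/
def AExp.prog : AExp → ℕ → Stk → StackProg Stk
  | .var x, _, c => (StackProg.loop (.var x) fun _ => (push .copy true).seq (push c true)).seq
      (move .copy (.var x))
  | .const k, _, c => (List.replicate k (push c true)).foldr StackProg.seq skip
  | .add a b, d, c => (a.prog d c).seq (b.prog d c)
  | .mul a b, d, c => (a.prog (d + 1) (.tmp d)).seq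
      (StackProg.loop (.tmp d) fun _ => b.prog (d + 1) c)

/-- Loop counters are bounded by values of expressions, so this keeps registers, and hence running
times, polynomial under nesting. -/
theorem AExp.eval_le (e : AExp) : ∃ q : Polynomial ℕ, ∀ (M : ℕ) (E : ℕ → ℕ), (∀ x, E x ≤ M) →
    e.eval E ≤ q.eval M := by
  induction e with
  | var x => exact ⟨Polynomial.X, fun M E h => by simpa [AExp.eval] using h x⟩
  | const k => exact ⟨Polynomial.C k, fun M E h => by simp [AExp.eval]⟩
  | add a b iha ihb =>
    obtain ⟨q, hq⟩ := iha
    obtain ⟨r, hr⟩ := ihb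
    exact ⟨q + r, fun M E h => by simpa [AExp.eval] using add_le_add (hq M E h) (hr M E h)⟩
  | mul a b iha ihb =>
    obtain ⟨q, hq⟩ := iha
    obtain ⟨r, hr⟩ := ihb
    exact ⟨q * r, fun M E h => by simpa [AExp.eval] using Nat.mul_le_mul (hq M E h) (hr M E h)⟩

/-- The number `d` is the first temporary stack not in use. A register is drained into `c` and
`copy` and then restored from `copy`; a product uses `tmp d` as a counter for the first factor and
pushes the second factor once per round. The polynomial depends only on the expression, not on `d`
or `c`. -/
theorem AExp.runsIn_prog (e : AExp) : ∃ q : Polynomial ℕ, ∀ (M : ℕ) (E : ℕ → ℕ) (d : ℕ) (c : Stk)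
    (s : Stk → List Bool), (∀ x, E x ≤ M) → Holding s E d → c.Free d →
    (e.prog d c).RunsIn s (Function.update s c (List.replicate (e.eval E) true ++ s c))
      (q.eval M) := by
  induction e with
  | var x =>
    -- Draining takes `3 * E x + 1` steps and moving the copy back `2 * E x + 1`.
    refine ⟨5 * Polynomial.X + 2, fun M E d c s hE hs hc => ?_⟩
    have hcx : c ≠ .var x := by rintro rfl; exact hc
    have hcc : c ≠ .copy := by rintro rfl; exact hc
    have h1 := RunsIn.loop (k := Stk.var x)
      (body := fun _ => (push .copy true).seq (push c true)) (C := 2)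
      (List.replicate (E x) true)
      (fun i => Function.update (Function.update (Function.update s (.var x)
        (List.replicate (E x - i) true)) .copy (List.replicate i true)) c
        (List.replicate i true ++ s c))
      (fun i _ => by simp [hcx.symm])
      (fun i hi => by
        refine ((runsIn_push _ _ _).seq (runsIn_push _ _ _)).cast ?_
        funext z
        by_cases h1 : z = c
        · subst h1
          simp [hcx, hcc, List.replicate_succ]
        · by_cases h2 : z = .copy
          · subst h2; simp [h1, List.replicate_succ]
          · by_cases h3 : z = .var x
            · subst h3; simp [h1]
            · simp [h1, h2, h3])
    have h2 := runsIn_move (k := Stk.copy) (k' := .var x) (by simp)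
      (Function.update (Function.update (Function.update s (.var x) []) .copy
        (List.replicate (E x) true)) c (List.replicate (E x) true ++ s c))
    simp only [List.length_replicate, Nat.sub_self, List.replicate_zero] at h1
    have hs0 : Function.update (Function.update (Function.update s (Stk.var x)
        (List.replicate (E x - 0) true)) Stk.copy []) c ([] ++ s c) = s := by
      rw [Nat.sub_zero, ← hs.var x, Function.update_eq_self, ← hs.copy, Function.update_eq_self,
        hs.copy, List.nil_append, Function.update_eq_self]
    rw [hs0] at h1
    refine ((h1.seq h2).cast ?_).mono ?_
    · funext z
      by_cases h1 : z = c
      · subst h1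
        simp [hcx, hcc, AExp.eval]
      · by_cases h2 : z = .copy
        · subst h2; simp [h1, hs.copy]
        · by_cases h3 : z = .var x
          · subst h3; simp [h1, hcc.symm, hs.var]
          · simp [h1, h2, h3]
    · have := hE x
      simp [hcc.symm]
      omega
  | const k =>
    refine ⟨Polynomial.C (k + 1), fun M E d c s hE hs hc => ?_⟩
    simp only [AExp.prog, AExp.eval, Polynomial.eval_C]
    clear hs
    induction k generalizing s with
    | zero => simpa using runsIn_skip s
    | succ k ih =>
      rw [List.replicate_succ, List.foldr_cons]
      refine (((runsIn_push c true s).seq (ih _)).cast ?_).mono (by omega)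
      simp only [Function.update_idem, Function.update_self]
      congr 1
      simp [List.replicate_succ', List.append_assoc]
  | add a b iha ihb =>
    obtain ⟨q, hq⟩ := iha
    obtain ⟨r, hr⟩ := ihb
    refine ⟨q + r, fun M E d c s hE hs hc => ?_⟩
    refine (((hq M E d c s hE hs hc).seq
      (hr M E d c _ hE (hs.update hc le_rfl _) hc)).cast ?_).mono (by simp)
    simp only [Function.update_idem, Function.update_self, AExp.eval]
    rw [← List.append_assoc, ← List.replicate_add, Nat.add_comm]
  | mul a b iha ihb =>
    obtain ⟨q, hq⟩ := iha
    obtain ⟨r, hr⟩ := ihb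
    obtain ⟨u, hu⟩ := a.eval_le
    refine ⟨q + (u * (r + 1) + 1), fun M E d c s hE hs hc => ?_⟩
    have hcd : c ≠ .tmp d := by rintro rfl; simp [Stk.Free] at hc
    have htd : (Stk.tmp d).Free (d + 1) := by simp [Stk.Free]
    have h1 := hq M E (d + 1) (.tmp d) s hE ⟨hs.var, hs.copy, fun j hj => hs.tmp j (by omega)⟩ htd
    have h2 := RunsIn.loop (k := Stk.tmp d) (body := fun _ => b.prog (d + 1) c)
      (C := r.eval M) (List.replicate (a.eval E) true)
      (fun i => Function.update (Function.update s (.tmp d)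
        (List.replicate (a.eval E - i) true)) c (List.replicate (i * b.eval E) true ++ s c))
      (fun i _ => by simp [hcd.symm])
      (fun i hi => by
        refine (hr M E (d + 1) c _ hE ?_ (hc.mono (Nat.le_succ d))).cast ?_
        · exact ((hs.update htd (Nat.le_succ d) _).update (hc.mono (Nat.le_succ d)) le_rfl
            _).update htd le_rfl _
        · funext z
          by_cases h1 : z = c
          · subst h1
            simp only [Function.update_self, ne_eq, hcd, not_false_eq_true, Function.update_of_ne]
            rw [← List.append_assoc, ← List.replicate_add, Nat.succ_mul, Nat.add_comm]
          · by_cases h2 : z = .tmp d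
            · subst h2; simp [h1]
            · simp [h1, h2])
    simp only [List.length_replicate, Nat.sub_self, List.replicate_zero, Nat.sub_zero, Nat.zero_mul,
      List.nil_append] at h2
    have e0 : Function.update (Function.update s (Stk.tmp d) (List.replicate (a.eval E) true)) c
        (s c) = Function.update s (Stk.tmp d)
          (List.replicate (a.eval E) true ++ s (Stk.tmp d)) := by
      rw [hs.tmp d le_rfl, List.append_nil]
      funext z
      by_cases h1 : z = c
      · subst h1; simp [hcd]
      · simp [h1]
    rw [e0] at h2
    refine ((h1.seq h2).cast ?_).mono ?_
    · rw [← hs.tmp d le_rfl, Function.update_eq_self]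
      rfl
    · have := hu M E hE
      simp only [Polynomial.eval_add, Polynomial.eval_mul, Polynomial.eval_one]
      gcongr

/-- Run `body` with the register `x` taking the values below the value of `a`. -/
def boundedLoop (x : ℕ) (a : AExp) (d : ℕ) (body : StackProg Stk) : StackProg Stk :=
  (a.prog (d + 1) (.tmp d)).seq <| (move (.var x) (.tmp (d + 1))).seq <|
    (StackProg.loop (.tmp d) fun _ => body.seq (push (.var x) true)).seq <|
      (clear (.var x)).seq (move (.tmp (d + 1)) (.var x))

/-- The counter occupies `tmp d` and the former value of the register `x` is saved on `tmp (d + 1)`,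
which leaves the temporaries from `d + 2` on to the body. `acc i` is the content of the result stack
`c` after `i` rounds. Inside the loop `x` stays below the value of `a`, so the registers are bounded
by `M + a.eval E`. -/
theorem runsIn_boundedLoop (x : ℕ) (a : AExp) (r : Polynomial ℕ) : ∃ q : Polynomial ℕ,
    ∀ (M : ℕ) (E : ℕ → ℕ) (d : ℕ) (body : StackProg Stk) (c : Stk) (s : Stk → List Bool)
      (acc : ℕ → List Bool), (∀ y, E y ≤ M) → Holding s E d → c.Free d → acc 0 = s c →
      (∀ i < a.eval E, ∀ s' : Stk → List Bool, Holding s' (Function.update E x i) (d + 2) →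
        (∀ z, z ≠ c → z.Free d → s' z = s z) → s' c = acc i →
        (∀ y, Function.update E x i y ≤ M + a.eval E) →
        body.RunsIn s' (Function.update s' c (acc (i + 1))) (r.eval (M + a.eval E))) →
      (boundedLoop x a d body).RunsIn s (Function.update s c (acc (a.eval E))) (q.eval M) := by
  obtain ⟨qa, hqa⟩ := a.runsIn_prog
  obtain ⟨u, hu⟩ := a.eval_le
  -- The summands are the costs of evaluating `a`, saving `x`, the loop, clearing `x` and restoring
  -- it. A round costs two steps besides the body: the pop of the counter and the increment of `x`.
  refine ⟨qa + (2 * Polynomial.X + 1) + (u * (r.comp (Polynomial.X + u) + 2) + 1) + (2 * u + 1) +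
    (2 * Polynomial.X + 1), ?_⟩
  intro M E d body c s acc hE hs hc hacc hbody
  have hN := hu M E hE
  have hN1 := hqa M E (d + 1) (.tmp d) s hE ⟨hs.var, hs.copy, fun j hj => hs.tmp j (by omega)⟩
    (by simp [Stk.Free])
  set N := a.eval E with hNdef
  have hcx : c ≠ .var x := by rintro rfl; exact hc
  have hcd : c ≠ .tmp d := by rintro rfl; simp [Stk.Free] at hc
  have hcd' : c ≠ .tmp (d + 1) := by rintro rfl; simp [Stk.Free] at hc
  have hcc : c ≠ .copy := by rintro rfl; exact hc
  -- The configuration after `i` rounds: `x` is `i`, the counter is `N - i`, and the old value of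
  -- `x` is put aside.
  let f : ℕ → Stk → List Bool := fun i => Function.update (Function.update (Function.update
    (Function.update s c (acc i)) (.var x) (List.replicate i true)) (.tmp d)
      (List.replicate (N - i) true)) (.tmp (d + 1)) (List.replicate (E x) true)
  have h2 := runsIn_move (k := Stk.var x) (k' := .tmp (d + 1)) (by simp)
    (Function.update s (Stk.tmp d) (List.replicate N true ++ s (Stk.tmp d)))
  have e0 : Function.update (Function.update (Function.update s (Stk.tmp d)
      (List.replicate N true ++ s (Stk.tmp d))) (Stk.var x) []) (Stk.tmp (d + 1))
      ((Function.update s (Stk.tmp d) (List.replicate N true ++ s (Stk.tmp d)) (Stk.var x)).reverse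
        ++ Function.update s (Stk.tmp d) (List.replicate N true ++ s (Stk.tmp d))
          (Stk.tmp (d + 1))) = f 0 := by
    funext z
    simp only [f]
    by_cases h1 : z = .tmp (d + 1)
    · subst h1; simp [hs.var, hs.tmp]
    · by_cases h2 : z = .tmp d
      · subst h2; simp [hs.tmp]
      · by_cases h3 : z = .var x
        · subst h3; simp
        · by_cases h4 : z = c
          · subst h4; simp [h1, h2, h3, hacc]
          · simp [h1, h2, h3, h4]
  have h3 := RunsIn.loop (k := Stk.tmp d) (body := fun _ => body.seq (push (.var x) true))
    (C := r.eval (M + N) + 1) (List.replicate N true) f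
    (fun i _ => by simp [f])
    (fun i hi => by
      have hi' : i < N := by simpa using hi
      refine ((hbody i hi' _ ?_ ?_ ?_ ?_).seq (runsIn_push _ _ _)).cast ?_
      · refine ⟨fun y => ?_, ?_, fun j hj => ?_⟩
        · by_cases hy : y = x
          · subst hy; simp [f]
          · have : c ≠ .var y := by rintro rfl; exact hc
            simp [f, hy, this.symm, hs.var]
        · simp [f, hcc.symm, hs.copy]
        · have : c ≠ .tmp j := by rintro rfl; simp [Stk.Free] at hc; omega
          have h1 : j ≠ d := by omega
          have h2 : j ≠ d + 1 := by omega
          simp [f, this.symm, h1, h2, hs.tmp j (by omega)]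
      · intro z hz hzd
        have h1 : z ≠ .tmp d := by rintro rfl; simp [Stk.Free] at hzd
        have h2 : z ≠ .tmp (d + 1) := by rintro rfl; simp [Stk.Free] at hzd
        have h3 : z ≠ .var x := by rintro rfl; exact hzd
        simp [f, hz, h1, h2, h3]
      · simp [f, hcx, hcd, hcd']
      · intro y
        by_cases hy : y = x
        · subst hy; simp; omega
        · have := hE y
          simp [hy]; omega
      · funext z
        simp only [f]
        by_cases h4 : z = c
        · subst h4; simp [hcx, hcd, hcd']
        · by_cases h1 : z = .tmp (d + 1)
          · subst h1; simp [h4]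
          · by_cases h2 : z = .tmp d
            · subst h2; simp [h4]
            · by_cases h3 : z = .var x
              · subst h3; simp [h4, List.replicate_succ]
              · simp [h1, h2, h3, h4])
  simp only [List.length_replicate] at h3
  have h4 := runsIn_clear (Stk.var x) (f N)
  have h5 := runsIn_move (k := Stk.tmp (d + 1)) (k' := .var x) (by simp)
    (Function.update (f N) (.var x) [])
  rw [← e0] at h3
  refine ((hN1.seq (h2.seq (h3.seq (h4.seq h5)))).cast ?_).mono ?_
  · funext z
    simp only [f]
    by_cases h4 : z = c
    · subst h4; simp [hcx, hcd, hcd']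
    · by_cases h1 : z = .tmp (d + 1)
      · subst h1; simp [h4, hs.tmp]
      · by_cases h2 : z = .tmp d
        · subst h2; simp [h4, hs.tmp]
        · by_cases h3 : z = .var x
          · subst h3; simp [h4, hs.var]
          · simp [h1, h2, h3, h4]
  · have hx := hE x
    have hmono : r.eval (M + N) ≤ r.eval (M + u.eval M) :=
      r.eval_mono_nat (Nat.add_le_add_left hN M)
    have : N * (r.eval (M + N) + 2) ≤ u.eval M * (r.eval (M + u.eval M) + 2) :=
      Nat.mul_le_mul hN (by omega)
    simp [f, hs.var, Nat.add_assoc]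
    omega

/-- Push the truth value of a test on the stack `flag`. -/
def BExp.prog : BExp → ℕ → StackProg Stk
  | .lt a b, d => (a.prog (d + 1) (.tmp d)).seq <| (b.prog (d + 2) (.tmp (d + 1))).seq <|
      (StackProg.loop (.tmp d) fun _ => .pop (.tmp (d + 1)) fun _ => skip).seq <|
        .pop (.tmp (d + 1)) fun o => (push .flag o.isSome).seq (clear (.tmp (d + 1)))
  | .bit a, d => (a.prog (d + 1) (.tmp d)).seq <|
      (StackProg.loop (.tmp d) fun _ => .pop .bits fun o => o.elim skip (push .aux)).seq <|
        .seq (.pop .bits fun o => o.elim (push .flag false) fun b => (push .bits b).seq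
          (push .flag b)) (move .aux .bits)
  | .not b, d => (b.prog d).seq (.pop .flag fun o => push .flag !(o.getD false))
  | .or b c, d => (b.prog d).seq <| (c.prog d).seq <|
      .pop .flag fun o => .pop .flag fun o' => push .flag (o.getD false || o'.getD false)
  | .ex x a b, d => (push .flag false).seq <| boundedLoop x a d <| (b.prog (d + 2)).seq <|
      .pop .flag fun o => .pop .flag fun o' => push .flag (o.getD false || o'.getD false)

-- A comparison removes one symbol of `b` for each symbol of `a` and looks whether any is left.
-- Reading a bit shifts the earlier bits to `aux`, inspects the top of `bits` and shifts back. A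
-- bounded quantifier keeps the disjunction over the values tried so far on top of `flag`.
open Classical in
theorem BExp.runsIn_prog (e : BExp) : ∃ q : Polynomial ℕ, ∀ (M : ℕ) (E : ℕ → ℕ) (d : ℕ)
    (s : Stk → List Bool), (∀ x, E x ≤ M) → Holding s E d → s .aux = [] →
    (e.prog d).RunsIn s (Function.update s .flag (decide (e.Holds (s .bits) E) :: s .flag))
      (q.eval M) := by
  induction e with
  | lt a b =>
    obtain ⟨q, hq⟩ := a.runsIn_prog
    obtain ⟨r, hr⟩ := b.runsIn_prog
    obtain ⟨u, hu⟩ := a.eval_le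
    obtain ⟨v, hv⟩ := b.eval_le
    refine ⟨q + r + (3 * u + 1) + (2 * v + 3), fun M E d s hE hs _ => ?_⟩
    have h1 := hq M E (d + 1) (.tmp d) s hE ⟨hs.var, hs.copy, fun j hj => hs.tmp j (by omega)⟩
      (by simp [Stk.Free])
    have h2 := hr M E (d + 2) (.tmp (d + 1)) _ hE
      ((hs.update (c := .tmp d) (d' := d + 2) (by simp [Stk.Free]) (by omega)
        (List.replicate (a.eval E) true ++ s (.tmp d)))) (by simp [Stk.Free])
    have h3 := RunsIn.loop (k := Stk.tmp d)
      (body := fun _ => .pop (.tmp (d + 1)) fun _ => skip) (C := 1 + 1)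
      (List.replicate (a.eval E) true)
      (fun i => Function.update (Function.update s (.tmp d)
        (List.replicate (a.eval E - i) true)) (.tmp (d + 1))
          (List.replicate (b.eval E - i) true))
      (fun i _ => by simp)
      (fun i hi => by
        refine RunsIn.cast (RunsIn.pop rfl rfl (runsIn_skip _)) ?_
        funext z
        by_cases h1 : z = .tmp (d + 1)
        · subst h1; simp [Nat.sub_sub]
        · by_cases h2 : z = .tmp d
          · subst h2; simp
          · simp [h1, h2])
    simp only [List.length_replicate] at h3
    have e1 : Function.update (Function.update s (.tmp d)
        (List.replicate (a.eval E) true ++ s (.tmp d))) (.tmp (d + 1))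
        (List.replicate (b.eval E) true ++ Function.update s (.tmp d)
          (List.replicate (a.eval E) true ++ s (.tmp d)) (.tmp (d + 1))) =
        Function.update (Function.update s (.tmp d)
        (List.replicate (a.eval E - 0) true)) (.tmp (d + 1))
          (List.replicate (b.eval E - 0) true) := by
      simp [hs.tmp]
    rw [e1] at h2
    refine ((h1.seq (h2.seq (h3.seq (RunsIn.pop rfl rfl
      ((runsIn_push _ _ _).seq (runsIn_clear _ _)))))).cast ?_).mono ?_
    · funext z
      by_cases h1 : z = .flag
      · subst h1
        by_cases hab : a.eval E < b.eval E
        · obtain ⟨m, hm⟩ := Nat.exists_eq_add_of_lt hab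
          simp [BExp.Holds, hab, show b.eval E - a.eval E = m + 1 by omega, List.replicate_succ]
        · simp [BExp.Holds, hab, show b.eval E - a.eval E = 0 by omega]
      · by_cases h2 : z = .tmp (d + 1)
        · subst h2; simp [hs.tmp]
        · by_cases h3 : z = .tmp d
          · subst h3; simp [hs.tmp]
          · simp [h1, h2, h3]
    · have := hu M E hE
      have := hv M E hE
      simp
      omega
  | bit a =>
    obtain ⟨q, hq⟩ := a.runsIn_prog
    obtain ⟨u, hu⟩ := a.eval_le
    refine ⟨q + (3 * u + 1) + 3 + (2 * u + 1), fun M E d s hE hs haux => ?_⟩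
    have h1 := hq M E (d + 1) (.tmp d) s hE ⟨hs.var, hs.copy, fun j hj => hs.tmp j (by omega)⟩
      (by simp [Stk.Free])
    have h2 := RunsIn.loop (k := Stk.tmp d)
      (body := fun _ => .pop .bits fun o => o.elim skip (push .aux)) (C := 1 + 1)
      (List.replicate (a.eval E) true)
      (fun i => Function.update (Function.update (Function.update s (.tmp d)
        (List.replicate (a.eval E - i) true)) .bits ((s .bits).drop i)) .aux
          ((s .bits).take i).reverse)
      (fun i _ => by simp)
      (fun i hi => by
        by_cases hl : i < (s .bits).length
        · refine RunsIn.cast (RunsIn.pop (o := some (s .bits)[i])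
            (l := (s .bits).drop (i + 1)) ?_ ?_ (runsIn_push _ _ _)) ?_
          · simp [List.getElem?_eq_getElem hl]
          · simp
          · funext z
            by_cases h1 : z = .aux
            · subst h1
              have := List.take_add_one (l := s .bits) (i := i)
              rw [List.getElem?_eq_getElem hl, Option.toList_some] at this
              simp [this, -List.take_append_getElem]
            · by_cases h2 : z = .bits
              · subst h2; simp
              · by_cases h3 : z = .tmp d
                · subst h3; simp
                · simp [h1, h2, h3]
        -- Past the end of the input nothing is popped or shifted, in accordance with the default
        -- `false` of `getD`.
        · have hd : (s .bits).drop i = [] := List.drop_eq_nil_of_le (by omega)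
          have hd' : (s .bits).drop (i + 1) = [] := List.drop_eq_nil_of_le (by omega)
          have ht : (s .bits).take i = s .bits := List.take_of_length_le (by omega)
          have ht' : (s .bits).take (i + 1) = s .bits := List.take_of_length_le (by omega)
          refine RunsIn.cast (RunsIn.pop (o := none) (l := []) ?_ ?_ (runsIn_skip _)) ?_
          · simp [hd]
          · simp [hd]
          · funext z
            by_cases h1 : z = .aux
            · subst h1; simp [ht, ht']
            · by_cases h2 : z = .bits
              · subst h2; simp [hd']
              · by_cases h3 : z = .tmp d
                · subst h3; simp
                · simp [h1, h2, h3])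
    have e0 : Function.update (Function.update (Function.update s (.tmp d)
        (List.replicate (a.eval E - 0) true)) .bits ((s .bits).drop 0)) .aux
          ((s .bits).take 0).reverse =
        Function.update s (.tmp d) (List.replicate (a.eval E) true ++ s (.tmp d)) := by
      funext z
      by_cases h1 : z = .aux
      · subst h1; simp [haux]
      · by_cases h2 : z = .bits
        · subst h2; simp
        · by_cases h3 : z = .tmp d
          · subst h3; simp [hs.tmp]
          · simp [h1, h2, h3]
    rw [e0] at h2
    simp only [List.length_replicate, Nat.sub_self, List.replicate_zero] at h2
    set s2 := Function.update (Function.update (Function.update s (.tmp d) []) .bits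
      ((s .bits).drop (a.eval E))) .aux ((s .bits).take (a.eval E)).reverse with hs2
    set b := (s .bits).getD (a.eval E) false with hb
    have h3 : (StackProg.pop Stk.bits fun o => o.elim (push .flag false) fun b =>
        (push .bits b).seq (push .flag b)).RunsIn s2
          (Function.update s2 .flag (b :: s .flag)) (1 + (1 + 1)) := by
      by_cases hl : a.eval E < (s .bits).length
      · refine RunsIn.cast (RunsIn.pop (o := some (s .bits)[a.eval E])
          (l := (s .bits).drop (a.eval E + 1)) ?_ ?_
            ((runsIn_push _ _ _).seq (runsIn_push _ _ _))) ?_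
        · simp [hs2, List.getElem?_eq_getElem hl]
        · simp [hs2]
        · rw [hb]
          funext z
          by_cases h1 : z = .flag
          · subst h1; simp [hs2, hl]
          · by_cases h2 : z = .bits
            · subst h2; simp [hs2]
            · simp [h1, h2]
      · have hd : (s .bits).drop (a.eval E) = [] := List.drop_eq_nil_of_le (by omega)
        refine RunsIn.mono (RunsIn.cast (RunsIn.pop (o := none) (l := []) ?_ ?_
          (runsIn_push _ _ _)) ?_) (by omega)
        · simp [hs2, hd]
        · simp [hs2, hd]
        · rw [hb]
          funext z
          by_cases h1 : z = .flag
          · subst h1; simp [hs2, not_lt.1 hl]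
          · by_cases h2 : z = .bits
            · subst h2; simp [hs2, hd]
            · simp [h1, h2]
    refine ((h1.seq (h2.seq (h3.seq (runsIn_move (by simp) _)))).cast ?_).mono ?_
    · funext z
      by_cases h1 : z = .flag
      · subst h1; simp [BExp.Holds, hb]
      · by_cases h2 : z = .bits
        · subst h2; simp [hs2]
        · by_cases h3 : z = .aux
          · subst h3; simp [haux]
          · by_cases h4 : z = .tmp d
            · subst h4; simp [hs.tmp, hs2]
            · simp [h1, h2, h3, h4, hs2]
    · have := hu M E hE
      simp [hs2]
      omega
  | not b ih =>
    obtain ⟨q, hq⟩ := ih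
    refine ⟨q + 2, fun M E d s hE hs haux => ?_⟩
    refine (((hq M E d s hE hs haux).seq (RunsIn.pop rfl rfl (runsIn_push _ _ _))).cast
      ?_).mono (by simp)
    simp only [Function.update_self, List.tail_cons, Function.update_idem, List.head?_cons,
      Option.getD_some, Function.update_eq_self]
    congr 2
    rw [Bool.eq_iff_iff]
    simp only [Bool.not_eq_true', decide_eq_false_iff_not, decide_eq_true_eq]
    rfl
  | or b c ihb ihc =>
    obtain ⟨q, hq⟩ := ihb
    obtain ⟨r, hr⟩ := ihc
    refine ⟨q + r + 3, fun M E d s hE hs haux => ?_⟩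
    refine (((hq M E d s hE hs haux).seq ((hr M E d _ hE (hs.update (c := .flag)
      (by simp [Stk.Free]) le_rfl _) (by simpa using haux)).seq (RunsIn.pop rfl rfl
        (RunsIn.pop rfl rfl (runsIn_push _ _ _))))).cast ?_).mono ?_
    · simp [Bool.or_comm]
      congr 2
      rw [Bool.eq_iff_iff]
      simp only [Bool.or_eq_true, decide_eq_true_eq]
      rfl
    · simp; omega
  | ex x a b ih =>
    obtain ⟨r, hr⟩ := ih
    obtain ⟨q, hq⟩ := runsIn_boundedLoop x a (r + 3)
    refine ⟨q + 1, fun M E d s hE hs haux => ?_⟩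
    -- The symbol `false` pushed first is the empty disjunction, the accumulator for `i = 0`.
    refine (((runsIn_push _ _ _).seq (hq M E d _ .flag _
      (fun i => decide (∃ j < i, b.Holds (s .bits) (Function.update E x j)) :: s .flag) hE
        (hs.update (c := .flag) (by simp [Stk.Free]) le_rfl _) (by simp [Stk.Free]) (by simp)
        ?_)).cast ?_).mono ?_
    · intro i hi s' hs' hz hf hM
      have hbits : s' .bits = s .bits := by
        rw [hz _ (by simp) (by simp [Stk.Free])]; simp
      refine (((hr _ _ (d + 2) s' hM hs' ?_).seq (RunsIn.pop rfl rfl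
        (RunsIn.pop rfl rfl (runsIn_push _ _ _)))).cast ?_).mono (by simp)
      · rw [hz _ (by simp) (by simp [Stk.Free])]
        simpa using haux
      · simp only [hf, hbits, Function.update_self, Function.update_idem, List.tail_cons,
          List.head?_cons, Option.getD_some]
        congr 2
        rw [Bool.eq_iff_iff]
        simp only [Bool.or_eq_true, decide_eq_true_eq]
        simp only [Nat.lt_succ_iff_lt_or_eq, or_and_right, exists_or, exists_eq_left]
        exact or_comm
    · simp only [Function.update_idem]
      congr 2
      rw [Bool.eq_iff_iff]
      simp only [decide_eq_true_eq]
      rfl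
    · simp; omega

/-- Push the output of a program on the stack `rev`, in reverse. -/
def OExp.prog : OExp → ℕ → StackProg Stk
  | .bit b, d => (b.prog d).seq (.pop .flag fun o => push .rev (o.getD false))
  | .seq p q, d => (p.prog d).seq (q.prog d)
  | .guard b p, d => (b.prog d).seq (.pop .flag fun o => if o = some true then p.prog d else skip)
  | .loop x a p, d => boundedLoop x a d (p.prog (d + 2))

theorem OExp.runsIn_prog (p : OExp) : ∃ q : Polynomial ℕ, ∀ (M : ℕ) (E : ℕ → ℕ) (d : ℕ)
    (s : Stk → List Bool), (∀ x, E x ≤ M) → Holding s E d → s .aux = [] →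
    (p.prog d).RunsIn s (Function.update s .rev ((p.eval (s .bits) E).reverse ++ s .rev))
      (q.eval M) := by
  classical
  induction p with
  | bit b =>
    obtain ⟨q, hq⟩ := b.runsIn_prog
    refine ⟨q + 2, fun M E d s hE hs haux => ?_⟩
    refine (((hq M E d s hE hs haux).seq (RunsIn.pop rfl rfl (runsIn_push _ _ _))).cast
      ?_).mono (by simp)
    simp [OExp.eval]
  | seq p p' ih ih' =>
    obtain ⟨q, hq⟩ := ih
    obtain ⟨r, hr⟩ := ih'
    refine ⟨q + r, fun M E d s hE hs haux => ?_⟩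
    refine (((hq M E d s hE hs haux).seq (hr M E d _ hE (hs.update (c := .rev)
      (by simp [Stk.Free]) le_rfl _) (by simpa using haux))).cast ?_).mono (by simp)
    simp [OExp.eval]
  | guard b p ih =>
    obtain ⟨q, hq⟩ := b.runsIn_prog
    obtain ⟨r, hr⟩ := ih
    refine ⟨q + r + 2, fun M E d s hE hs haux => ?_⟩
    have h1 := hq M E d s hE hs haux
    have e0 : Function.update (Function.update s .flag (decide (b.Holds (s .bits) E) :: s .flag))
        .flag (s .flag) = s := by simp
    by_cases hb : b.Holds (s .bits) E
    · refine ((h1.seq (RunsIn.pop (o := some true) (l := s .flag) (by simp [hb]) (by simp)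
        (e0.symm ▸ hr M E d s hE hs haux))).cast ?_).mono ?_
      · simp [OExp.eval, hb]
      · simp; omega
    · refine ((h1.seq (RunsIn.pop (o := some false) (l := s .flag) (by simp [hb]) (by simp)
        (e0.symm ▸ runsIn_skip s))).cast ?_).mono ?_
      · simp [OExp.eval, hb]
      · simp
  | loop x a p ih =>
    obtain ⟨r, hr⟩ := ih
    obtain ⟨q, hq⟩ := runsIn_boundedLoop x a r
    refine ⟨q, fun M E d s hE hs haux => ?_⟩
    refine (hq M E d _ .rev s (fun i => ((List.range i).flatMap fun i =>
      p.eval (s .bits) (Function.update E x i)).reverse ++ s .rev) hE hs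
        (by simp [Stk.Free]) (by simp) ?_).cast ?_
    · intro i hi s' hs' hz hf hM
      have hbits : s' .bits = s .bits := hz _ (by simp) (by simp [Stk.Free])
      refine (hr _ _ (d + 2) s' hM hs' ?_).cast ?_
      · rw [hz _ (by simp) (by simp [Stk.Free])]
        exact haux
      · rw [hf, hbits]
        simp [List.range_succ]
    · simp [OExp.eval]

/-- The output is produced in reverse, and the final move that turns it around takes time
proportional to its length. -/
theorem OExp.length_eval_le (p : OExp) : ∃ q : Polynomial ℕ, ∀ (M : ℕ) (w : List Bool)
    (E : ℕ → ℕ), (∀ x, E x ≤ M) → (p.eval w E).length ≤ q.eval M := by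
  induction p with
  | bit b => exact ⟨1, fun M w E _ => by simp [OExp.eval]⟩
  | seq p p' ih ih' =>
    obtain ⟨q, hq⟩ := ih
    obtain ⟨r, hr⟩ := ih'
    exact ⟨q + r, fun M w E h => by simpa [OExp.eval] using add_le_add (hq M w E h) (hr M w E h)⟩
  | guard b p ih =>
    obtain ⟨q, hq⟩ := ih
    refine ⟨q, fun M w E h => ?_⟩
    rw [OExp.eval]
    split_ifs
    · exact hq M w E h
    · simp
  | loop x a p ih =>
    obtain ⟨q, hq⟩ := ih
    obtain ⟨u, hu⟩ := a.eval_le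
    refine ⟨u * q.comp (Polynomial.X + u), fun M w E h => ?_⟩
    have hN := hu M E h
    rw [OExp.eval, List.length_flatMap, Polynomial.eval_mul, Polynomial.eval_comp,
      Polynomial.eval_add, Polynomial.eval_X]
    refine (List.sum_le_card_nsmul _ (q.eval (M + u.eval M)) ?_).trans ?_
    · intro n hn
      obtain ⟨i, hi, rfl⟩ := List.mem_map.1 hn
      refine hq _ _ _ fun y => ?_
      have hi := List.mem_range.1 hi
      have := h y
      by_cases hy : y = x
      · subst hy; simp; omega
      · simp [hy]; omega
    · simpa using Nat.mul_le_mul_right _ hN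

/-- The function computed by a program of bounded loops, with the length of the input in
register `0` and all other registers equal to `0`, is computable in polynomial time. -/
theorem OExp.polyTimeComputable (p : OExp) : PolyTimeComputable fun w =>
    p.eval w (Function.update (fun _ => 0) 0 w.length) := by
  obtain ⟨q, hq⟩ := p.runsIn_prog
  obtain ⟨r, hr⟩ := p.length_eval_le
  -- While the input is read its length is counted in register `0`; two reversals bring it to `bits`
  -- in the original order. At the end `bits` and the register are cleared, because only the output
  -- stack may be non-empty.
  let P : StackProg Stk :=
    (StackProg.loop .inp fun b => (push .aux b).seq (push (.var 0) true)).seq <|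
      (move .aux .bits).seq <| (p.prog 0).seq <| (move .rev .out).seq <|
        (clear .bits).seq (clear (.var 0))
  refine StackProg.polyTimeComputable P .inp .out _
    -- Reading costs `3|w| + 1`; moving to `bits`, clearing `bits` and clearing the register cost
    -- `2|w| + 1` each; moving the output costs twice its length plus one.
    (9 * Polynomial.X + 5 + q + 2 * r) fun w => ?_
  set E : ℕ → ℕ := Function.update (fun _ => 0) 0 w.length with hE
  have hEM : ∀ x, E x ≤ w.length := by
    intro x
    by_cases hx : x = 0
    · subst hx; simp [hE]
    · simp [hE, hx]
  set o := p.eval w E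
  have h1 := RunsIn.loop (k := Stk.inp)
    (body := fun b => (push .aux b).seq (push (.var 0) true)) (C := 2) w
    (fun i => Function.update (Function.update (Function.update (fun _ => []) .inp (w.drop i))
      .aux (w.take i).reverse) (.var 0) (List.replicate i true))
    (fun i _ => by simp)
    (fun i hi => by
      refine ((runsIn_push _ _ _).seq (runsIn_push _ _ _)).cast ?_
      funext z
      by_cases h1 : z = .var 0
      · subst h1; simp [List.replicate_succ]
      · by_cases h2 : z = .aux
        · subst h2
          have := List.take_add_one (l := w) (i := i)
          rw [List.getElem?_eq_getElem hi, Option.toList_some] at this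
          simp [this, -List.take_append_getElem]
        · by_cases h3 : z = .inp
          · subst h3; simp
          · simp [h1, h2, h3])
  have e0 : Function.update (Function.update (Function.update (fun _ => []) Stk.inp (w.drop 0))
      .aux (w.take 0).reverse) (.var 0) (List.replicate 0 true) =
      Function.update (fun _ => []) Stk.inp w := by
    funext z
    by_cases h1 : z = .var 0
    · subst h1; simp
    · by_cases h2 : z = .aux
      · subst h2; simp
      · simp [h1, h2]
  rw [e0] at h1
  let s2 : Stk → List Bool := Function.update (Function.update (fun _ => []) .bits w) (.var 0)
    (List.replicate w.length true)
  have h2 := (runsIn_move (k := Stk.aux) (k' := .bits) (by simp) _).cast (s'' := s2) <| by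
    show Function.update (Function.update (Function.update (Function.update (Function.update
      (fun _ => []) Stk.inp (w.drop w.length)) .aux (w.take w.length).reverse) (.var 0)
        (List.replicate w.length true)) _ _) _ _ = _
    funext z
    simp only [s2]
    by_cases h1 : z = .var 0
    · subst h1; simp
    · by_cases h2 : z = .bits
      · subst h2; simp
      · by_cases h3 : z = .aux
        · subst h3; simp
        · by_cases h4 : z = .inp
          · subst h4; simp
          · simp [h1, h2, h3]
  have h3 := hq w.length E 0 s2 hEM
    ⟨fun x => by by_cases hx : x = 0 <;> simp [s2, hE, hx], by simp [s2], fun j _ => by simp [s2]⟩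
    (by simp [s2])
  have hb : s2 .bits = w := by simp [s2]
  rw [hb] at h3
  obtain ⟨t, ht, hrun⟩ := h1.seq (h2.seq (h3.seq ((runsIn_move (k := Stk.rev) (k' := .out)
    (by simp) _).seq ((runsIn_clear .bits _).seq (runsIn_clear (.var 0) _)))))
  refine ⟨t, ht.trans ?_, ?_⟩
  · have := hr w.length w E hEM
    simp [s2]
    omega
  · convert hrun using 1
    funext z
    simp only [s2]
    by_cases h1 : z = .out
    · subst h1; simp [o]
    · by_cases h2 : z = .var 0
      · subst h2; simp
      · by_cases h3 : z = .bits
        · subst h3; simp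
        · by_cases h4 : z = .rev
          · subst h4; simp
          · simp [h1, h2, h3, h4]

/-! ### Levels -/

/-- `e'` agrees with `e` outside the `k` levels from `d` on. -/
def Extends {A : Type} (d k : ℕ) (e e' : ℕ → A) : Prop := ∀ x, x < d ∨ d + k ≤ x → e' x = e x

theorem Extends.refl {A : Type} (d k : ℕ) (e : ℕ → A) : Extends d k e e := fun _ _ => rfl

theorem extends_zero {A : Type} {d : ℕ} {e e' : ℕ → A} : Extends d 0 e e' ↔ e' = e := by
  refine ⟨fun h => funext fun x => h x (by omega), ?_⟩
  rintro rfl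
  exact Extends.refl _ _ _

theorem extends_succ {A : Type} {d k : ℕ} {e e' : ℕ → A} :
    Extends d (k + 1) e e' ↔ ∃ a, Extends (d + 1) k (Function.update e d a) e' := by
  constructor
  · intro h
    refine ⟨e' d, fun x hx => ?_⟩
    by_cases hxd : x = d
    · subst hxd; simp
    · rw [Function.update_of_ne hxd, h x (by omega)]
  · rintro ⟨a, h⟩ x hx
    rw [h x (by omega), Function.update_of_ne (by omega)]

/-- The variables `xs` are renamed to the levels from `d` on. -/
def bindLevels (ρ : FVar → ℕ) : ℕ → List FVar → FVar → ℕ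
  | _, [] => ρ
  | d, x :: xs => bindLevels (Function.update ρ x d) (d + 1) xs

theorem bindLevels_lt (xs : List FVar) : ∀ (ρ : FVar → ℕ) (d : ℕ), (∀ x, ρ x < d) →
    ∀ x, bindLevels ρ d xs x < d + xs.length := by
  induction xs with
  | nil => exact fun ρ d h => h
  | cons y xs ih =>
    intro ρ d h x
    have := ih (Function.update ρ y d) (d + 1) (fun z => by
      by_cases hz : z = y
      · subst hz; simp
      · rw [Function.update_of_ne hz]; have := h z; omega) x
    rw [List.length_cons]
    rw [bindLevels]
    omega

/-- As `ρ` stays below `d`, the level `d` is fresh, and writing there affects no variable other than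
`x`. -/
theorem update_comp_update {A : Type} {ρ : FVar → ℕ} {d : ℕ} (h : ∀ x, ρ x < d) (e : ℕ → A)
    (x : FVar) (a : A) : Function.update e d a ∘ Function.update ρ x d =
      Function.update (e ∘ ρ) x a := by
  funext y
  by_cases hy : y = x
  · subst hy; simp
  · simp [hy, (h y).ne]

theorem update_lt {ρ : FVar → ℕ} {d : ℕ} (h : ∀ x, ρ x < d) (x y : FVar) :
    Function.update ρ x d y < d + 1 := by
  by_cases hy : y = x
  · subst hy; simp
  · rw [Function.update_of_ne hy]; exact (h y).trans (Nat.lt_succ_self d)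

namespace SO

variable {R : Signature} (S : OrdStruct R)

/-- A block of quantifiers becomes one quantifier over the values at fresh levels. If a variable is
repeated in the block, the last binding wins on both sides and the earlier level is simply not
referred to. -/
theorem sat_exs (φ : SO R) (V : SAssign S.A) (xs : List FVar) : ∀ (ρ : FVar → ℕ) (d : ℕ),
    (∀ x, ρ x < d) → ∀ e : ℕ → S.A, (exs xs φ).Sat S (e ∘ ρ) V ↔
      ∃ e', Extends d xs.length e e' ∧ φ.Sat S (e' ∘ bindLevels ρ d xs) V := by
  induction xs with
  | nil => intro ρ d _ e; simp [exs, extends_zero, bindLevels]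
  | cons x xs ih =>
    intro ρ d h e
    simp only [exs, List.foldr_cons, Sat, List.length_cons, extends_succ, bindLevels]
    simp only [exs] at ih
    simp only [← update_comp_update h, ih _ _ (update_lt h x)]
    constructor
    · rintro ⟨a, e', h1, h2⟩
      exact ⟨e', ⟨a, h1⟩, h2⟩
    · rintro ⟨e', ⟨a, h1⟩, h2⟩
      exact ⟨a, e', h1, h2⟩

theorem sat_alls (φ : SO R) (v : FAssign S.A) (V : SAssign S.A) (xs : List FVar) :
    (alls xs φ).Sat S v V ↔ ¬ (exs xs (neg φ)).Sat S v V := by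
  induction xs generalizing v with
  | nil => simp [exs, alls, Sat]
  | cons x xs ih =>
    simp only [alls, exs] at ih
    simp [exs, alls, all, Sat, ih]

theorem sat_bigOr (v : FAssign S.A) (V : SAssign S.A) : ∀ l : List (SO R),
    (bigOr l).Sat S v V ↔ ∃ φ ∈ l, φ.Sat S v V
  | [] => by simp [bigOr, Sat]
  | [φ] => by simp [bigOr]
  | φ :: ψ :: l => by simp [bigOr, Sat, sat_bigOr v V (ψ :: l)]

theorem sat_bigAnd (v : FAssign S.A) (V : SAssign S.A) : ∀ l : List (SO R),
    (bigAnd l).Sat S v V ↔ ∀ φ ∈ l, φ.Sat S v V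
  | [] => by simp [bigAnd, Sat]
  | [φ] => by simp [bigAnd]
  | φ :: ψ :: l => by
    have := sat_bigAnd v V (ψ :: l)
    simp [bigAnd, conj, Sat, this, not_or]

theorem IsFO.sat_congr {φ : SO R} (h : φ.IsFO) (v : FAssign S.A) (V W : SAssign S.A) :
    φ.Sat S v V ↔ φ.Sat S v W := by
  induction φ generalizing v with
  | eq | lt | rel | top => exact Iff.rfl
  | app | exSO => exact h.elim
  | neg φ ih => exact not_congr (ih h v)
  | disj φ ψ ih1 ih2 => exact or_congr (ih1 h.1 v) (ih2 h.2 v)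
  | ex x φ ih => exact exists_congr fun a => ih h _

end SO

/-! ### A normal form -/

/-- An atom: a predicate symbol applied to levels. -/
structure Atom {P : Type} (ar : P → ℕ) where
  pred : P
  args : List ℕ
  len : args.length = ar pred

/-- A first-order formula with its variables renamed to levels. -/
structure Guard (R : Signature) where
  form : SO R
  ren : FVar → ℕ
  top : ℕ
  ren_lt : ∀ x, ren x < top
  isFO : form.IsFO

/-- The true guard. -/
def Guard.trivial (R : Signature) : Guard R :=
  ⟨.top, fun _ => 0, 1, fun _ => Nat.one_pos, True.intro⟩

/-- The guard saying that two levels have the same value. -/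
def Guard.eq (R : Signature) (a b : ℕ) : Guard R :=
  ⟨.eq 0 1, fun x => if x = 0 then a else b, a + b + 1, fun x => by split_ifs <;> omega, True.intro⟩

/-- A universally quantified Horn clause; a negative literal comes with its number of existential
quantifiers. -/
structure HClause (R : Signature) {P : Type} (ar : P → ℕ) where
  univ : ℕ
  guards : List (Guard R)
  pos : Option (Atom ar)
  negs : List (ℕ × Atom ar)

/-- An existentially quantified conjunction of Horn clauses. -/
structure Branch (R : Signature) {P : Type} (ar : P → ℕ) where
  exis : ℕ
  clauses : List (HClause R ar)

section Semantics

variable {R : Signature} (S : OrdStruct R) {P : Type} {ar : P → ℕ}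

/-- Truth of a guard under an assignment to the levels. -/
def Guard.Sat (g : Guard R) (e : ℕ → S.A) : Prop := g.form.Sat S (e ∘ g.ren) fun _ => ∅

variable {S} (T : P → List S.A → Prop)

/-- Truth of an atom under a valuation. -/
def Atom.Sat (a : Atom ar) (e : ℕ → S.A) : Prop := T a.pred (a.args.map e)

/-- Truth of the matrix of a Horn clause. -/
def HClause.Matrix (c : HClause R ar) (d : ℕ) (e : ℕ → S.A) : Prop :=
  (∃ g ∈ c.guards, g.Sat S e) ∨ (∃ a ∈ c.pos, a.Sat T e) ∨
    ∃ n ∈ c.negs, ∃ e', Extends d n.1 e e' ∧ ¬ n.2.Sat T e'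

/-- Truth of a Horn clause whose free levels are below `d`. -/
def HClause.Sat (c : HClause R ar) (d : ℕ) (e : ℕ → S.A) : Prop :=
  ∀ e', Extends d c.univ e e' → c.Matrix T (d + c.univ) e'

/-- Truth of a branch whose free levels are below `d`. -/
def Branch.Sat (b : Branch R ar) (d : ℕ) (e : ℕ → S.A) : Prop :=
  ∃ e', Extends d b.exis e e' ∧ ∀ c ∈ b.clauses, c.Sat T (d + b.exis) e'

end Semantics

section Map

variable {R : Signature} {P Q : Type} {ar : P → ℕ} {ar' : Q → ℕ} (f : P → Q)
  (hf : ∀ p, ar' (f p) = ar p)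

/-- Rename the predicate symbol of an atom. -/
def Atom.map (a : Atom ar) : Atom ar' := ⟨f a.pred, a.args, a.len.trans (hf a.pred).symm⟩

/-- Rename the predicate symbols of a Horn clause. -/
def HClause.map (c : HClause R ar) : HClause R ar' where
  univ := c.univ
  guards := c.guards
  pos := c.pos.map (Atom.map f hf)
  negs := c.negs.map fun n => (n.1, n.2.map f hf)

/-- Rename the predicate symbols of a branch. -/
def Branch.map (b : Branch R ar) : Branch R ar' := ⟨b.exis, b.clauses.map (HClause.map f hf)⟩

@[simp]
theorem Branch.exis_map (b : Branch R ar) : (b.map f hf).exis = b.exis := rfl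

variable {f hf} {S : OrdStruct R} {T : P → List S.A → Prop} {T' : Q → List S.A → Prop}

theorem HClause.sat_map (hT : ∀ p l, T' (f p) l ↔ T p l) (c : HClause R ar) (d : ℕ)
    (e : ℕ → S.A) : (c.map f hf).Sat T' d e ↔ c.Sat T d e := by
  simp [HClause.Sat, HClause.Matrix, HClause.map, Atom.Sat, Atom.map, hT]

end Map

/-- The relation on lists given by a set of tuples. -/
def tupleRel {A : Type} {k : ℕ} (B : Set (Fin k → A)) (l : List A) : Prop :=
  ∃ t ∈ B, List.ofFn t = l

theorem tupleRel_ofFn {A : Type} {k : ℕ} (B : Set (Fin k → A)) (t : Fin k → A) :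
    tupleRel B (List.ofFn t) ↔ t ∈ B :=
  ⟨fun ⟨_, hu, h⟩ => List.ofFn_injective h ▸ hu, fun h => ⟨t, h, rfl⟩⟩

/-- A normal form: a disjunction of branches, with summation over the predicates `ι`.  Further
predicate symbols are the second-order variables. -/
structure NForm (R : Signature) where
  ι : Type
  [fin : Fintype ι]
  ar : ι → ℕ
  branches : List (Branch R (Sum.elim SVar.arity ar))

attribute [instance] NForm.fin

section

variable {R : Signature} {S : OrdStruct R}

/-- The valuation given by second-order assignments to external and internal predicates. -/
def valuation {ι : Type} {ar : ι → ℕ} (V : SAssign S.A)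
    (τ : (i : ι) → Set (Fin (ar i) → S.A)) : SVar ⊕ ι → List S.A → Prop
  | .inl X => tupleRel (V X)
  | .inr i => tupleRel (τ i)

/-- The number of internal assignments for which some branch is true. -/
noncomputable def NForm.count (F : NForm R) (V : SAssign S.A) (d : ℕ) (e : ℕ → S.A) : ℕ :=
  Nat.card {τ : (i : F.ι) → Set (Fin (F.ar i) → S.A) //
    ∃ b ∈ F.branches, b.Sat (valuation V τ) d e}

end

theorem exists_mem_cons_and {α : Type*} {p : α → Prop} {a : α} {l : List α} :
    (∃ x ∈ a :: l, p x) ↔ p a ∨ ∃ x ∈ l, p x := by simp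

theorem or_or_or_rotate {a b c d : Prop} : a ∨ b ∨ c ∨ d ↔ c ∨ a ∨ b ∨ d := by tauto

/-- An atom for an external predicate. -/
def Atom.external {ι : Type} (ar : ι → ℕ) (X : SVar) (u : Fin X.arity → ℕ) :
    Atom (Sum.elim SVar.arity ar) := ⟨.inl X, List.ofFn u, List.length_ofFn⟩

theorem Atom.sat_external {R : Signature} {S : OrdStruct R} {ι : Type} {ar : ι → ℕ}
    (V : SAssign S.A) (τ : (i : ι) → Set (Fin (ar i) → S.A)) (X : SVar) (u : Fin X.arity → FVar)
    (ρ : FVar → ℕ) (e : ℕ → S.A) : (Atom.external ar X (ρ ∘ u)).Sat (valuation V τ) e ↔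
      (SO.app X u).Sat S (e ∘ ρ) V := by
  simp only [Atom.Sat, Atom.external, valuation, List.map_ofFn, tupleRel_ofFn, SO.Sat]
  rfl

/-! ### Horn formulae in normal form -/

section Leaf

variable {R : Signature} {ι : Type} {ar : ι → ℕ}

/-- Induction on the disjuncts. The normal form has a single slot for a positive atom; the middle
assertion says that it is still free as long as no positive literal has occurred, and the pairwise
condition guarantees this when one arrives. -/
theorem exists_matrix (ρ : FVar → ℕ) (d : ℕ) (hρ : ∀ x, ρ x < d) (l : List (SO R))
    (h1 : ∀ ψ ∈ l, ψ.IsPosLit ∨ ψ.IsNegLit ∨ ψ.IsFO)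
    (h2 : l.Pairwise fun ψ χ => ¬ (ψ.IsPosLit ∧ χ.IsPosLit)) (m : ℕ) :
    ∃ c : HClause R (Sum.elim SVar.arity ar), c.univ = m ∧
      ((∀ ψ ∈ l, ¬ ψ.IsPosLit) → c.pos = none) ∧
      ∀ (S : OrdStruct R) (V : SAssign S.A) (τ : (i : ι) → Set (Fin (ar i) → S.A)) (e : ℕ → S.A),
        c.Matrix (valuation V τ) d e ↔ ∃ ψ ∈ l, ψ.Sat S (e ∘ ρ) V := by
  induction l with
  | nil => exact ⟨⟨m, [], none, []⟩, rfl, fun _ => rfl, by simp [HClause.Matrix]⟩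
  | cons φ l ih =>
    obtain ⟨c, rfl, hc1, hc2⟩ := ih (fun ψ hψ => h1 ψ (List.mem_cons_of_mem _ hψ))
      (List.pairwise_cons.1 h2).2
    by_cases hp : φ.IsPosLit
    · have hn : c.pos = none := hc1 fun ψ hψ hψ' => (List.pairwise_cons.1 h2).1 ψ hψ ⟨hp, hψ'⟩
      obtain ⟨X, u, rfl⟩ := hp
      refine ⟨⟨c.univ, c.guards, some (.external ar X (ρ ∘ u)), c.negs⟩, rfl,
        fun h => absurd ⟨X, u, rfl⟩ (h _ List.mem_cons_self), fun S V τ e => ?_⟩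
      rw [exists_mem_cons_and, ← hc2 S V τ e]
      simp only [HClause.Matrix, hn, Option.mem_def, Option.some.injEq, exists_eq_left',
        Atom.sat_external,
        reduceCtorEq, false_and, exists_false, false_or]
      exact or_left_comm
    by_cases hfo : φ.IsFO
    · refine ⟨⟨c.univ, ⟨φ, ρ, d, hρ, hfo⟩ :: c.guards, c.pos, c.negs⟩, rfl,
        fun h => hc1 fun ψ hψ => h ψ (List.mem_cons_of_mem _ hψ), fun S V τ e => ?_⟩
      rw [exists_mem_cons_and, ← hc2 S V τ e, hfo.sat_congr S _ V fun _ => ∅]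
      simp only [HClause.Matrix, exists_mem_cons_and, Guard.Sat, or_assoc]
    -- The shape of the argument list as `us ++ vs` plays no role: the quantified variables are
    -- renamed to the levels from `d` on, wherever they occur in `w`.
    · obtain ⟨X, w, us, vs, -, rfl⟩ := ((h1 φ List.mem_cons_self).resolve_left hp).resolve_right hfo
      refine ⟨⟨c.univ, c.guards, c.pos,
        (vs.length, .external ar X (bindLevels ρ d vs ∘ w)) :: c.negs⟩, rfl,
        fun h => hc1 fun ψ hψ => h ψ (List.mem_cons_of_mem _ hψ), fun S V τ e => ?_⟩
      rw [exists_mem_cons_and, ← hc2 S V τ e, SO.sat_exs _ _ _ _ _ _ hρ]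
      simp only [HClause.Matrix, exists_mem_cons_and, Atom.sat_external, SO.Sat]
      exact or_or_or_rotate

theorem exists_hclause (ρ : FVar → ℕ) (d : ℕ) (hρ : ∀ x, ρ x < d) (φ : SO R)
    (h : φ.IsHornClause) : ∃ c : HClause R (Sum.elim SVar.arity ar),
      ∀ (S : OrdStruct R) (V : SAssign S.A) (τ : (i : ι) → Set (Fin (ar i) → S.A)) (e : ℕ → S.A),
        c.Sat (valuation V τ) d e ↔ φ.Sat S (e ∘ ρ) V := by
  obtain ⟨xs, l, rfl, h1, h2⟩ := h
  obtain ⟨c, hm, -, hc⟩ := exists_matrix (ar := ar) _ _ (bindLevels_lt xs ρ d hρ) l h1 h2 xs.length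
  refine ⟨c, fun S V τ e => ?_⟩
  rw [SO.sat_alls, SO.sat_exs _ _ _ _ _ _ hρ, HClause.Sat, hm]
  simp [hc, SO.Sat, SO.sat_bigOr]

theorem exists_branch (ρ : FVar → ℕ) (d : ℕ) (hρ : ∀ x, ρ x < d) (φ : SO R)
    (h : φ ∈ ExistsHorn R) : ∃ b : Branch R (Sum.elim SVar.arity ar),
      ∀ (S : OrdStruct R) (V : SAssign S.A) (τ : (i : ι) → Set (Fin (ar i) → S.A)) (e : ℕ → S.A),
        b.Sat (valuation V τ) d e ↔ φ.Sat S (e ∘ ρ) V := by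
  obtain ⟨xs, _, ⟨l, rfl, hl⟩, rfl⟩ := h
  have : ∀ l : List (SO R), (∀ ψ ∈ l, ψ.IsHornClause) →
      ∃ cs : List (HClause R (Sum.elim SVar.arity ar)), ∀ (S : OrdStruct R) (V : SAssign S.A)
        (τ : (i : ι) → Set (Fin (ar i) → S.A)) (e : ℕ → S.A),
        (∀ c ∈ cs, c.Sat (valuation V τ) (d + xs.length) e) ↔
          ∀ ψ ∈ l, ψ.Sat S (e ∘ bindLevels ρ d xs) V := by
    intro l hl
    induction l with
    | nil => exact ⟨[], by simp⟩
    | cons ψ l ih =>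
      obtain ⟨cs, hcs⟩ := ih fun χ hχ => hl χ (List.mem_cons_of_mem _ hχ)
      obtain ⟨c, hc⟩ := exists_hclause (ar := ar) _ _ (bindLevels_lt xs ρ d hρ) ψ
        (hl ψ List.mem_cons_self)
      exact ⟨c :: cs, fun S V τ e => by simp only [List.forall_mem_cons, hcs, hc]⟩
  obtain ⟨cs, hcs⟩ := this l hl
  refine ⟨⟨xs.length, cs⟩, fun S V τ e => ?_⟩
  rw [SO.sat_exs _ _ _ _ _ _ hρ, Branch.Sat]
  simp only [hcs, SO.sat_bigAnd]

end Leaf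

/-! ### Normal forms of quantitative formulae -/

section Cases

variable {R : Signature}

-- With no internal predicates there is exactly one family of relations, so the count is a truth
-- value.
open Classical in
theorem exists_nform_form (ρ : FVar → ℕ) (d : ℕ) (hρ : ∀ x, ρ x < d) (φ : SO R)
    (h : φ ∈ ExistsHorn R) : ∃ F : NForm R, ∀ (S : OrdStruct R) (V : SAssign S.A) (e : ℕ → S.A),
      F.count V d e = if φ.Sat S (e ∘ ρ) V then 1 else 0 := by
  obtain ⟨b, hb⟩ := exists_branch (ι := Empty) (ar := Empty.elim) ρ d hρ φ h
  refine ⟨⟨Empty, Empty.elim, [b]⟩, fun S V e => ?_⟩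
  simp only [NForm.count, List.mem_singleton, exists_eq_left, hb]
  split_ifs with hs
  · simp [hs]
  · simp [hs]

theorem exists_nform_zero (R : Signature) : ∃ F : NForm R, ∀ (S : OrdStruct R) (V : SAssign S.A)
    (d : ℕ) (e : ℕ → S.A), F.count V d e = 0 :=
  ⟨⟨Empty, Empty.elim, []⟩, fun S V d e => by simp [NForm.count]⟩

theorem exists_nform_one (R : Signature) : ∃ F : NForm R, ∀ (S : OrdStruct R) (V : SAssign S.A)
    (d : ℕ) (e : ℕ → S.A), F.count V d e = 1 :=
  ⟨⟨Empty, Empty.elim, [⟨0, []⟩]⟩, fun S V d e => by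
    have : ∃ e' : ℕ → S.A, Extends d 0 e e' := ⟨e, Extends.refl _ _ _⟩
    simp [NForm.count, Branch.Sat, this]⟩

/-- The clause consisting of an atom. -/
def HClause.ofPos {P : Type} {ar : P → ℕ} (a : Atom ar) : HClause R ar := ⟨0, [], some a, []⟩

/-- The clause saying that a predicate is empty, for free levels below `d`. -/
def HClause.ofEmpty {P : Type} (ar : P → ℕ) (d : ℕ) (p : P) : HClause R ar :=
  ⟨ar p, [], none, [(0, ⟨p, List.range' d (ar p), by simp⟩)]⟩

theorem HClause.sat_ofPos {S : OrdStruct R} {P : Type} {ar : P → ℕ} (T : P → List S.A → Prop)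
    (a : Atom ar) (d : ℕ) (e : ℕ → S.A) : (HClause.ofPos (R := R) a).Sat T d e ↔ a.Sat T e := by
  simp [HClause.Sat, HClause.ofPos, HClause.Matrix, extends_zero]

/-- Any tuple can be placed at the levels from `d` on, so a universal clause over these levels
speaks about all tuples. -/
theorem exists_extends_range' {A : Type} (d : ℕ) (l : List A) (e : ℕ → A) :
    ∃ e', Extends d l.length e e' ∧ (List.range' d l.length).map e' = l := by
  induction l generalizing d e with
  | nil => exact ⟨e, Extends.refl _ _ _, by simp⟩
  | cons a l ih =>
    obtain ⟨e', h1, h2⟩ := ih (d + 1) (Function.update e d a)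
    refine ⟨e', extends_succ.2 ⟨a, h1⟩, ?_⟩
    rw [List.length_cons, List.range'_succ, List.map_cons, h2, h1 d (by omega),
      Function.update_self]

theorem HClause.sat_ofEmpty {S : OrdStruct R} {P : Type} (ar : P → ℕ) (T : P → List S.A → Prop)
    (d : ℕ) (p : P) (e : ℕ → S.A) : (HClause.ofEmpty (R := R) ar d p).Sat T d e ↔
      ∀ l, l.length = ar p → ¬ T p l := by
  simp only [HClause.Sat, HClause.ofEmpty, HClause.Matrix, List.mem_singleton,
    exists_eq_left, extends_zero, Atom.Sat]
  constructor
  · intro h l hl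
    obtain ⟨e', h1, h2⟩ := exists_extends_range' d l e
    have := h e' (hl ▸ h1)
    simpa [← hl, h2] using this
  · intro h e' _
    simpa using h _ (by simp)

/-- Add clauses to a branch. -/
def Branch.addClauses {P : Type} {ar : P → ℕ} (b : Branch R ar) (cs : List (HClause R ar)) :
    Branch R ar := ⟨b.exis, cs ++ b.clauses⟩

/-- The added clauses express a condition `q` that does not depend on the existential levels and can
therefore be taken out of the quantifier. -/
theorem Branch.sat_addClauses {S : OrdStruct R} {P : Type} {ar : P → ℕ}
    {T : P → List S.A → Prop} {b : Branch R ar} {cs : List (HClause R ar)} {d : ℕ} {e : ℕ → S.A}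
    {q : Prop} (h : ∀ e', (∀ c ∈ cs, c.Sat T (d + b.exis) e') ↔ q) :
    (b.addClauses cs).Sat T d e ↔ q ∧ b.Sat T d e := by
  simp only [Branch.Sat, Branch.addClauses, List.forall_mem_append, h]
  constructor
  · rintro ⟨e', h1, h2, h3⟩
    exact ⟨h2, e', h1, h3⟩
  · rintro ⟨h2, e', h1, h3⟩
    exact ⟨e', h1, h2, h3⟩

theorem Branch.sat_map {S : OrdStruct R} {P Q : Type} {ar : P → ℕ} {ar' : Q → ℕ} {f : P → Q}
    {hf : ∀ p, ar' (f p) = ar p} {T : P → List S.A → Prop} {T' : Q → List S.A → Prop}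
    (hT : ∀ p l, T' (f p) l ↔ T p l) (b : Branch R ar) (d : ℕ) (e : ℕ → S.A) :
    (b.map f hf).Sat T' d e ↔ b.Sat T d e := by
  simp [Branch.Sat, Branch.map, HClause.sat_map hT]

theorem tupleRel_nil {A : Type} (B : Set (Fin 0 → A)) : tupleRel B [] ↔ B = Set.univ := by
  rw [Set.eq_univ_iff_forall]
  constructor
  · rintro ⟨t, ht, -⟩ u
    rwa [Subsingleton.elim u t]
  · intro h
    exact ⟨Fin.elim0, h _, by simp⟩

theorem forall_not_tupleRel {A : Type} {k : ℕ} (B : Set (Fin k → A)) :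
    (∀ l, l.length = k → ¬ tupleRel B l) ↔ B = ∅ := by
  rw [Set.eq_empty_iff_forall_notMem]
  constructor
  · exact fun h t ht => h (List.ofFn t) (by simp) ⟨t, ht, rfl⟩
  · rintro h l - ⟨t, ht, -⟩
    exact h t ht

theorem tupleRel_singleton {A : Type} (B : Set (Fin 1 → A)) (a : A) :
    tupleRel B [a] ↔ (fun _ => a) ∈ B := by
  have := tupleRel_ofFn B fun _ => a
  rwa [List.ofFn_succ, List.ofFn_zero] at this

theorem tupleRel_unique {A : Type} (B : Set (Fin 1 → A)) (a : A) :
    (tupleRel B [a] ∧ ∀ b, b = a ∨ ¬ tupleRel B [b]) ↔ B = {fun _ => a} := by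
  simp only [tupleRel_singleton, Set.eq_singleton_iff_unique_mem]
  refine and_congr_right fun _ => ⟨fun h t ht => ?_, fun h b => ?_⟩
  · have h2 : t = fun _ => t 0 := funext fun j => by rw [Subsingleton.elim j (0 : Fin 1)]
    rw [h2] at ht ⊢
    rw [(h _).resolve_right (not_not.2 ht)]
  · by_cases hb : (fun _ : Fin 1 => b) ∈ B
    · exact .inl (congrFun (h _ hb) 0)
    · exact .inr hb

/-- The clause saying that a unary predicate holds at most at the level `d`. -/
def HClause.atMost {P : Type} (ar : P → ℕ) (d D : ℕ) (p : P) (h : ar p = 1) : HClause R ar :=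
  ⟨1, [.eq R D d], none, [(0, ⟨p, [D], h.symm⟩)]⟩

/-- Because `d < D`, the universally quantified level `D` does not overwrite the level `d` it is
compared with. -/
theorem HClause.sat_atMost {S : OrdStruct R} {P : Type} (ar : P → ℕ) (T : P → List S.A → Prop)
    {d D : ℕ} (hD : d < D) (p : P) (h : ar p = 1) (e : ℕ → S.A) :
    (HClause.atMost (R := R) ar d D p h).Sat T D e ↔ ∀ a, a = e d ∨ ¬ T p [a] := by
  simp only [HClause.Sat, HClause.atMost, HClause.Matrix, Guard.Sat, Guard.eq, SO.Sat,
    List.mem_singleton, exists_eq_left, extends_zero, Atom.Sat, List.map_cons, List.map_nil,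
    Option.mem_def,
    reduceCtorEq, false_and, exists_false, false_or, Function.comp_apply, if_true, one_ne_zero,
    if_false]
  constructor
  · intro h a
    have := h (Function.update e D a) fun x hx => Function.update_of_ne (by omega) _ _
    rwa [Function.update_self, Function.update_of_ne hD.ne] at this
  · intro h e' he'
    rw [he' d (.inl hD)]
    exact h _

theorem tupleRel_update_self {A : Type} (V : SAssign A) (X : SVar) (B : Set (Fin X.arity → A))
    (l : List A) : tupleRel (Function.update V X B X) l ↔ tupleRel B l := by
  rw [Function.update_self]

theorem tupleRel_update_of_ne {A : Type} (V : SAssign A) {X Y : SVar} (h : Y ≠ X)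
    (B : Set (Fin X.arity → A)) (l : List A) :
    tupleRel (Function.update V X B Y) l ↔ tupleRel (V Y) l := by
  rw [Function.update_of_ne h]

/-- Extend a family of relations by one relation. -/
def consRel {A ι : Type} {k : ℕ} {ar : ι → ℕ} (B : Set (Fin k → A))
    (τ : (i : ι) → Set (Fin (ar i) → A)) :
    (o : Option ι) → Set (Fin (o.elim k ar) → A)
  | none => B
  | some i => τ i

theorem consRel_eta {A ι : Type} {k : ℕ} {ar : ι → ℕ}
    (σ : (o : Option ι) → Set (Fin (o.elim k ar) → A)) : consRel (σ none) (fun i => σ (some i)) = σ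
      := by
  funext o
  cases o <;> rfl

/-- Combine two families of relations. -/
def sumRel {A ι κ : Type} {ar : ι → ℕ} {ar' : κ → ℕ} (τ : (i : ι) → Set (Fin (ar i) → A))
    (σ : (j : κ) → Set (Fin (ar' j) → A)) : (s : ι ⊕ κ) → Set (Fin (Sum.elim ar ar' s) → A)
  | .inl i => τ i
  | .inr j => σ j

/-- The models form a disjoint union. The nullary predicate `none` is full on the branches from `F`
and empty on those from `G`; each branch also forces the predicates of the other summand to be
empty, so that a model of a summand extends in exactly one way. These constraints are a single
positive atom or purely negative clauses, hence Horn. -/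
theorem exists_nform_add (F G : NForm R) (d : ℕ) : ∃ H : NForm R, ∀ (S : OrdStruct R)
    (V : SAssign S.A) (e : ℕ → S.A), H.count V d e = F.count V d e + G.count V d e := by
  let ι := Option (F.ι ⊕ G.ι)
  let ar : ι → ℕ := fun o => o.elim 0 (Sum.elim F.ar G.ar)
  let arS : SVar ⊕ ι → ℕ := Sum.elim SVar.arity ar
  let fF : SVar ⊕ F.ι → SVar ⊕ ι := Sum.map id fun i => some (.inl i)
  let fG : SVar ⊕ G.ι → SVar ⊕ ι := Sum.map id fun i => some (.inr i)
  have hfF : ∀ p, arS (fF p) = Sum.elim SVar.arity F.ar p := by rintro (p | p) <;> rfl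
  have hfG : ∀ p, arS (fG p) = Sum.elim SVar.arity G.ar p := by rintro (p | p) <;> rfl
  refine ⟨⟨ι, ar, F.branches.map (fun b => (b.map fF hfF).addClauses
      (HClause.ofPos ⟨.inr none, [], rfl⟩ :: Finset.univ.toList.map fun j =>
        HClause.ofEmpty arS (d + b.exis) (.inr (some (.inr j))))) ++
    G.branches.map (fun b => (b.map fG hfG).addClauses
      (HClause.ofEmpty arS (d + b.exis) (.inr none) :: Finset.univ.toList.map fun j =>
        HClause.ofEmpty arS (d + b.exis) (.inr (some (.inl j)))))⟩, fun S V e => ?_⟩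
  have hF : ∀ (τ : (i : ι) → Set (Fin (ar i) → S.A)) (b : Branch R (Sum.elim SVar.arity F.ar)),
      ((b.map fF hfF).addClauses (HClause.ofPos ⟨.inr none, [], rfl⟩ ::
        Finset.univ.toList.map fun j =>
          HClause.ofEmpty arS (d + b.exis) (.inr (some (.inr j))))).Sat (valuation V τ) d e ↔
      (τ none = Set.univ ∧ ∀ j, τ (some (.inr j)) = ∅) ∧
        b.Sat (valuation V fun i => τ (some (.inl i))) d e := by
    intro τ b
    rw [Branch.sat_addClauses (q := τ none = Set.univ ∧ ∀ j, τ (some (.inr j)) = ∅),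
      Branch.sat_map (T := valuation V fun i => τ (some (.inl i)))]
    · rintro (p | p) l <;> rfl
    · intro e'
      simp only [List.forall_mem_cons, List.forall_mem_map, Finset.mem_toList, Finset.mem_univ,
        forall_const, HClause.sat_ofPos, Branch.exis_map, HClause.sat_ofEmpty]
      exact and_congr (tupleRel_nil _) (forall_congr' fun j => forall_not_tupleRel _)
  have hG : ∀ (τ : (i : ι) → Set (Fin (ar i) → S.A)) (b : Branch R (Sum.elim SVar.arity G.ar)),
      ((b.map fG hfG).addClauses (HClause.ofEmpty arS (d + b.exis) (.inr none) ::
        Finset.univ.toList.map fun j =>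
          HClause.ofEmpty arS (d + b.exis) (.inr (some (.inl j))))).Sat (valuation V τ) d e ↔
      (τ none = ∅ ∧ ∀ j, τ (some (.inl j)) = ∅) ∧
        b.Sat (valuation V fun i => τ (some (.inr i))) d e := by
    intro τ b
    rw [Branch.sat_addClauses (q := τ none = ∅ ∧ ∀ j, τ (some (.inl j)) = ∅),
      Branch.sat_map (T := valuation V fun i => τ (some (.inr i)))]
    · rintro (p | p) l <;> rfl
    · intro e'
      simp only [List.forall_mem_cons, List.forall_mem_map, Finset.mem_toList, Finset.mem_univ,
        forall_const, Branch.exis_map, HClause.sat_ofEmpty]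
      exact and_congr (forall_not_tupleRel _) (forall_congr' fun j => forall_not_tupleRel _)
  simp only [NForm.count]
  rw [← Nat.card_sum]
  symm
  refine Nat.card_eq_of_bijective (Sum.elim
    (fun τ => ⟨consRel Set.univ (sumRel τ.1 fun _ => ∅), ?_⟩)
    (fun τ => ⟨consRel ∅ (sumRel (fun _ => ∅) τ.1), ?_⟩)) ⟨?_, ?_⟩
  · obtain ⟨b, hb, h⟩ := τ.2
    exact ⟨_, List.mem_append_left _ (List.mem_map_of_mem hb),
      (hF _ b).2 ⟨⟨rfl, fun _ => rfl⟩, h⟩⟩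
  · obtain ⟨b, hb, h⟩ := τ.2
    exact ⟨_, List.mem_append_right _ (List.mem_map_of_mem hb),
      (hG _ b).2 ⟨⟨rfl, fun _ => rfl⟩, h⟩⟩
  -- The tag separates the images of the two summands: there is an empty tuple, so the two nullary
  -- relations differ.
  · have hne : (Set.univ : Set (Fin 0 → S.A)) ≠ ∅ := Set.univ_nonempty.ne_empty
    rintro (τ | τ) (σ | σ) h
    · have h' := congrArg Subtype.val h
      exact congrArg Sum.inl (Subtype.ext (funext fun i => congrFun h' (some (.inl i))))
    · exact absurd (congrFun (congrArg Subtype.val h) none) hne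
    · exact absurd (congrFun (congrArg Subtype.val h) none) hne.symm
    · have h' := congrArg Subtype.val h
      exact congrArg Sum.inr (Subtype.ext (funext fun i => congrFun h' (some (.inr i))))
  · rintro ⟨τ, b', hb', h⟩
    rcases List.mem_append.1 hb' with hb' | hb'
    · obtain ⟨b, hb, rfl⟩ := List.mem_map.1 hb'
      obtain ⟨⟨h1, h2⟩, h3⟩ := (hF τ b).1 h
      refine ⟨.inl ⟨fun i => τ (some (.inl i)), b, hb, h3⟩, Subtype.ext (funext fun o => ?_)⟩
      rcases o with _ | (i | j)
      exacts [h1.symm, rfl, (h2 j).symm]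
    · obtain ⟨b, hb, rfl⟩ := List.mem_map.1 hb'
      obtain ⟨⟨h1, h2⟩, h3⟩ := (hG τ b).1 h
      refine ⟨.inr ⟨fun i => τ (some (.inr i)), b, hb, h3⟩, Subtype.ext (funext fun o => ?_)⟩
      rcases o with _ | (i | j)
      exacts [h1.symm, (h2 i).symm, rfl]

/-- The external predicate `X` is renamed to a new internal one, so that choosing a value for `X` is
part of choosing the family that is counted. -/
theorem exists_nform_sumSO (F : NForm R) (d : ℕ) (X : SVar) : ∃ H : NForm R, ∀ (S : OrdStruct R)
    (V : SAssign S.A) (e : ℕ → S.A),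
      H.count V d e = ∑ B : Set (Fin X.arity → S.A), F.count (Function.update V X B) d e := by
  let ι := Option F.ι
  let ar : ι → ℕ := fun o => o.elim X.arity F.ar
  let f : SVar ⊕ F.ι → SVar ⊕ ι := Sum.elim (fun Y => if Y = X then .inr none else .inl Y)
    fun i => .inr (some i)
  have hf : ∀ p, Sum.elim SVar.arity ar (f p) = Sum.elim SVar.arity F.ar p := by
    rintro (Y | i)
    · by_cases hY : Y = X
      · subst hY; simp [f, ar]
      · simp [f, hY]
    · rfl
  refine ⟨⟨ι, ar, F.branches.map (Branch.map f hf)⟩, fun S V e => ?_⟩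
  have hF : ∀ (τ : (i : ι) → Set (Fin (ar i) → S.A)) (b : Branch R (Sum.elim SVar.arity F.ar)),
      (b.map f hf).Sat (valuation V τ) d e ↔
        b.Sat (valuation (Function.update V X (τ none)) fun i => τ (some i)) d e := by
    intro τ b
    refine Branch.sat_map ?_ b d e
    rintro (Y | i) l
    · by_cases hY : Y = X
      · subst hY
        simp only [f, Sum.elim_inl, if_true]
        exact (tupleRel_update_self V Y _ l).symm
      · simp only [f, Sum.elim_inl, hY, if_false]
        exact (tupleRel_update_of_ne V hY _ l).symm
    · rfl
  simp only [NForm.count, List.mem_map, exists_exists_and_eq_and, hF]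
  rw [← Nat.card_sigma]
  symm
  refine Nat.card_eq_of_bijective (fun p => ⟨consRel p.1 p.2.1, p.2.2⟩) ⟨?_, ?_⟩
  · rintro ⟨B, τ, h⟩ ⟨B', τ', h'⟩ heq
    have h0 := congrArg Subtype.val heq
    obtain rfl : B = B' := congrFun h0 none
    obtain rfl : τ = τ' := funext fun i => congrFun h0 (some i)
    rfl
  · rintro ⟨τ, h⟩
    exact ⟨⟨τ none, fun i => τ (some i), h⟩, Subtype.ext (consRel_eta τ)⟩

/-- Making the level `d` existential would count a family once even if several elements work for it.
A new unary predicate forced to be the singleton of the value at `d`, by the clauses `X(d)` and `∀y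
(y = d ∨ ¬X(y))`, makes the chosen element part of the family. -/
theorem exists_nform_sumFO (F : NForm R) (d : ℕ) : ∃ H : NForm R, ∀ (S : OrdStruct R)
    (V : SAssign S.A) (e : ℕ → S.A),
      H.count V d e = ∑ a : S.A, F.count V (d + 1) (Function.update e d a) := by
  let ι := Option F.ι
  let ar : ι → ℕ := fun o => o.elim 1 F.ar
  let arS : SVar ⊕ ι → ℕ := Sum.elim SVar.arity ar
  let f : SVar ⊕ F.ι → SVar ⊕ ι := Sum.map id some
  have hf : ∀ p, arS (f p) = Sum.elim SVar.arity F.ar p := by rintro (p | p) <;> rfl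
  let cs : ℕ → List (HClause R arS) := fun D =>
    [HClause.ofPos ⟨.inr none, [d], rfl⟩,
      HClause.atMost arS d D (.inr none) rfl]
  refine ⟨⟨ι, ar, F.branches.map fun b =>
    ⟨b.exis + 1, cs (d + 1 + b.exis) ++ (b.map f hf).clauses⟩⟩, fun S V e => ?_⟩
  have hcs : ∀ (τ : (i : ι) → Set (Fin (ar i) → S.A)) (D : ℕ) (e' : ℕ → S.A), d < D →
      ((∀ c ∈ cs D, c.Sat (valuation V τ) D e') ↔ τ none = {fun _ => e' d}) := by
    intro τ D e' hD
    simp only [cs, List.forall_mem_cons, HClause.sat_ofPos, List.not_mem_nil,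
      false_imp_iff, implies_true, and_true]
    exact (and_congr Iff.rfl (HClause.sat_atMost arS (valuation V τ) hD (.inr none) rfl e')).trans
      (tupleRel_unique (τ none) (e' d))
  have hF : ∀ (τ : (i : ι) → Set (Fin (ar i) → S.A)) (b : Branch R (Sum.elim SVar.arity F.ar)),
      Branch.Sat (ar := arS) (R := R) (valuation V τ)
        ⟨b.exis + 1, cs (d + 1 + b.exis) ++ (b.map f hf).clauses⟩ d e ↔
      ∃ a, τ none = {fun _ => a} ∧
        b.Sat (valuation V fun i => τ (some i)) (d + 1) (Function.update e d a) := by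
    intro τ b
    have hT : ∀ p l, valuation V τ (f p) l ↔ valuation V (fun i => τ (some i)) p l := by
      rintro (p | p) l <;> rfl
    simp only [Branch.Sat, List.forall_mem_append, Branch.map, List.forall_mem_map,
      HClause.sat_map hT, extends_succ]
    rw [show d + (b.exis + 1) = d + 1 + b.exis by omega]
    simp only [hcs τ _ _ (show d < d + 1 + b.exis by omega)]
    constructor
    · rintro ⟨e', ⟨a, h1⟩, h2, h3⟩
      rw [h1 d (by omega), Function.update_self] at h2
      exact ⟨a, h2, e', h1, h3⟩
    · rintro ⟨a, h2, e', h1, h3⟩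
      refine ⟨e', ⟨a, h1⟩, ?_, h3⟩
      rw [h1 d (by omega), Function.update_self, h2]
  simp only [NForm.count, List.mem_map, exists_exists_and_eq_and]
  simp only [arS] at hF
  simp only [hF]
  rw [← Nat.card_sigma]
  symm
  refine Nat.card_eq_of_bijective (fun p => ⟨consRel {fun _ => p.1} p.2.1, ?_⟩) ⟨?_, ?_⟩
  · obtain ⟨b, hb, h⟩ := p.2.2
    exact ⟨b, hb, p.1, rfl, h⟩
  · rintro ⟨a, τ, h⟩ ⟨a', τ', h'⟩ heq
    have h0 := congrArg Subtype.val heq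
    have h1 : ({fun _ => a} : Set (Fin 1 → S.A)) = {fun _ => a'} := congrFun h0 none
    obtain rfl : a = a' := congrFun (Set.singleton_injective h1) 0
    obtain rfl : τ = τ' := funext fun i => congrFun h0 (some i)
    rfl
  · rintro ⟨τ, b, hb, a, h1, h2⟩
    refine ⟨⟨a, fun i => τ (some i), b, hb, h2⟩, Subtype.ext ?_⟩
    exact (congrArg (fun B => consRel B fun i => τ (some i)) h1.symm).trans (consRel_eta τ)

end Cases

/-- Every formula of `ΣQSO(∃Horn)` has a normal form. -/
theorem exists_nform {R : Signature} (α : QSO R) (hα : α.IsSigma (ExistsHorn R)) :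
    ∀ (ρ : FVar → ℕ) (d : ℕ), (∀ x, ρ x < d) → ∃ F : NForm R, ∀ (S : OrdStruct R)
      (V : SAssign S.A) (e : ℕ → S.A), α.eval S (e ∘ ρ) V = F.count V d e := by
  induction α with
  | form φ =>
    intro ρ d hρ
    obtain ⟨F, hF⟩ := exists_nform_form ρ d hρ φ hα
    exact ⟨F, fun S V e => by rw [hF, QSO.eval]⟩
  | const s =>
    intro ρ d hρ
    simp only [QSO.eval]
    induction s with
    | zero =>
      obtain ⟨F, hF⟩ := exists_nform_zero R
      exact ⟨F, fun S V e => (hF S V d e).symm⟩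
    | succ s ih =>
      obtain ⟨F, hF⟩ := ih trivial
      obtain ⟨G, hG⟩ := exists_nform_one R
      obtain ⟨H, hH⟩ := exists_nform_add F G d
      exact ⟨H, fun S V e => by rw [hH, hG, ← hF]⟩
  | add α β ih1 ih2 =>
    intro ρ d hρ
    obtain ⟨F, hF⟩ := ih1 hα.1 ρ d hρ
    obtain ⟨G, hG⟩ := ih2 hα.2 ρ d hρ
    obtain ⟨H, hH⟩ := exists_nform_add F G d
    exact ⟨H, fun S V e => by rw [hH, QSO.eval, hF, hG]⟩
  | mul | prodFO | prodSO => exact hα.elim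
  | sumFO x α ih =>
    intro ρ d hρ
    obtain ⟨F, hF⟩ := ih hα (Function.update ρ x d) (d + 1) (update_lt hρ x)
    obtain ⟨H, hH⟩ := exists_nform_sumFO F d
    exact ⟨H, fun S V e => by
      rw [hH, QSO.eval]
      exact Finset.sum_congr rfl fun a _ => by rw [← hF, update_comp_update hρ]⟩
  | sumSO X α ih =>
    intro ρ d hρ
    obtain ⟨F, hF⟩ := ih hα ρ d hρ
    obtain ⟨H, hH⟩ := exists_nform_sumSO F d X
    exact ⟨H, fun S V e => by
      rw [hH, QSO.eval]
      exact Finset.sum_congr rfl fun B _ => hF S _ e⟩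

/-! ### Closed normal forms -/

section Closed

variable {R : Signature} {ι : Type} {ar : ι → ℕ}

/-- The atom, if its predicate is internal. -/
def Atom.internal : Atom (Sum.elim SVar.arity ar) → Option (Atom ar)
  | ⟨.inl _, _, _⟩ => none
  | ⟨.inr i, l, h⟩ => some ⟨i, l, h⟩

/-- Replace the external predicates of a clause by the empty relation. -/
def HClause.closed (c : HClause R (Sum.elim SVar.arity ar)) : HClause R ar where
  univ := c.univ
  guards := c.guards ++ (c.negs.filter fun n => n.2.internal.isNone).map
    fun _ => .trivial R
  pos := c.pos.bind Atom.internal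
  negs := c.negs.filterMap fun n => n.2.internal.map (Prod.mk n.1)

/-- Replace the external predicates of a branch by the empty relation. -/
def Branch.closed (b : Branch R (Sum.elim SVar.arity ar)) : Branch R ar :=
  ⟨b.exis, b.clauses.map HClause.closed⟩

variable {S : OrdStruct R} (τ : (i : ι) → Set (Fin (ar i) → S.A))

theorem Atom.sat_valuation_empty (a : Atom (Sum.elim SVar.arity ar)) (e : ℕ → S.A) :
    a.Sat (valuation (fun _ => ∅) τ) e ↔
      ∃ a' ∈ a.internal, a'.Sat (fun i => tupleRel (τ i)) e := by
  obtain ⟨X | i, l, h⟩ := a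
  · simp [Atom.Sat, Atom.internal, valuation, tupleRel]
  · simp [Atom.Sat, Atom.internal, valuation]

/-- For empty external relations a positive external literal is false and can be omitted, while a
negative one is true, its quantifiers being witnessed by the current values. The latter is replaced
by a true guard. -/
theorem HClause.matrix_closed (c : HClause R (Sum.elim SVar.arity ar)) (d : ℕ) (e : ℕ → S.A) :
    c.closed.Matrix (fun i => tupleRel (τ i)) d e ↔
      c.Matrix (valuation (fun _ => ∅) τ) d e := by
  by_cases h : ∃ n ∈ c.negs, n.2.internal = none
  · obtain ⟨n, hn, hn'⟩ := h
    refine iff_of_true (.inl ⟨.trivial R, ?_, trivial⟩)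
      (.inr (.inr ⟨n, hn, e, Extends.refl _ _ _, ?_⟩))
    · exact List.mem_append_right _ (List.mem_map.2 ⟨n, by simp [hn, hn'], rfl⟩)
    · rw [Atom.sat_valuation_empty, hn']
      simp
  · have hg : (c.negs.filter fun n => n.2.internal.isNone) = [] := by
      rw [List.filter_eq_nil_iff]
      intro n hn h'
      exact h ⟨n, hn, by simpa using h'⟩
    have hp : (∃ a ∈ c.pos.bind Atom.internal, a.Sat (fun i => tupleRel (τ i)) e) ↔
        ∃ a ∈ c.pos, a.Sat (valuation (fun _ => ∅) τ) e := by
      simp only [Atom.sat_valuation_empty, Option.mem_def, Option.bind_eq_some_iff]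
      tauto
    have hn : (∃ n ∈ c.negs.filterMap fun n => n.2.internal.map (Prod.mk n.1),
          ∃ e', Extends d n.1 e e' ∧ ¬ n.2.Sat (fun i => tupleRel (τ i)) e') ↔
        ∃ n ∈ c.negs, ∃ e', Extends d n.1 e e' ∧
          ¬ n.2.Sat (valuation (fun _ => ∅) τ) e' := by
      simp only [Atom.sat_valuation_empty, List.mem_filterMap, Option.map_eq_some_iff]
      constructor
      · rintro ⟨_, ⟨n, hn, a, ha, rfl⟩, e', h1, h2⟩
        exact ⟨n, hn, e', h1, by simpa [ha] using h2⟩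
      · rintro ⟨n, hn, e', h1, h2⟩
        obtain ⟨a, ha⟩ := Option.ne_none_iff_exists'.1 fun h' => h ⟨n, hn, h'⟩
        exact ⟨(n.1, a), ⟨n, hn, a, ha, rfl⟩, e', h1, by simpa [ha] using h2⟩
    simp only [HClause.Matrix, HClause.closed, hg, List.map_nil, List.append_nil, hp, hn]

theorem Branch.sat_closed (b : Branch R (Sum.elim SVar.arity ar)) (d : ℕ) (e : ℕ → S.A) :
    b.closed.Sat (fun i => tupleRel (τ i)) d e ↔
      b.Sat (valuation (fun _ => ∅) τ) d e := by
  have hu : ∀ c : HClause R (Sum.elim SVar.arity ar), c.closed.univ = c.univ := fun _ => rfl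
  simp only [Branch.Sat, Branch.closed, List.forall_mem_map, HClause.Sat, HClause.matrix_closed, hu]

end Closed

/-- The value of a sentence of `ΣQSO(∃Horn)` is the number of models of a disjunction of
branches, each of which has a clause without guards. -/
theorem exists_closed_branches {R : Signature} (α : QSO R) (hα : α.IsSigma (ExistsHorn R))
    (hs : α.IsSentence) : ∃ (ι : Type) (_ : Fintype ι) (ar : ι → ℕ)
      (bs : List (Branch R ar)), (∀ b ∈ bs, ∃ c ∈ b.clauses, c.guards = []) ∧
        ∀ (S : OrdStruct R) (e : ℕ → S.A),
          α.value S = Nat.card {τ : (i : ι) → Set (Fin (ar i) → S.A) //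
            ∃ b ∈ bs, b.Sat (fun i => tupleRel (τ i)) 1 e} := by
  -- A sentence does not depend on the values of its variables, so all of them are sent to the level
  -- `0`; quantified levels start at `1`.
  obtain ⟨F, hF⟩ := exists_nform α hα (fun _ => 0) 1 fun _ => Nat.one_pos
  -- A new nullary predicate, asserted by the guardless clause `z` in every branch. Its value is
  -- forced, so the number of models does not change.
  let ar : Option F.ι → ℕ := fun o => o.elim 0 F.ar
  let z : HClause R ar := HClause.ofPos ⟨none, [], rfl⟩
  refine ⟨Option F.ι, inferInstance, ar, F.branches.map fun b =>
    (b.closed.map some fun _ => rfl).addClauses [z], ?_, fun S e => ?_⟩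
  · intro b hb
    obtain ⟨b, -, rfl⟩ := List.mem_map.1 hb
    exact ⟨z, List.mem_cons_self, rfl⟩
  have hz : ∀ (τ : (i : Option F.ι) → Set (Fin (ar i) → S.A))
      (b : Branch R (Sum.elim SVar.arity F.ar)),
      ((b.closed.map (ar' := ar) some fun _ => rfl).addClauses [z]).Sat
        (fun i => tupleRel (τ i)) 1 e ↔
      τ none = Set.univ ∧ b.Sat (valuation (fun _ => ∅) fun i => τ (some i)) 1 e := by
    intro τ b
    rw [Branch.sat_addClauses (q := τ none = Set.univ)]
    · exact and_congr_right fun _ => (Branch.sat_map (T := fun i => tupleRel (τ (some i)))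
        (fun p l => Iff.rfl) b.closed 1 e).trans (Branch.sat_closed (fun i => τ (some i)) b 1 e)
    · intro e'
      simp only [List.forall_mem_cons, z, HClause.sat_ofPos, List.not_mem_nil, false_imp_iff,
        implies_true, and_true]
      exact tupleRel_nil _
  rw [QSO.value_eq hs S (e ∘ fun _ => 0) fun _ => ∅, hF, NForm.count]
  simp only [List.mem_map, exists_exists_and_eq_and, hz]
  refine Nat.card_eq_of_bijective (fun τ => ⟨consRel Set.univ τ.1, ?_⟩) ⟨?_, ?_⟩
  · obtain ⟨b, hb, h⟩ := τ.2
    exact ⟨b, hb, rfl, h⟩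
  · rintro ⟨τ, h⟩ ⟨τ', h'⟩ heq
    have h0 := congrArg Subtype.val heq
    exact Subtype.ext (funext fun i => congrFun h0 (some i))
  · rintro ⟨τ, b, hb, h1, h2⟩
    refine ⟨⟨fun i => τ (some i), b, hb, h2⟩, Subtype.ext ?_⟩
    exact (congrArg (fun B => consRel B fun i => τ (some i)) h1.symm).trans (consRel_eta τ)

/-! ### Structures coding disjunctions of Horn formulae -/

namespace DisjHorn

/-- Separates the combinatorics from the coding: the structure need only represent an abstract
system of variables, clauses and disjuncts. The three codings are injective separately; one element
may code a variable, a clause and a disjunct at once, since its place in a relation tells its role.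
Clauses in no disjunct are left out, as the typing conditions of `IsInstance` demand. -/
theorem numSat_of_coding (T : OrdStruct dhSig) {Var Cl Dj : Type} (pos neg : Cl → Var → Prop)
    (dis : Dj → Cl → Prop) (fV : Var → T.A) (fC : Cl → T.A) (fD : Dj → T.A)
    (hfV : fV.Injective) (hfC : fC.Injective) (hfD : fD.Injective)
    (hpos : ∀ c x y, pos c x → pos c y → x = y)
    (hP : ∀ a b, P T a b ↔ ∃ c x, fC c = a ∧ fV x = b ∧ (∃ d, dis d c) ∧ pos c x)
    (hN : ∀ a b, N T a b ↔ ∃ c x, fC c = a ∧ fV x = b ∧ (∃ d, dis d c) ∧ neg c x)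
    (hV : ∀ a, V T a ↔ ∃ x, fV x = a)
    (hNC : ∀ a, NC T a ↔ ∃ c, fC c = a ∧ (∃ d, dis d c) ∧ ∀ x, ¬ pos c x)
    (hD : ∀ a b, D T a b ↔ ∃ d c, fD d = a ∧ fC c = b ∧ dis d c) :
    count T = Nat.card {τ : Set Var // ∃ d, (∃ c, dis d c) ∧
      ∀ c, dis d c → (∃ x, pos c x ∧ x ∈ τ) ∨ ∃ x, neg c x ∧ x ∉ τ} := by
  have hP' : ∀ c b, P T (fC c) b ↔ (∃ d, dis d c) ∧ ∃ x, fV x = b ∧ pos c x := by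
    intro c b
    rw [hP]
    constructor
    · rintro ⟨c', x, h1, h2, h3, h4⟩
      obtain rfl := hfC h1
      exact ⟨h3, x, h2, h4⟩
    · rintro ⟨h1, x, h2, h3⟩
      exact ⟨c, x, rfl, h2, h1, h3⟩
  have hN' : ∀ c b, N T (fC c) b ↔ (∃ d, dis d c) ∧ ∃ x, fV x = b ∧ neg c x := by
    intro c b
    rw [hN]
    constructor
    · rintro ⟨c', x, h1, h2, h3, h4⟩
      obtain rfl := hfC h1
      exact ⟨h3, x, h2, h4⟩
    · rintro ⟨h1, x, h2, h3⟩
      exact ⟨c, x, rfl, h2, h1, h3⟩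
  have hcl : ∀ b, (∃ a, D T a b) ↔ ∃ c, fC c = b ∧ ∃ d, dis d c := by
    intro b
    simp only [hD]
    constructor
    · rintro ⟨a, d, c, -, h2, h3⟩
      exact ⟨c, h2, d, h3⟩
    · rintro ⟨c, h2, d, h3⟩
      exact ⟨_, d, c, rfl, h2, h3⟩
  have hI : IsInstance T := by
    refine ⟨fun a b h => ?_, fun a b h => ?_, fun a => ?_, ?_⟩
    · obtain ⟨c, x, rfl, rfl, h1, -⟩ := (hP _ _).1 h
      exact ⟨(hcl _).2 ⟨c, rfl, h1⟩, (hV _).2 ⟨x, rfl⟩⟩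
    · obtain ⟨c, x, rfl, rfl, h1, -⟩ := (hN _ _).1 h
      exact ⟨(hcl _).2 ⟨c, rfl, h1⟩, (hV _).2 ⟨x, rfl⟩⟩
    · rw [hNC, hcl]
      constructor
      · rintro ⟨c, rfl, h1, h2⟩
        exact ⟨⟨c, rfl, h1⟩, fun b hb =>
          let ⟨_, x, _, hx⟩ := (hP' _ _).1 hb
          h2 x hx⟩
      · rintro ⟨⟨c, rfl, h1⟩, h2⟩
        exact ⟨c, rfl, h1, fun x hx => h2 (fV x) ((hP' _ _).2 ⟨h1, x, rfl, hx⟩)⟩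
    · rintro _ ⟨a, -, rfl⟩ _ ⟨b, hb, rfl⟩ ⟨x, hx⟩ hx' ⟨y, hy⟩ hy'
      obtain ⟨c, rfl, -⟩ := (hcl _).1 ⟨a, hb⟩
      obtain ⟨-, x, rfl, h1⟩ := (hP' _ _).1 hx'
      obtain ⟨-, y, rfl, h2⟩ := (hP' _ _).1 hy'
      exact Subtype.ext (congrArg fV (hpos c x y h1 h2))
  rw [count, if_pos hI, numSat_formulaOf]
  let g : Var ≃ {a : T.A // V T a} := Equiv.ofBijective (fun x => ⟨fV x, (hV _).2 ⟨x, rfl⟩⟩)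
    ⟨fun x y h => hfV (congrArg Subtype.val h), fun ⟨a, ha⟩ =>
      let ⟨x, hx⟩ := (hV a).1 ha
      ⟨x, Subtype.ext hx⟩⟩
  symm
  refine Nat.card_congr ((Equiv.Set.congr g).subtypeEquiv fun τ => ?_)
  have hH : ∀ c, (∃ d, dis d c) → ((clauseOf T (fC c)).Holds (Equiv.Set.congr g τ) ↔
      (∃ x, pos c x ∧ x ∈ τ) ∨ ∃ x, neg c x ∧ x ∉ τ) := by
    intro c hc
    simp only [PropClause.Holds, Equiv.Set.congr_apply]
    rw [← g.exists_congr_right, ← g.exists_congr_right]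
    simp only [g.injective.mem_set_image]
    refine or_congr (exists_congr fun x => and_congr_left fun _ => ?_)
      (exists_congr fun x => and_congr_left fun _ => ?_)
    · refine (hP' c (fV x)).trans ⟨?_, fun h => ⟨hc, x, rfl, h⟩⟩
      rintro ⟨-, y, hy, h⟩
      exact hfV hy ▸ h
    · refine (hN' c (fV x)).trans ⟨?_, fun h => ⟨hc, x, rfl, h⟩⟩
      rintro ⟨-, y, hy, h⟩
      exact hfV hy ▸ h
  constructor
  · rintro ⟨d, ⟨c, hc⟩, h⟩
    refine ⟨fD d, ⟨fC c, (hD _ _).2 ⟨d, c, rfl, rfl, hc⟩⟩, fun b hb => ?_⟩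
    obtain ⟨d', c', h1, rfl, h2⟩ := (hD _ _).1 hb
    obtain rfl := hfD h1
    exact (hH c' ⟨_, h2⟩).2 (h c' h2)
  · rintro ⟨a, ⟨b, hb⟩, h⟩
    obtain ⟨d, c, rfl, rfl, hc⟩ := (hD _ _).1 hb
    exact ⟨d, ⟨c, hc⟩, fun c' hc' => (hH c' ⟨d, hc'⟩).1 (h _ ((hD _ _).2 ⟨d, c', rfl, rfl, hc'⟩))⟩

end DisjHorn

/-! ### Ground instances of branches and clauses -/

section Instances

variable {R : Signature} {ι : Type} {ar : ι → ℕ} (bs : List (Branch R ar)) {A : Type} (e₀ : ℕ → A)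

/-- Instances of branches, given by the values of the existential variables. -/
structure DisjInst where
  i : Fin bs.length
  e : ℕ → A
  agree : Extends 1 bs[i].exis e₀ e

/-- Instances of clauses, given by the values of the existential and universal variables. -/
structure ClauseInst where
  i : Fin bs.length
  j : Fin bs[i].clauses.length
  e : ℕ → A
  agree : Extends 1 (bs[i].exis + bs[i].clauses[j].univ) e₀ e

variable {bs e₀}

/-- The clause of an instance. -/
def ClauseInst.clause (c : ClauseInst bs e₀) : HClause R ar := bs[c.i].clauses[c.j]

/-- The variable occurring positively in an instance of a clause. -/
def ClauseInst.Pos (c : ClauseInst bs e₀) (x : Σ i, (Fin (ar i) → A)) : Prop :=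
  ∃ a ∈ c.clause.pos, a.pred = x.1 ∧ a.args.map c.e = List.ofFn x.2

/-- The variables occurring negatively in an instance of a clause. -/
def ClauseInst.Neg (c : ClauseInst bs e₀) (x : Σ i, (Fin (ar i) → A)) : Prop :=
  ∃ n ∈ c.clause.negs, ∃ e, Extends (1 + bs[c.i].exis + c.clause.univ) n.1 c.e e ∧
    n.2.pred = x.1 ∧ n.2.args.map e = List.ofFn x.2

end Instances

/-- A set of a disjoint union as a family of sets. -/
def setSigmaEquiv {ι : Type} {β : ι → Type} : Set (Σ i, β i) ≃ ((i : ι) → Set (β i)) where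
  toFun τ i := {t | ⟨i, t⟩ ∈ τ}
  invFun σ := {x | x.2 ∈ σ x.1}
  left_inv _ := rfl
  right_inv _ := rfl

theorem extends_add {A : Type} {d k m : ℕ} {e e' e'' : ℕ → A} (h : Extends d k e e')
    (h' : Extends (d + k) m e' e'') : Extends d (k + m) e e'' := fun x hx => by
  rw [h' x (by omega), h x (by omega)]

theorem sigma_eq_of_ofFn {ι A : Type} {ar : ι → ℕ} {x y : Σ i, (Fin (ar i) → A)} (h : x.1 = y.1)
    (h' : List.ofFn x.2 = List.ofFn y.2) : x = y := by
  obtain ⟨i, t⟩ := x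
  obtain ⟨j, u⟩ := y
  obtain rfl : i = j := h
  obtain rfl : t = u := List.ofFn_injective h'
  rfl

section

variable {R : Signature} {ι : Type} {ar : ι → ℕ} {bs : List (Branch R ar)} (S : OrdStruct R)
  {e₀ : ℕ → S.A}

/-- An instance of a clause belongs to an instance of a branch, and no guard is true. -/
def DisjInst.Mem (d : DisjInst bs e₀) (c : ClauseInst bs e₀) : Prop :=
  d.i = c.i ∧ Extends (1 + bs[c.i].exis) c.clause.univ d.e c.e ∧
    ∀ g ∈ c.clause.guards, ¬ g.Sat S c.e

theorem Atom.exists_eq_ofFn {A : Type} (a : Atom ar) (e : ℕ → A) :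
    ∃ x : Σ i, (Fin (ar i) → A), a.pred = x.1 ∧ a.args.map e = List.ofFn x.2 :=
  ⟨⟨a.pred, fun j => (a.args.map e)[j]'(by rw [List.length_map, a.len]; exact j.2)⟩, rfl,
    List.ext_getElem (by simp [a.len]) fun i _ _ => by simp⟩

/-- An instance of a clause belongs to some instance of a branch if no guard is true. -/
theorem ClauseInst.exists_mem_iff (c : ClauseInst bs e₀) : (∃ d : DisjInst bs e₀, d.Mem S c) ↔
    ∀ g ∈ c.clause.guards, ¬ g.Sat S c.e := by
  refine ⟨fun ⟨d, hd⟩ => hd.2.2, fun h => ?_⟩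
  -- The disjunct is obtained by keeping the existential values of `c` and resetting the universal
  -- ones to `e₀`.
  refine ⟨⟨c.i, fun x => if x < 1 + bs[c.i].exis then c.e x else e₀ x, fun x hx => ?_⟩, rfl,
    fun x hx => ?_, h⟩
  · dsimp only
    split_ifs with h1
    · exact c.agree x (by omega)
    · rfl
  · dsimp only
    split_ifs with h1
    · rfl
    · refine c.agree x ?_
      have : c.clause.univ = bs[c.i].clauses[c.j].univ := rfl
      omega

/-- An instance with a true guard holds for every `τ` and may be dropped; any other instance says
exactly what its propositional clause says, and each instantiated atom is a single variable.
Quantifying over the levels is quantifying over instances. The hypothesis `hbs` supplies every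
instance of a branch with a clause, as a represented disjunct requires. -/
theorem card_models [Fintype ι] (hbs : ∀ b ∈ bs, ∃ c ∈ b.clauses, c.guards = []) :
    Nat.card {τ : Set (Σ i, (Fin (ar i) → S.A)) // ∃ d : DisjInst bs e₀, (∃ c, d.Mem S c) ∧
      ∀ c, d.Mem S c → (∃ x, c.Pos x ∧ x ∈ τ) ∨ ∃ x, c.Neg x ∧ x ∉ τ} =
    Nat.card {τ : (i : ι) → Set (Fin (ar i) → S.A) //
      ∃ b ∈ bs, b.Sat (fun i => tupleRel (τ i)) 1 e₀} := by
  refine Nat.card_congr (setSigmaEquiv.subtypeEquiv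
    fun τ => ?_)
  have hτ : ∀ (a : Atom ar) (e : ℕ → S.A),
      a.Sat (fun i => tupleRel (setSigmaEquiv τ i)) e ↔
        ∃ x : Σ i, (Fin (ar i) → S.A), (a.pred = x.1 ∧ a.args.map e = List.ofFn x.2) ∧ x ∈ τ := by
    intro a e
    constructor
    · rintro ⟨t, h1, h2⟩
      exact ⟨⟨a.pred, t⟩, ⟨rfl, h2.symm⟩, h1⟩
    · rintro ⟨⟨i, t⟩, ⟨h1, h2⟩, h3⟩
      obtain rfl : a.pred = i := h1
      exact ⟨t, h3, h2.symm⟩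
  have hτ' : ∀ (a : Atom ar) (e : ℕ → S.A),
      ¬ a.Sat (fun i => tupleRel (setSigmaEquiv τ i)) e ↔
        ∃ x : Σ i, (Fin (ar i) → S.A), (a.pred = x.1 ∧ a.args.map e = List.ofFn x.2) ∧ x ∉ τ := by
    intro a e
    obtain ⟨x, hx⟩ := a.exists_eq_ofFn e
    rw [hτ]
    constructor
    · exact fun h => ⟨x, hx, fun hxτ => h ⟨x, hx, hxτ⟩⟩
    · rintro ⟨y, ⟨h1, h2⟩, h3⟩ ⟨z, ⟨h4, h5⟩, h6⟩
      exact h3 (sigma_eq_of_ofFn (h1.symm.trans h4) (h2.symm.trans h5) ▸ h6)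
  have hm : ∀ c : ClauseInst bs e₀, c.clause.Matrix (fun i => tupleRel
      (setSigmaEquiv τ i))
        (1 + bs[c.i].exis + c.clause.univ) c.e ↔
      (∃ g ∈ c.clause.guards, g.Sat S c.e) ∨ (∃ x, c.Pos x ∧ x ∈ τ) ∨ ∃ x, c.Neg x ∧ x ∉ τ := by
    intro c
    refine or_congr_right (or_congr ?_ ?_)
    · simp only [hτ, ClauseInst.Pos]
      constructor
      · rintro ⟨a, h1, x, h2, h3⟩
        exact ⟨x, ⟨a, h1, h2⟩, h3⟩
      · rintro ⟨x, ⟨a, h1, h2⟩, h3⟩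
        exact ⟨a, h1, x, h2, h3⟩
    · simp only [hτ', ClauseInst.Neg]
      constructor
      · rintro ⟨n, h1, e, h2, x, h3, h4⟩
        exact ⟨x, ⟨n, h1, e, h2, h3⟩, h4⟩
      · rintro ⟨x, ⟨n, h1, e, h2, h3⟩, h4⟩
        exact ⟨n, h1, e, h2, x, h3, h4⟩
  constructor
  · rintro ⟨d, -, h⟩
    refine ⟨bs[d.i], List.getElem_mem _, d.e, d.agree, fun c hc e he => ?_⟩
    obtain ⟨j, hj, rfl⟩ := List.mem_iff_getElem.1 hc
    let C : ClauseInst bs e₀ := ⟨d.i, ⟨j, hj⟩, e, extends_add d.agree he⟩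
    refine (hm C).2 ?_
    by_cases hg : ∃ g ∈ C.clause.guards, g.Sat S C.e
    · exact .inl hg
    · exact .inr (h C ⟨rfl, he, fun g hg1 hg2 => hg ⟨g, hg1, hg2⟩⟩)
  · rintro ⟨b, hb, e, he, h⟩
    obtain ⟨i, hi, rfl⟩ := List.mem_iff_getElem.1 hb
    refine ⟨⟨⟨i, hi⟩, e, he⟩, ?_, ?_⟩
    · obtain ⟨c, hc, hg⟩ := hbs _ hb
      obtain ⟨j, hj, rfl⟩ := List.mem_iff_getElem.1 hc
      refine ⟨⟨⟨i, hi⟩, ⟨j, hj⟩, e, extends_add he (Extends.refl _ _ _)⟩, rfl,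
        Extends.refl _ _ _, ?_⟩
      simp only [ClauseInst.clause]
      intro g hg'
      have : g ∈ bs[i].clauses[j].guards := hg'
      rw [hg] at this
      exact absurd this List.not_mem_nil
    · rintro ⟨i', j, e', he'⟩ ⟨h1, h2, h3⟩
      obtain rfl : ⟨i, hi⟩ = i' := h1
      refine ((hm ⟨⟨i, hi⟩, j, e', he'⟩).1 (h _ (List.getElem_mem j.2) e' h2)).resolve_left ?_
      rintro ⟨g, hg1, hg2⟩
      exact h3 g hg1 hg2

end

/-! ### Indices of tuples -/

/-- The position of a tuple of numbers below `n` in the lexicographic order. -/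
def lexIndex (n : ℕ) : List ℕ → ℕ
  | [] => 0
  | a :: l => a * n ^ l.length + lexIndex n l

theorem lexIndex_lt {n : ℕ} : ∀ {l : List ℕ}, (∀ a ∈ l, a < n) → lexIndex n l < n ^ l.length
  | [], _ => by simp [lexIndex]
  | a :: l, h => by
    have h1 : a + 1 ≤ n := h a List.mem_cons_self
    have h2 := lexIndex_lt fun b hb => h b (List.mem_cons_of_mem _ hb)
    have h3 := Nat.mul_le_mul_right (n ^ l.length) h1
    rw [Nat.add_mul, Nat.one_mul, Nat.mul_comm n, ← Nat.pow_succ] at h3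
    rw [Nat.succ_eq_add_one] at h3
    rw [lexIndex, List.length_cons]
    omega

/-- The index is a numeral in base `n`: the leading digit is the quotient by `n ^ l'.length`. Equal
lengths are needed because leading zeros are invisible. -/
theorem lexIndex_inj {n : ℕ} : ∀ {l l' : List ℕ}, (∀ a ∈ l, a < n) → (∀ a ∈ l', a < n) →
    l.length = l'.length → lexIndex n l = lexIndex n l' → l = l'
  | [], [], _, _, _, _ => rfl
  | a :: l, b :: l', h, h', hl, he => by
    replace hl : l.length = l'.length := by simpa using hl
    have h1 := lexIndex_lt fun b hb => h b (List.mem_cons_of_mem _ hb)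
    have h2 := lexIndex_lt fun b hb => h' b (List.mem_cons_of_mem _ hb)
    rw [lexIndex, lexIndex, hl] at he
    rw [hl] at h1
    have hp : 0 < n ^ l'.length := Nat.pos_of_ne_zero (by rintro h0; omega)
    have hab : a = b := by
      have := congrArg (· / n ^ l'.length) he
      simpa [Nat.mul_add_div hp, Nat.mul_comm _ (n ^ l'.length), Nat.div_eq_of_lt h1,
        Nat.div_eq_of_lt h2] using this
    subst hab
    rw [lexIndex_inj (fun b hb => h b (List.mem_cons_of_mem _ hb))
      (fun b hb => h' b (List.mem_cons_of_mem _ hb)) hl (by omega)]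

/-- Consecutive blocks of sizes `c 0, c 1, …` tile an initial segment. This serves both for the
tuples with a given first entry and for the bit blocks of the relations. -/
theorem flatMap_range_map_add (c : ℕ → ℕ) (m : ℕ) :
    (List.range m).flatMap (fun i => (List.range (c i)).map
      fun q => ∑ j ∈ Finset.range i, c j + q) = List.range (∑ j ∈ Finset.range m, c j) := by
  induction m with
  | zero => simp
  | succ m ih =>
    rw [List.range_succ, List.flatMap_append, ih, Finset.sum_range_succ, List.range_add]
    simp

theorem flatMap_finRange {α : Type} (m : ℕ) (f : ℕ → List α) :
    (List.finRange m).flatMap (fun i : Fin m => f i.val) = (List.range m).flatMap f := by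
  rw [← List.map_coe_finRange_eq_range, List.flatMap_map]

theorem map_lexIndex_tuples (n k : ℕ) : (tuples (List.finRange n) k).map
    (fun t => lexIndex n (List.ofFn fun j => (t j : ℕ))) = List.range (n ^ k) := by
  induction k with
  | zero => simp [tuples, lexIndex]
  | succ k ih =>
    have h : ∀ (a : Fin n) (t : Fin k → Fin n),
        lexIndex n (List.ofFn fun j => ((Fin.cons a t : Fin (k + 1) → Fin n) j : ℕ)) =
          a * n ^ k + lexIndex n (List.ofFn fun j => (t j : ℕ)) := by
      intro a t
      rw [List.ofFn_succ, lexIndex, List.length_ofFn]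
      simp
    simp only [tuples, List.map_flatMap, List.map_map, Function.comp_def, h]
    have h2 : ∀ a : ℕ, (tuples (List.finRange n) k).map
        (fun t => a * n ^ k + lexIndex n (List.ofFn fun j => (t j : ℕ))) =
        (List.range (n ^ k)).map (a * n ^ k + ·) := by
      intro a
      rw [← ih, List.map_map]
      rfl
    simp only [h2]
    have := flatMap_range_map_add (fun _ => n ^ k) n
    simp only [Finset.sum_const, Finset.card_range, smul_eq_mul] at this
    rw [flatMap_finRange n fun a => (List.range (n ^ k)).map (a * n ^ k + ·), this, Nat.pow_succ,
      Nat.mul_comm]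

/-! ### Decoding structures -/

theorem sort_univ_fin (n : ℕ) :
    Finset.univ.sort (fun a b : Fin n => a ≤ b) = List.finRange n := by
  refine List.Perm.eq_of_pairwise (le := fun a b : Fin n => a ≤ b)
    (fun a b _ _ h1 h2 => le_antisymm h1 h2) (Finset.pairwise_sort _ _) ?_ ?_
  · exact (List.pairwise_lt_finRange n).imp fun h => le_of_lt h
  · rw [List.perm_ext_iff_of_nodup (Finset.sort_nodup _ _) (List.nodup_finRange n)]
    simp

/-- The number of bits of the `j`-th relation of a structure with `n` elements. -/
def relSize (R : Signature) (n j : ℕ) : ℕ :=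
  if h : j < R.numRel then n ^ R.arity ⟨j, h⟩ else 0

/-- The number of bits of the first `i` relations of a structure with `n` elements. -/
def relOffset (R : Signature) (n i : ℕ) : ℕ := ∑ j ∈ Finset.range i, relSize R n j

/-- The string `w` encodes a structure with `n` elements. -/
structure EncodesSize (R : Signature) (w : List Bool) (n : ℕ) : Prop where
  pos : 0 < n
  zeros : ∀ i < n, w.getD i false = false
  one : w.getD n false = true
  length : w.length = n + 1 + relOffset R n R.numRel

/-- The size is the position of the first `1`. -/
theorem EncodesSize.unique {R : Signature} {w : List Bool} {m n : ℕ} (h : EncodesSize R w m)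
    (h' : EncodesSize R w n) : m = n := by
  rcases lt_trichotomy m n with hmn | hmn | hmn
  · exact absurd ((h'.zeros m hmn).symm.trans h.one) (by simp)
  · exact hmn
  · exact absurd ((h.zeros n hmn).symm.trans h'.one) (by simp)

theorem length_tuples {A : Type} (l : List A) (k : ℕ) : (tuples l k).length = l.length ^ k := by
  induction k with
  | zero => simp [tuples]
  | succ k ih => simp [tuples, List.length_flatMap, ih, Nat.pow_succ, Nat.mul_comm]

theorem encodesSize_enc {R : Signature} (S : OrdStruct R) :
    EncodesSize R S.enc (Fintype.card S.A) := by
  refine ⟨Fintype.card_pos, fun i hi => ?_, ?_, ?_⟩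
  · rw [OrdStruct.enc, List.getD_append _ _ _ _ (by simpa using hi)]
    simp [hi]
  · rw [OrdStruct.enc, List.getD_append_right _ _ _ _ (by simp)]
    simp
  · have h : ∀ i : Fin R.numRel, R.arity i = R.arity ⟨i, i.2⟩ := fun _ => rfl
    rw [OrdStruct.enc, List.length_append, List.length_replicate, List.length_cons,
      List.length_flatMap, relOffset, Finset.sum_range]
    simp only [List.length_map, length_tuples, Finset.length_sort, Finset.card_univ, relSize,
      Fin.is_lt, dif_pos]
    rw [← List.sum_ofFn, List.ofFn_eq_map]
    simp only [Fin.eta]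
    omega

/-- The structure with domain `Fin n` encoded by the string `w`. -/
def decode (R : Signature) (w : List Bool) (n : ℕ) (hn : 0 < n) : OrdStruct R where
  A := Fin n
  nonemptyA := ⟨⟨0, hn⟩⟩
  rel i := {t | w.getD (n + 1 + (relOffset R n i + lexIndex n (List.ofFn fun j => (t j : ℕ))))
    false = true}

/-- The bit for a tuple sits after the prefix of length `n + 1`, at the offset of its relation plus
the index of the tuple, and these positions run through the rest of `w` in order. So `EncodesSize`
recognises exactly the encodings. -/
theorem enc_decode {R : Signature} {w : List Bool} {n : ℕ} (h : EncodesSize R w n) :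
    (decode R w n h.pos).enc = w := by
  have hs : Finset.univ.sort (fun a b : (decode R w n h.pos).A => a ≤ b) = List.finRange n :=
    sort_univ_fin n
  have hc : Fintype.card (decode R w n h.pos).A = n := Fintype.card_fin n
  rw [OrdStruct.enc, hs, hc]
  have h1 : ∀ i : Fin R.numRel, ((tuples (List.finRange n) (R.arity i)).map
      fun t => @decide (t ∈ (decode R w n h.pos).rel i) (Classical.propDecidable _)) =
      (List.range (relSize R n i)).map
        fun q => w.getD (n + 1 + (relOffset R n i + q)) false := by
    intro i
    rw [relSize, dif_pos i.2, ← map_lexIndex_tuples, List.map_map]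
    refine List.map_congr_left fun t _ => ?_
    exact Bool.eq_iff_iff.2 ((@decide_eq_true_iff _ (Classical.propDecidable _)).trans Iff.rfl)
  refine (congrArg (fun F => List.replicate n false ++ true ::
    (List.finRange R.numRel).flatMap F) (funext h1)).trans ?_
  rw [flatMap_finRange R.numRel fun i => (List.range (relSize R n i)).map
    fun q => w.getD (n + 1 + (relOffset R n i + q)) false]
  have h2 := congrArg (List.map fun q => w.getD (n + 1 + q) false)
    (flatMap_range_map_add (relSize R n) R.numRel)
  rw [List.map_flatMap] at h2
  simp only [List.map_map] at h2
  refine Eq.trans (congrArg (fun l => List.replicate n false ++ true :: l) h2) ?_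
  have hl := h.length
  rw [relOffset] at hl
  refine List.ext_getElem (by simp; omega) fun i hi hi' => ?_
  have hw : ∀ (j : ℕ) (hj : j < w.length), w[j] = w.getD j false := fun j hj => by simp [hj]
  rw [hw i hi']
  rcases lt_trichotomy i n with hin | rfl | hin
  · rw [List.getElem_append_left (by simpa using hin), h.zeros i hin]
    simp
  · rw [List.getElem_append_right (by simp), h.one]
    simp
  · obtain ⟨q, rfl⟩ := Nat.exists_eq_add_of_lt hin
    rw [List.getElem_append_right (by simp; omega)]
    simp [show n + q + 1 - n = q + 1 by omega, show n + 1 + q = n + q + 1 by omega]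

/-! ### Structures for disjunctions of Horn formulae -/

/-- The structure with domain `Fin N` with the given relations. -/
def dhStruct (N : ℕ) (hN : 0 < N) (p n d : ℕ → ℕ → Prop) (v nc : ℕ → Prop) : OrdStruct dhSig where
  A := Fin N
  nonemptyA := ⟨⟨0, hN⟩⟩
  rel i := match i with
    | ⟨0, _⟩ => {t : Fin 2 → Fin N | p (t 0) (t 1)}
    | ⟨1, _⟩ => {t : Fin 2 → Fin N | n (t 0) (t 1)}
    | ⟨2, _⟩ => {t : Fin 1 → Fin N | v (t 0)}
    | ⟨3, _⟩ => {t : Fin 1 → Fin N | nc (t 0)}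
    | ⟨4, _⟩ => {t : Fin 2 → Fin N | d (t 0) (t 1)}

-- The right-hand side has the form of the output of nested loops that write one bit at a time,
-- ready to be compared with `OExp.eval`.
open Classical in
theorem enc_dhStruct (N : ℕ) (hN : 0 < N) (p n d : ℕ → ℕ → Prop) (v nc : ℕ → Prop) :
    (dhStruct N hN p n d v nc).enc = (List.range N).flatMap (fun _ => [false]) ++ ([true] ++
      (((List.range N).flatMap fun x => (List.range N).flatMap fun y => [decide (p x y)]) ++
      (((List.range N).flatMap fun x => (List.range N).flatMap fun y => [decide (n x y)]) ++
      (((List.range N).flatMap fun x => [decide (v x)]) ++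
      (((List.range N).flatMap fun x => [decide (nc x)]) ++
      ((List.range N).flatMap fun x => (List.range N).flatMap fun y => [decide (d x y)])))))) := by
  have hs : Finset.univ.sort (fun a b : (dhStruct N hN p n d v nc).A => a ≤ b) = List.finRange N :=
    sort_univ_fin N
  have hc : Fintype.card (dhStruct N hN p n d v nc).A = N := Fintype.card_fin N
  have h1 : ∀ q : ℕ → Prop, (tuples (List.finRange N) 1).map (fun t => decide (q (t 0))) =
      (List.range N).flatMap fun x => [decide (q x)] := by
    intro q
    rw [← flatMap_finRange]
    simp only [tuples, List.map_flatMap, List.map_cons, List.map_nil, Fin.cons_zero]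
  have h2 : ∀ q : ℕ → ℕ → Prop,
      (tuples (List.finRange N) 2).map (fun t => decide (q (t 0) (t 1))) =
      (List.range N).flatMap fun x => (List.range N).flatMap fun y => [decide (q x y)] := by
    intro q
    rw [← flatMap_finRange]
    simp only [tuples, List.map_flatMap, List.map_cons, List.map_nil, Fin.cons_zero]
    congr 1
    funext x
    rw [← flatMap_finRange]
    rfl
  rw [OrdStruct.enc, hs, hc]
  have h0 : List.replicate N false = (List.range N).flatMap (fun _ => [false]) := by
    rw [← List.map_eq_flatMap, List.map_const', List.length_range]
  -- The concatenation over the five relations unfolds with an empty list at its end, hence the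
  -- `append_nil`.
  rw [← h1, ← h1, ← h2, ← h2, ← h2, ← h0,
    ← List.append_nil ((tuples (List.finRange N) 2).map fun t => decide (d (t 0) (t 1)))]
  rfl

/-! ### Tests for first-order formulae -/

namespace BExp

/-- Conjunction of tests. -/
def and (b c : BExp) : BExp := .not (.or (.not b) (.not c))

/-- The false test. -/
def ff : BExp := .lt (.const 0) (.const 0)

/-- Equality of numbers. -/
def eq (a b : AExp) : BExp := .not (.or (.lt a b) (.lt b a))

/-- Disjunction of the tests `f x` for `x` in a list. -/
def anyOf {α : Type} (l : List α) (f : α → BExp) : BExp := (l.map f).foldr .or ff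

variable {w : List Bool} {E : ℕ → ℕ}

@[simp]
theorem holds_and (b c : BExp) : (and b c).Holds w E ↔ b.Holds w E ∧ c.Holds w E := by
  simp [and, Holds]

@[simp]
theorem holds_ff : ¬ ff.Holds w E := by simp [ff, Holds]

@[simp]
theorem holds_eq (a b : AExp) : (eq a b).Holds w E ↔ a.eval E = b.eval E := by
  simp only [eq, Holds]
  omega

@[simp]
theorem holds_anyOf {α : Type} (l : List α) (f : α → BExp) :
    (anyOf l f).Holds w E ↔ ∃ x ∈ l, (f x).Holds w E := by
  induction l with
  | nil => simp [anyOf]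
  | cons a l ih =>
    rw [anyOf] at ih
    simp [anyOf, Holds, ih]

/-- Quantification over the elements at the `k` levels from `d` on. -/
def exLevels : ℕ → ℕ → BExp → BExp
  | _, 0, b => b
  | d, k + 1, b => .ex (d + 4) (.var 1) (exLevels (d + 1) k b)

end BExp

/-- Registers: the numbers `r` in the first four, then the elements `e`. -/
def numEnv {n : ℕ} (r : ℕ → ℕ) (e : ℕ → Fin n) (x : ℕ) : ℕ := if x < 4 then r x else (e (x - 4) : ℕ)

theorem numEnv_of_lt {n : ℕ} (r : ℕ → ℕ) (e : ℕ → Fin n) {x : ℕ} (h : x < 4) :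
    numEnv r e x = r x := if_pos h

theorem numEnv_level {n : ℕ} (r : ℕ → ℕ) (e : ℕ → Fin n) (x : ℕ) : numEnv r e (x + 4) = e x := by
  simp [numEnv]

/-- In the reduction, registers `0` to `3` hold the length of the input, the size `n` and the two
coordinates of the bit being written; level `x` lives in register `x + 4`. -/
theorem update_numEnv {n : ℕ} (r : ℕ → ℕ) (e : ℕ → Fin n) (d : ℕ) (a : Fin n) :
    Function.update (numEnv r e) (d + 4) (a : ℕ) = numEnv r (Function.update e d a) := by
  funext x
  by_cases hx : x = d + 4
  · subst hx
    rw [Function.update_self, numEnv_level, Function.update_self]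
  · rw [Function.update_of_ne hx]
    by_cases h4 : x < 4
    · rw [numEnv_of_lt _ _ h4, numEnv_of_lt _ _ h4]
    · obtain ⟨y, rfl⟩ : ∃ y, x = y + 4 := ⟨x - 4, by omega⟩
      rw [numEnv_level, numEnv_level, Function.update_of_ne (by omega)]

/-- Register `1` holds `n`, so a quantifier bounded by it ranges over the domain of the decoded
structure. -/
theorem exists_lt_update_numEnv {n : ℕ} {r : ℕ → ℕ} (hr : r 1 = n) (e : ℕ → Fin n) (d : ℕ)
    (p : (ℕ → ℕ) → Prop) : (∃ i < (AExp.var 1).eval (numEnv r e),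
      p (Function.update (numEnv r e) (d + 4) i)) ↔ ∃ a, p (numEnv r (Function.update e d a)) := by
  rw [AExp.eval, numEnv_of_lt _ _ (by omega), hr, Fin.exists_iff]
  constructor
  · rintro ⟨i, hi, h⟩
    exact ⟨i, hi, by rwa [← update_numEnv]⟩
  · rintro ⟨i, hi, h⟩
    exact ⟨i, hi, by rwa [← update_numEnv] at h⟩

theorem BExp.holds_exLevels {n : ℕ} {r : ℕ → ℕ} (hr : r 1 = n) (w : List Bool) (b : BExp) (k : ℕ) :
    ∀ (d : ℕ) (e : ℕ → Fin n), (exLevels d k b).Holds w (numEnv r e) ↔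
      ∃ e', Extends d k e e' ∧ b.Holds w (numEnv r e') := by
  induction k with
  | zero => intro d e; simp [exLevels, extends_zero]
  | succ k ih =>
    intro d e
    rw [exLevels, Holds, exists_lt_update_numEnv hr e d fun E => (exLevels (d + 1) k b).Holds w E]
    simp only [ih, extends_succ]
    constructor
    · rintro ⟨a, e', h1, h2⟩
      exact ⟨e', ⟨a, h1⟩, h2⟩
    · rintro ⟨e', ⟨a, h1⟩, h2⟩
      exact ⟨a, e', h1, h2⟩

namespace AExp

/-- The `k`-th power of the number of elements. -/
def pow : ℕ → AExp
  | 0 => .const 1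
  | k + 1 => .mul (pow k) (.var 1)

/-- The index of the tuple of the elements at the given levels. -/
def lex : List ℕ → AExp
  | [] => .const 0
  | x :: l => .add (.mul (.var (x + 4)) (pow l.length)) (lex l)

/-- The number of bits of the first relations. -/
def offset (R : Signature) : ℕ → AExp
  | 0 => .const 0
  | i + 1 => .add (offset R i) (if h : i < R.numRel then pow (R.arity ⟨i, h⟩) else .const 0)

theorem eval_pow (E : ℕ → ℕ) (k : ℕ) : (pow k).eval E = E 1 ^ k := by
  induction k with
  | zero => rfl
  | succ k ih => rw [pow, eval, ih, Nat.pow_succ]; rfl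

theorem eval_offset (R : Signature) (E : ℕ → ℕ) (i : ℕ) :
    (offset R i).eval E = relOffset R (E 1) i := by
  induction i with
  | zero => rfl
  | succ i ih =>
    rw [offset, eval, ih, relOffset, relOffset, Finset.sum_range_succ, relSize]
    split_ifs
    · rw [eval_pow]
    · rfl

theorem eval_lex {n : ℕ} {r : ℕ → ℕ} (hr : r 1 = n) (e : ℕ → Fin n) (l : List ℕ) :
    (lex l).eval (numEnv r e) = lexIndex n (l.map fun x => (e x : ℕ)) := by
  induction l with
  | nil => rfl
  | cons x l ih =>
    rw [lex, eval, eval, ih, eval_pow, numEnv_of_lt _ _ (by omega), hr, eval, numEnv_level,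
      List.map_cons, lexIndex, List.length_map]

end AExp

/-- The test for a first-order formula; the variables are renamed to levels below `d`. -/
def SO.test {R : Signature} : SO R → (FVar → ℕ) → ℕ → BExp
  | .eq x y, ρ, _ => .eq (.var (ρ x + 4)) (.var (ρ y + 4))
  | .lt x y, ρ, _ => .lt (.var (ρ x + 4)) (.var (ρ y + 4))
  | .rel i u, ρ, _ => .bit <| .add (.add (.var 1) (.const 1)) <|
      .add (.offset R i) (.lex (List.ofFn fun j => ρ (u j)))
  | .top, _, _ => .not .ff
  | .app _ _, _, _ => .ff
  | .neg φ, ρ, d => .not (φ.test ρ d)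
  | .disj φ ψ, ρ, d => .or (φ.test ρ d) (ψ.test ρ d)
  | .ex x φ, ρ, d => .ex (d + 4) (.var 1) (φ.test (Function.update ρ x d) (d + 1))
  | .exSO _ _, _, _ => .ff

theorem SO.holds_test {R : Signature} {w : List Bool} {n : ℕ} (hn : 0 < n) {r : ℕ → ℕ}
    (hr : r 1 = n) {φ : SO R} (hφ : φ.IsFO) : ∀ (ρ : FVar → ℕ) (d : ℕ) (_ : ∀ x, ρ x < d)
      (e : ℕ → Fin n), (φ.test ρ d).Holds w (numEnv r e) ↔
        φ.Sat (decode R w n hn) (e ∘ ρ) fun _ => ∅ := by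
  induction φ with
  | eq x y =>
    intro ρ d _ e
    rw [test, BExp.holds_eq, AExp.eval, AExp.eval, numEnv_level, numEnv_level]
    exact Fin.val_inj
  | lt x y =>
    intro ρ d _ e
    rw [test, BExp.Holds, AExp.eval, AExp.eval, numEnv_level, numEnv_level]
    exact Fin.val_fin_lt
  | rel i u =>
    intro ρ d _ e
    rw [test, BExp.Holds, AExp.eval, AExp.eval, AExp.eval, AExp.eval, AExp.eval, AExp.eval_offset,
      AExp.eval_lex hr, numEnv_of_lt _ _ (by omega), hr, List.map_ofFn]
    exact Iff.rfl
  | top => intro ρ d _ e; simp [test, Sat, BExp.Holds]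
  | app | exSO => exact hφ.elim
  | neg φ ih => exact fun ρ d h e => not_congr (ih hφ ρ d h e)
  | disj φ ψ ih1 ih2 => exact fun ρ d h e => or_congr (ih1 hφ.1 ρ d h e) (ih2 hφ.2 ρ d h e)
  | ex x φ ih =>
    intro ρ d h e
    rw [test, BExp.Holds, exists_lt_update_numEnv hr e d
      fun E => (φ.test (Function.update ρ x d) (d + 1)).Holds w E]
    refine exists_congr fun a => ?_
    exact (ih hφ _ _ (update_lt h x) _).trans (iff_of_eq (congrArg
      (fun v => φ.Sat (decode R w n hn) v fun _ => ∅) (update_comp_update h e x a)))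

/-- The test for a guard. -/
def Guard.test {R : Signature} (g : Guard R) : BExp := g.form.test g.ren g.top

theorem Guard.holds_test {R : Signature} (g : Guard R) {w : List Bool} {n : ℕ} (hn : 0 < n)
    {r : ℕ → ℕ} (hr : r 1 = n) (e : ℕ → Fin n) :
    g.test.Holds w (numEnv r e) ↔ g.Sat (decode R w n hn) e :=
  SO.holds_test hn hr g.isFO _ _ g.ren_lt e

/-! ### Codes of variables, clauses and disjuncts -/

/-- The code of a pair of numbers below `M` and a tuple of numbers below `n`. -/
def tupleCode (M n i j : ℕ) (l : List ℕ) : ℕ := i + M * (j + M * lexIndex n l)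

/-- Mixed radix: two digits below `M`, then an index below `n ^ K`. -/
theorem tupleCode_lt {M K n i j : ℕ} {l : List ℕ} (hi : i < M) (hj : j < M) (hl : ∀ a ∈ l, a < n)
    (hK : l.length ≤ K) (hn : 0 < n) : tupleCode M n i j l < M * (M * n ^ K) := by
  have key : ∀ {a b c : ℕ}, a < M → b < c → a + M * b < M * c := by
    intro a b c ha hb
    calc a + M * b < M + M * b := by omega
      _ = M * (b + 1) := by ring
      _ ≤ M * c := Nat.mul_le_mul_left _ hb
  exact key hi (key hj ((lexIndex_lt hl).trans_le (Nat.pow_le_pow_right hn hK)))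

/-- The two digits are recovered modulo `M`. They identify the predicate, branch or clause in
question and with it the length of the list, so recovering the list only for equal lengths is
enough. -/
theorem tupleCode_inj {M n i i' j j' : ℕ} {l l' : List ℕ} (hi : i < M) (hi' : i' < M) (hj : j < M)
    (hj' : j' < M) (hl : ∀ a ∈ l, a < n) (hl' : ∀ a ∈ l', a < n)
    (h : tupleCode M n i j l = tupleCode M n i' j' l') :
    i = i' ∧ j = j' ∧ (l.length = l'.length → l = l') := by
  have key : ∀ {a a' b b' : ℕ}, a < M → a' < M → a + M * b = a' + M * b' → a = a' ∧ b = b' := by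
    intro a a' b b' ha ha' h
    have h1 := congrArg (· % M) h
    simp only [Nat.add_mul_mod_self_left, Nat.mod_eq_of_lt ha, Nat.mod_eq_of_lt ha'] at h1
    subst h1
    exact ⟨rfl, Nat.eq_of_mul_eq_mul_left (by omega) (Nat.add_left_cancel h)⟩
  obtain ⟨h1, h2⟩ := key hi hi' h
  obtain ⟨h3, h4⟩ := key hj hj' h2
  exact ⟨h1, h3, fun hll => lexIndex_inj hl hl' hll h4⟩

/-- The code with fixed numbers of the elements at the given levels. -/
def AExp.tupleCode (M i j : ℕ) (l : List ℕ) : AExp :=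
  .add (.const i) (.mul (.const M) (.add (.const j) (.mul (.const M) (.lex l))))

theorem AExp.eval_tupleCode (M i j : ℕ) (l : List ℕ) {n : ℕ} {r : ℕ → ℕ} (hr : r 1 = n)
    (e : ℕ → Fin n) : (AExp.tupleCode M i j l).eval (numEnv r e) =
      _root_.tupleCode M n i j (l.map fun x => (e x : ℕ)) := by
  simp only [AExp.tupleCode, _root_.tupleCode, eval, eval_lex hr]

theorem lt_of_mem_map_val {n : ℕ} (l : List ℕ) (e : ℕ → Fin n) :
    ∀ a ∈ l.map fun x => (e x : ℕ), a < n := fun a ha => by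
  obtain ⟨x, -, rfl⟩ := List.mem_map.1 ha
  exact (e x).2

section

variable {R : Signature} {ι : Type} [Fintype ι] {ar : ι → ℕ} (bs : List (Branch R ar))

/-- `M` bounds the numbers of branches, clauses and predicates, and `K` the lengths of tuples. -/
structure CodeBounds (M K : ℕ) : Prop where
  branches : bs.length < M
  clauses : ∀ b ∈ bs, b.clauses.length ≤ M
  preds : Fintype.card ι ≤ M
  levels : ∀ b ∈ bs, ∀ c ∈ b.clauses, b.exis + c.univ ≤ K
  exis : ∀ b ∈ bs, b.exis ≤ K
  arity : ∀ i, ar i ≤ K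

theorem exists_bound {α : Type} (l : List α) (f : α → ℕ) : ∃ M, ∀ a ∈ l, f a ≤ M := by
  induction l with
  | nil => exact ⟨0, by simp⟩
  | cons a l ih =>
    obtain ⟨M, hM⟩ := ih
    refine ⟨max (f a) M, fun b hb => ?_⟩
    rcases List.mem_cons.1 hb with rfl | hb
    · exact le_max_left _ _
    · exact (hM b hb).trans (le_max_right _ _)

theorem exists_codeBounds : ∃ M K, CodeBounds bs M K := by
  obtain ⟨M, hM⟩ := exists_bound bs fun b => b.clauses.length
  obtain ⟨K₁, h1⟩ := exists_bound (bs.flatMap fun b => b.clauses.map fun c => b.exis + c.univ) id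
  obtain ⟨K₂, h2⟩ := exists_bound bs fun b => b.exis
  obtain ⟨K₃, h3⟩ := exists_bound (Finset.univ : Finset ι).toList ar
  refine ⟨bs.length + 1 + M + Fintype.card ι, K₁ + K₂ + K₃, by omega,
    fun b hb => (hM b hb).trans (by omega), by omega, fun b hb c hc => ?_,
    fun b hb => (h2 b hb).trans (by omega), fun i => (h3 i (by simp)).trans (by omega)⟩
  exact (h1 _ (List.mem_flatMap.2 ⟨b, hb, List.mem_map.2 ⟨c, hc, rfl⟩⟩)).trans
    (show K₁ ≤ _ by omega)

variable (M : ℕ)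

/-- The code of a variable. -/
noncomputable def varCode {n : ℕ} (x : Σ i, (Fin (ar i) → Fin n)) : ℕ :=
  tupleCode M n (Fintype.equivFin ι x.1) 0 (List.ofFn fun j => (x.2 j : ℕ))

variable {bs}

/-- The code of an instance of a clause. -/
def ClauseInst.code {n : ℕ} {e₀ : ℕ → Fin n} (c : ClauseInst bs e₀) : ℕ :=
  tupleCode M n c.i c.j ((List.range' 1 (bs[c.i].exis + bs[c.i].clauses[c.j].univ)).map
    fun x => (c.e x : ℕ))

/-- The code of an instance of a branch. -/
def DisjInst.code {n : ℕ} {e₀ : ℕ → Fin n} (d : DisjInst bs e₀) : ℕ :=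
  tupleCode M n d.i 0 ((List.range' 1 bs[d.i].exis).map fun x => (d.e x : ℕ))

variable {M} {K n : ℕ} {e₀ : ℕ → Fin n}

/-- An instance carries an infinite sequence of values, but outside finitely many levels it is fixed
by `e₀`, so a finite tuple codes it. -/
theorem eq_of_map_range' {k : ℕ} {e e' : ℕ → Fin n} (h : Extends 1 k e₀ e) (h' : Extends 1 k e₀ e')
    (hm : (List.range' 1 k).map (fun x => (e x : ℕ)) = (List.range' 1 k).map fun x => (e' x : ℕ)) :
    e = e' := by
  funext x
  by_cases hx : x < 1 ∨ 1 + k ≤ x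
  · rw [h x hx, h' x hx]
  · exact Fin.ext (List.map_inj_left.1 hm x (by rw [List.mem_range'_1]; omega))

theorem CodeBounds.varCode_lt (hB : CodeBounds bs M K) (hn : 0 < n)
    (x : Σ i, (Fin (ar i) → Fin n)) : varCode M x < M * (M * n ^ K) :=
  tupleCode_lt ((Fin.is_lt _).trans_le hB.preds) (Nat.zero_lt_of_lt hB.branches)
    (by simp) (by simpa using hB.arity x.1) hn

theorem CodeBounds.clauseCode_lt (hB : CodeBounds bs M K) (hn : 0 < n) (c : ClauseInst bs e₀) :
    c.code M < M * (M * n ^ K) :=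
  tupleCode_lt (c.i.2.trans hB.branches) (c.j.2.trans_le (hB.clauses _ (List.getElem_mem _)))
    (lt_of_mem_map_val _ _)
    (by simpa using hB.levels _ (List.getElem_mem c.i.2) _ (List.getElem_mem c.j.2)) hn

theorem CodeBounds.disjCode_lt (hB : CodeBounds bs M K) (hn : 0 < n) (d : DisjInst bs e₀) :
    d.code M < M * (M * n ^ K) :=
  tupleCode_lt (d.i.2.trans hB.branches) (Nat.zero_lt_of_lt hB.branches)
    (lt_of_mem_map_val _ _) (by simpa using hB.exis _ (List.getElem_mem d.i.2)) hn

theorem CodeBounds.varCode_inj (hB : CodeBounds bs M K) {x y : Σ i, (Fin (ar i) → Fin n)}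
    (h : varCode M x = varCode M y) : x = y := by
  obtain ⟨h1, -, h3⟩ := tupleCode_inj ((Fin.is_lt _).trans_le hB.preds)
    ((Fin.is_lt _).trans_le hB.preds) (Nat.zero_lt_of_lt hB.branches)
    (Nat.zero_lt_of_lt hB.branches) (by simp)
    (by simp) h
  obtain ⟨i, t⟩ := x
  obtain ⟨i', t'⟩ := y
  obtain rfl : i = i' := (Fintype.equivFin ι).injective (Fin.ext h1)
  have := List.ofFn_injective (h3 (by simp))
  obtain rfl : t = t' := funext fun j => Fin.ext (congrFun this j)
  rfl

theorem CodeBounds.clauseCode_inj (hB : CodeBounds bs M K) {c d : ClauseInst bs e₀}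
    (h : c.code M = d.code M) : c = d := by
  obtain ⟨h1, h2, h3⟩ := tupleCode_inj (c.i.2.trans hB.branches) (d.i.2.trans hB.branches)
    (c.j.2.trans_le (hB.clauses _ (List.getElem_mem _)))
    (d.j.2.trans_le (hB.clauses _ (List.getElem_mem _))) (lt_of_mem_map_val _ _)
    (lt_of_mem_map_val _ _) h
  obtain ⟨i, j, e, he⟩ := c
  obtain ⟨i', j', e', he'⟩ := d
  obtain rfl : i = i' := Fin.ext h1
  obtain rfl : j = j' := Fin.ext h2
  obtain rfl : e = e' := eq_of_map_range' he he' (h3 (by simp))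
  rfl

theorem CodeBounds.disjCode_inj (hB : CodeBounds bs M K) {c d : DisjInst bs e₀}
    (h : c.code M = d.code M) : c = d := by
  obtain ⟨h1, -, h3⟩ := tupleCode_inj (c.i.2.trans hB.branches) (d.i.2.trans hB.branches)
    (Nat.zero_lt_of_lt hB.branches) (Nat.zero_lt_of_lt hB.branches) (lt_of_mem_map_val _ _)
    (lt_of_mem_map_val _ _) h
  obtain ⟨i, e, he⟩ := c
  obtain ⟨i', e', he'⟩ := d
  obtain rfl : i = i' := Fin.ext h1
  obtain rfl : e = e' := eq_of_map_range' he he' (h3 (by simp))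
  rfl

end

/-! ### Tests for the relations of the coding structure -/

section

variable {R : Signature} {ι : Type} {ar : ι → ℕ} (M : ℕ)

/-- The code of the variable given by an atom. -/
noncomputable def Atom.code [Fintype ι] (a : Atom ar) : AExp :=
  .tupleCode M (Fintype.equivFin ι a.pred) 0 a.args

theorem Atom.eq_eval_code [Fintype ι] (a : Atom ar) {n : ℕ} {r : ℕ → ℕ} (hr : r 1 = n) (e :
    ℕ → Fin n) (m : ℕ) :
    m = (a.code M).eval (numEnv r e) ↔ ∃ x : Σ i, (Fin (ar i) → Fin n), varCode M x = m ∧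
      a.pred = x.1 ∧ a.args.map e = List.ofFn x.2 := by
  have key : ∀ x : Σ i, (Fin (ar i) → Fin n), a.pred = x.1 → a.args.map e = List.ofFn x.2 →
      (a.code M).eval (numEnv r e) = varCode M x := by
    rintro ⟨p, t⟩ h1 h2
    obtain rfl : a.pred = p := h1
    have h3 := congrArg (List.map fun a : Fin n => (a : ℕ)) h2
    rw [List.map_map, List.map_ofFn] at h3
    rw [Atom.code, AExp.eval_tupleCode _ _ _ _ hr, varCode]
    exact congrArg (tupleCode M n _ 0) h3
  constructor
  · rintro rfl
    obtain ⟨x, h1, h2⟩ := a.exists_eq_ofFn e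
    exact ⟨x, (key x h1 h2).symm, h1, h2⟩
  · rintro ⟨x, rfl, h1, h2⟩
    exact (key x h1 h2).symm

variable (bs : List (Branch R ar))

/-- The code of an instance of a clause. -/
def clauseCode (i : Fin bs.length) (j : Fin bs[i].clauses.length) : AExp :=
  .tupleCode M i j (List.range' 1 (bs[i].exis + bs[i].clauses[j].univ))

/-- The test for an instance of a clause with the property `f` and without a true guard. -/
def clauseTest (f : (i : Fin bs.length) → Fin bs[i].clauses.length → BExp) : BExp :=
  .anyOf (List.finRange bs.length) fun i => .anyOf (List.finRange bs[i].clauses.length) fun j =>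
    .exLevels 1 (bs[i].exis + bs[i].clauses[j].univ)
      (.and (.not (.anyOf bs[i].clauses[j].guards Guard.test)) (f i j))

/-- The test for positive occurrences. -/
noncomputable def posTest [Fintype ι] : BExp := clauseTest bs fun i j =>
  .and (.eq (.var 2) (clauseCode M bs i j)) <|
  (.anyOf bs[i].clauses[j].pos.toList fun a => .eq (.var 3) (a.code M))

/-- The test for negative occurrences. -/
noncomputable def negTest [Fintype ι] : BExp := clauseTest bs fun i j =>
  .and (.eq (.var 2) (clauseCode M bs i j)) <|
  (.anyOf bs[i].clauses[j].negs fun a =>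
    .exLevels (1 + bs[i].exis + bs[i].clauses[j].univ) a.1 (.eq (.var 3) (a.2.code M)))

/-- The test for clauses without positive literals. -/
def negClauseTest : BExp := clauseTest bs fun i j => .and (.eq (.var 2) (clauseCode M bs i j))
  (.not (.anyOf bs[i].clauses[j].pos.toList fun _ => .not .ff))

/-- The test for the clauses of a disjunct. -/
def disjTest : BExp := clauseTest bs fun i j =>
  .and (.eq (.var 2) (.tupleCode M i 0 (List.range' 1 bs[i].exis)))
    (.eq (.var 3) (clauseCode M bs i j))

/-- The test for variables. -/
noncomputable def varTest [Fintype ι] (ar : ι → ℕ) : BExp :=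
  .anyOf (List.finRange (Fintype.card ι)) fun i =>
  .exLevels 0 (ar ((Fintype.equivFin ι).symm i))
    (.eq (.var 2) (.tupleCode M i 0 (List.range (ar ((Fintype.equivFin ι).symm i)))))

variable {M bs} {w : List Bool} {n : ℕ} {r : ℕ → ℕ} {e₀ : ℕ → Fin n}

theorem eval_clauseCode (hr : r 1 = n) (c : ClauseInst bs e₀) :
    (clauseCode M bs c.i c.j).eval (numEnv r c.e) = c.code M :=
  AExp.eval_tupleCode _ _ _ _ hr _

/-- Searching for a branch, a clause and values at its levels is searching for an instance; by
`ClauseInst.exists_mem_iff`, falsity of all guards means that it belongs to a disjunct. -/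
theorem holds_clauseTest (hn : 0 < n) (hr : r 1 = n)
    (f : (i : Fin bs.length) → Fin bs[i].clauses.length → BExp) :
    (clauseTest bs f).Holds w (numEnv r e₀) ↔ ∃ c : ClauseInst bs e₀,
      (∃ d : DisjInst bs e₀, DisjInst.Mem (decode R w n hn) d c) ∧
        (f c.i c.j).Holds w (numEnv r c.e) := by
  simp only [clauseTest, BExp.holds_anyOf, BExp.holds_exLevels hr, BExp.holds_and, BExp.Holds,
    Guard.holds_test _ hn hr, List.mem_finRange, true_and]
  constructor
  · rintro ⟨i, j, e, he, h1, h2⟩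
    refine ⟨⟨i, j, e, he⟩, (ClauseInst.exists_mem_iff (decode R w n hn) _).2 ?_, h2⟩
    exact fun g hg hs => h1 ⟨g, hg, hs⟩
  · rintro ⟨c, h1, h2⟩
    refine ⟨c.i, c.j, c.e, c.agree, ?_, h2⟩
    rintro ⟨g, hg, hs⟩
    exact (ClauseInst.exists_mem_iff (decode R w n hn) _).1 h1 g hg hs

theorem holds_posTest [Fintype ι] (hn : 0 < n) (hr : r 1 = n) : (posTest M bs).Holds w (numEnv r
    e₀) ↔
    ∃ (c : ClauseInst bs e₀) (x : Σ i, (Fin (ar i) → Fin n)), c.code M = r 2 ∧ varCode M x = r 3 ∧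
      (∃ d : DisjInst bs e₀, DisjInst.Mem (decode R w n hn) d c) ∧ c.Pos x := by
  rw [posTest, holds_clauseTest hn hr]
  refine exists_congr fun c => ?_
  simp only [BExp.holds_and, BExp.holds_eq, BExp.holds_anyOf, eval_clauseCode hr, AExp.eval,
    numEnv_of_lt _ _ (show 2 < 4 by omega), numEnv_of_lt _ _ (show 3 < 4 by omega),
    Atom.eq_eval_code M _ hr, Option.mem_toList]
  constructor
  · rintro ⟨h1, h2, a, h3, x, h4, h5⟩
    exact ⟨x, h2.symm, h4, h1, a, h3, h5⟩
  · rintro ⟨x, h2, h4, h1, a, h3, h5⟩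
    exact ⟨h1, h2.symm, a, h3, x, h4, h5⟩

theorem holds_negTest [Fintype ι] (hn : 0 < n) (hr : r 1 = n) : (negTest M bs).Holds w (numEnv r
    e₀) ↔
    ∃ (c : ClauseInst bs e₀) (x : Σ i, (Fin (ar i) → Fin n)), c.code M = r 2 ∧ varCode M x = r 3 ∧
      (∃ d : DisjInst bs e₀, DisjInst.Mem (decode R w n hn) d c) ∧ c.Neg x := by
  rw [negTest, holds_clauseTest hn hr]
  refine exists_congr fun c => ?_
  simp only [BExp.holds_and, BExp.holds_eq, BExp.holds_anyOf, eval_clauseCode hr, AExp.eval,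
    numEnv_of_lt _ _ (show 2 < 4 by omega), numEnv_of_lt _ _ (show 3 < 4 by omega),
    Atom.eq_eval_code M _ hr, BExp.holds_exLevels hr]
  constructor
  · rintro ⟨h1, h2, a, h3, e, h4, x, h5, h6⟩
    exact ⟨x, h2.symm, h5, h1, a, h3, e, h4, h6⟩
  · rintro ⟨x, h2, h5, h1, a, h3, e, h4, h6⟩
    exact ⟨h1, h2.symm, a, h3, e, h4, x, h5, h6⟩

theorem holds_negClauseTest (hn : 0 < n) (hr : r 1 = n) :
    (negClauseTest M bs).Holds w (numEnv r e₀) ↔ ∃ c : ClauseInst bs e₀, c.code M = r 2 ∧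
      (∃ d : DisjInst bs e₀, DisjInst.Mem (decode R w n hn) d c) ∧ ∀ x, ¬ c.Pos x := by
  rw [negClauseTest, holds_clauseTest hn hr]
  refine exists_congr fun c => ?_
  -- Whether an instance has a positive literal depends only on the clause, because every atom has
  -- an instance.
  have h : (∀ x, ¬ c.Pos x) ↔ ¬ ∃ a, a ∈ c.clause.pos := by
    rw [← not_exists]
    refine not_congr ⟨fun ⟨x, a, ha, _⟩ => ⟨a, ha⟩, fun ⟨a, ha⟩ => ?_⟩
    obtain ⟨x, hx⟩ := a.exists_eq_ofFn c.e
    exact ⟨x, a, ha, hx⟩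
  rw [h]
  simp only [BExp.holds_and, BExp.holds_eq, BExp.holds_anyOf, eval_clauseCode hr, AExp.eval,
    numEnv_of_lt _ _ (show 2 < 4 by omega), BExp.Holds, BExp.holds_ff, not_false_eq_true, and_true,
    Option.mem_toList]
  constructor
  · rintro ⟨h1, h2, h3⟩
    exact ⟨h2.symm, h1, h3⟩
  · rintro ⟨h2, h1, h3⟩
    exact ⟨h1, h2.symm, h3⟩

/-- The values of the disjunct are a prefix of those of the clause, so `disjTest` need not quantify
over disjuncts separately. -/
theorem DisjInst.Mem.code_eq {hn : 0 < n} {d : DisjInst bs e₀} {c : ClauseInst bs e₀}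
    (h : DisjInst.Mem (decode R w n hn) d c) : d.code M =
      tupleCode M n c.i 0 ((List.range' 1 bs[c.i].exis).map fun x => (c.e x : ℕ)) := by
  obtain ⟨h1, h2, -⟩ := h
  obtain ⟨i, e, he⟩ := d
  obtain ⟨i', j, e', he'⟩ := c
  obtain rfl : i = i' := h1
  refine congrArg (tupleCode M n i 0) (List.map_congr_left fun x hx => ?_)
  exact congrArg Fin.val (h2 x (.inl (List.mem_range'_1.1 hx).2)).symm

theorem holds_disjTest (hn : 0 < n) (hr : r 1 = n) : (disjTest M bs).Holds w (numEnv r e₀) ↔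
    ∃ (d : DisjInst bs e₀) (c : ClauseInst bs e₀), d.code M = r 2 ∧ c.code M = r 3 ∧
      DisjInst.Mem (decode R w n hn) d c := by
  rw [disjTest, holds_clauseTest hn hr]
  simp only [BExp.holds_and, BExp.holds_eq, eval_clauseCode hr, AExp.eval,
    numEnv_of_lt _ _ (show 2 < 4 by omega), numEnv_of_lt _ _ (show 3 < 4 by omega),
    AExp.eval_tupleCode _ _ _ _ hr]
  constructor
  · rintro ⟨c, ⟨d, h1⟩, h2, h3⟩
    exact ⟨d, c, h1.code_eq.trans h2.symm, h3.symm, h1⟩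
  · rintro ⟨d, c, h2, h3, h1⟩
    exact ⟨c, ⟨d, h1⟩, h2.symm.trans h1.code_eq, h3.symm⟩

theorem holds_varTest [Fintype ι] (hr : r 1 = n) : (varTest M ar).Holds w (numEnv r e₀) ↔
    ∃ x : Σ i, (Fin (ar i) → Fin n), varCode M x = r 2 := by
  simp only [varTest, BExp.holds_anyOf, List.mem_finRange, true_and, BExp.holds_exLevels hr,
    BExp.holds_eq, AExp.eval, AExp.eval_tupleCode _ _ _ _ hr, numEnv_of_lt _ _ (show 2 < 4 by
    omega)]
  constructor
  · rintro ⟨i, e, -, h⟩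
    refine ⟨⟨(Fintype.equivFin ι).symm i, fun j => e j⟩, ?_⟩
    rw [h, varCode, Equiv.apply_symm_apply]
    congr 1
    exact List.ext_getElem (by simp) fun i _ _ => by simp
  · rintro ⟨⟨p, t⟩, h⟩
    obtain ⟨i, rfl⟩ := (Fintype.equivFin ι).symm.surjective p
    -- The tuple is placed at the levels from `0` on; the other levels must keep their values for
    -- `Extends`.
    refine ⟨i, fun x => if hx : x < ar ((Fintype.equivFin ι).symm i) then t ⟨x, hx⟩ else e₀ x,
      fun x hx => dif_neg (by omega), ?_⟩
    rw [← h, varCode, Equiv.apply_symm_apply]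
    congr 1
    exact List.ext_getElem (by simp) fun i hi _ => by
      simp only [List.length_ofFn] at hi
      simp [hi]

end

/-! ### The reduction -/

namespace OExp

/-- The membership bits of a unary relation on the numbers below `N`. -/
def table₁ (N : AExp) (b : BExp) : OExp := .loop 2 N (.bit b)

/-- The membership bits of a binary relation on the numbers below `N`. -/
def table₂ (N : AExp) (b : BExp) : OExp := .loop 2 N (.loop 3 N (.bit b))

/-- The encoding of a structure for a disjunction of Horn formulae. -/
def dhEnc (N : AExp) (p n d v nc : BExp) : OExp :=
  .seq (.loop 2 N (.bit .ff)) <| .seq (.bit (.not .ff)) <| .seq (table₂ N p) <| .seq (table₂ N n) <|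
    .seq (table₁ N v) <| .seq (table₁ N nc) (table₂ N d)

theorem eval_dhEnc (w : List Bool) (E : ℕ → ℕ) (N : AExp) (p n d v nc : BExp) {k : ℕ} (hk : 0 < k)
    (hN : ∀ E', E' 1 = E 1 → N.eval E' = k) : (dhEnc N p n d v nc).eval w E = (dhStruct k hk
      (fun a b => p.Holds w (Function.update (Function.update E 2 a) 3 b))
      (fun a b => n.Holds w (Function.update (Function.update E 2 a) 3 b))
      (fun a b => d.Holds w (Function.update (Function.update E 2 a) 3 b))
      (fun a => v.Holds w (Function.update E 2 a))
      (fun a => nc.Holds w (Function.update E 2 a))).enc := by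
  have h1 : ∀ a, N.eval (Function.update E 2 a) = k := fun a => hN _ (by simp)
  rw [enc_dhStruct]
  simp only [dhEnc, table₁, table₂, eval, h1, hN E rfl, BExp.holds_ff, BExp.Holds, decide_false,
    not_false_eq_true, decide_true]

end OExp

/-- The test that the input encodes a structure whose size is in register 1. -/
def sizeTest (R : Signature) : BExp :=
  .and (.lt (.const 0) (.var 1)) <| .and (.not (.ex 2 (.var 1) (.bit (.var 2)))) <|
    .and (.bit (.var 1)) (.eq (.var 0) (.add (.add (.var 1) (.const 1)) (.offset R R.numRel)))

theorem holds_sizeTest (R : Signature) {w : List Bool} {E : ℕ → ℕ} (h : E 0 = w.length) :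
    (sizeTest R).Holds w E ↔ EncodesSize R w (E 1) := by
  simp only [sizeTest, BExp.holds_and, BExp.holds_eq, BExp.Holds, AExp.eval, AExp.eval_offset, h,
    Function.update_self]
  constructor
  · rintro ⟨h1, h2, h3, h4⟩
    exact ⟨h1, fun i hi => Bool.eq_false_iff.2 fun hb => h2 ⟨i, hi, hb⟩, h3, h4⟩
  · rintro ⟨h1, h2, h3, h4⟩
    exact ⟨h1, fun ⟨i, hi, hb⟩ => Bool.false_ne_true ((h2 i hi).symm.trans hb), h3, h4⟩

section

variable {R : Signature} {ι : Type} [Fintype ι] {ar : ι → ℕ} (bs : List (Branch R ar)) (M K : ℕ)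

/-- The structure for the instances of branches and clauses, for a structure whose size is in
register 1. -/
noncomputable def hornEnc : OExp :=
  .dhEnc (.mul (.const M) (.mul (.const M) (.pow K))) (posTest M bs) (negTest M bs) (disjTest M bs)
    (varTest M ar) (negClauseTest M bs)

/-- The program of the reduction. -/
noncomputable def reductionProg : OExp := .loop 1 (.var 0) (.guard (sizeTest R) (hornEnc bs M K))

variable {bs M K}

/-- The domain has as many elements as there are possible codes. Numbers that code nothing occur in
no relation and do no harm. -/
theorem exists_eval_hornEnc (hB : CodeBounds bs M K) (hbs : ∀ b ∈ bs, ∃ c ∈ b.clauses, c.guards =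
    [])
    {w : List Bool} {n : ℕ} (hn : 0 < n) {E : ℕ → ℕ} (hE : E 1 = n) (hE' : ∀ x, 4 ≤ x → E x = 0) :
    ∃ T : OrdStruct dhSig, (hornEnc bs M K).eval w E = T.enc ∧ DisjHorn.count T =
      Nat.card {τ : (i : ι) → Set (Fin (ar i) → (decode R w n hn).A) //
        ∃ b ∈ bs, b.Sat (fun i => tupleRel (τ i)) 1 (fun _ => (⟨0, hn⟩ : Fin n))} := by
  have hM : 0 < M := Nat.zero_lt_of_lt hB.branches
  have hk : 0 < M * (M * n ^ K) := by positivity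
  refine ⟨_, OExp.eval_dhEnc w E _ _ _ _ _ _ hk fun E' h => ?_, ?_⟩
  · simp only [AExp.eval, AExp.eval_pow, h, hE]
  refine Eq.trans ?_ (card_models (decode R w n hn) hbs)
  -- Registers that are not set contain `0`, which represents the assignment of the least element to
  -- all levels, the `e₀` of the instances.
  have hEnv : ∀ r : ℕ → ℕ, (∀ x, 4 ≤ x → r x = 0) → numEnv r (fun _ => (⟨0, hn⟩ : Fin n)) = r := by
    intro r h
    funext x
    by_cases hx : x < 4
    · exact numEnv_of_lt _ _ hx
    · obtain ⟨y, rfl⟩ : ∃ y, x = y + 4 := ⟨x - 4, by omega⟩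
      rw [numEnv_level, h _ (by omega)]
  have h1 : ∀ a, numEnv (Function.update E 2 a) (fun _ => (⟨0, hn⟩ : Fin n)) =
      Function.update E 2 a := fun a => hEnv _ fun x hx => by
    rw [Function.update_of_ne (by omega), hE' x hx]
  have h2 : ∀ a b, numEnv (Function.update (Function.update E 2 a) 3 b)
      (fun _ => (⟨0, hn⟩ : Fin n)) = Function.update (Function.update E 2 a) 3 b :=
    fun a b => hEnv _ fun x hx => by
      rw [Function.update_of_ne (by omega), Function.update_of_ne (by omega), hE' x hx]
  let val : Fin (M * (M * n ^ K)) → ℕ := Fin.val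
  have hval : ∀ {m k : ℕ} (h : m < M * (M * n ^ K)) (a : Fin (M * (M * n ^ K))), k = (a : ℕ) →
      (m = k ↔ (⟨m, h⟩ : Fin (M * (M * n ^ K))) = a) := by
    rintro m _ h a rfl
    exact (Fin.ext_iff (a := ⟨m, h⟩) (b := a)).symm
  have e1 : ∀ a, Function.update E 2 a 1 = n := fun a => by simpa using hE
  have e2 : ∀ a b, Function.update (Function.update E 2 a) 3 b 1 = n := fun a b => by simpa using hE
  refine DisjHorn.numSat_of_coding _ (ClauseInst.Pos (bs := bs) (e₀ := fun _ => (⟨0, hn⟩ : Fin n)))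
    ClauseInst.Neg (DisjInst.Mem (decode R w n hn)) (fun x => ⟨varCode M x, hB.varCode_lt hn x⟩)
    (fun c => ⟨c.code M, hB.clauseCode_lt hn c⟩) (fun d => ⟨d.code M, hB.disjCode_lt hn d⟩)
    (fun x y h => hB.varCode_inj (congrArg Fin.val h))
    (fun x y h => hB.clauseCode_inj (congrArg Fin.val h))
    (fun x y h => hB.disjCode_inj (congrArg Fin.val h)) ?_ ?_ ?_ ?_ ?_ ?_
  · rintro c x y ⟨a, h1, h2, h3⟩ ⟨b, h4, h5, h6⟩
    obtain rfl : a = b := Option.some.inj ((Option.mem_def.1 h1).symm.trans (Option.mem_def.1 h4))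
    exact sigma_eq_of_ofFn (h2.symm.trans h5) (h3.symm.trans h6)
  · intro a b
    have := holds_posTest (M := M) (bs := bs) (w := w) (e₀ := fun _ => ⟨0, hn⟩) hn (e2 (val a) (val
      b))
    rw [h2] at this
    exact this.trans (exists_congr fun c => exists_congr fun x =>
      and_congr (hval _ a rfl) (and_congr (hval _ b rfl) Iff.rfl))
  · intro a b
    have := holds_negTest (M := M) (bs := bs) (w := w) (e₀ := fun _ => ⟨0, hn⟩) hn (e2 (val a) (val
      b))
    rw [h2] at this
    exact this.trans (exists_congr fun c => exists_congr fun x =>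
      and_congr (hval _ a rfl) (and_congr (hval _ b rfl) Iff.rfl))
  · intro a
    have := holds_varTest (M := M) (ar := ar) (w := w) (e₀ := fun _ => ⟨0, hn⟩) (e1 (val a))
    rw [h1] at this
    exact this.trans (exists_congr fun x => hval _ a rfl)
  · intro a
    have := holds_negClauseTest (M := M) (bs := bs) (w := w) (e₀ := fun _ => ⟨0, hn⟩) hn (e1 (val
      a))
    rw [h1] at this
    exact this.trans (exists_congr fun c => and_congr (hval _ a rfl) Iff.rfl)
  · intro a b
    have := holds_disjTest (M := M) (bs := bs) (w := w) (e₀ := fun _ => ⟨0, hn⟩) hn (e2 (val a)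
      (val b))
    rw [h2] at this
    exact this.trans (exists_congr fun d => exists_congr fun c =>
      and_congr (hval _ a rfl) (and_congr (hval _ b rfl) Iff.rfl))

end

/-- The program tries all candidate sizes, and the guard lets at most one of them write anything. -/
theorem flatMap_range_eq {α : Type} {f : ℕ → List α} {n : ℕ} (h : ∀ i, i ≠ n → f i = []) (m : ℕ) :
    (List.range m).flatMap f = if n < m then f n else [] := by
  induction m with
  | zero => simp
  | succ m ih =>
    rw [List.range_succ, List.flatMap_append, ih, List.flatMap_singleton]
    rcases lt_trichotomy n m with hnm | rfl | hnm
    · rw [if_pos hnm, if_pos (by omega), h m (by omega), List.append_nil]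
    · simp
    · rw [if_neg (by omega), if_neg (by omega), h m (by omega), List.append_nil]

theorem onStrings_of_forall_not_encodesSize {R : Signature} (val : OrdStruct R → ℕ) {w : List Bool}
    (h : ∀ n, ¬ EncodesSize R w n) : onStrings val w = 0 := by
  rw [onStrings, dif_neg]
  rintro ⟨S, rfl⟩
  exact h _ (encodesSize_enc S)

theorem onStrings_nil {R : Signature} (val : OrdStruct R → ℕ) : onStrings val [] = 0 :=
  onStrings_of_forall_not_encodesSize val fun n h => by
    have := h.length
    rw [List.length_nil] at this
    omega

/-- Every function of the class is reducible to `#DisjHornSAT`. -/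
theorem parsimoniouslyReducible_sharpDisjHornSAT {f : List Bool → ℕ}
    (hf : f ∈ SigmaQSOClass ExistsHorn) : ParsimoniouslyReducible f sharpDisjHornSAT := by
  obtain ⟨R, α, hα, hs, rfl⟩ := hf
  obtain ⟨ι, _, ar, bs, hbs, hcount⟩ := exists_closed_branches α hα hs
  obtain ⟨M, K, hB⟩ := exists_codeBounds bs
  refine ⟨_, OExp.polyTimeComputable (reductionProg bs M K), fun w => ?_⟩
  set E₀ : ℕ → ℕ := Function.update (fun _ => 0) 0 w.length with hE₀
  have hlen : E₀ 0 = w.length := by simp [hE₀]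
  have hsize : ∀ i, (sizeTest R).Holds w (Function.update E₀ 1 i) ↔ EncodesSize R w i := fun i => by
    rw [holds_sizeTest R (by simpa using hlen), Function.update_self]
  simp only [reductionProg, OExp.eval, AExp.eval, hlen]
  by_cases hw : ∃ n, EncodesSize R w n
  · obtain ⟨n, hn⟩ := hw
    -- An encoding of a structure of size `n` has length at least `n + 1`, so the loop over `i <
    -- w.length` reaches `n`.
    rw [flatMap_range_eq (n := n) (fun i hi => if_neg fun h => hi (((hsize i).1 h).unique hn)),
      if_pos (by have := hn.length; omega), if_pos ((hsize n).2 hn)]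
    obtain ⟨T, h1, h2⟩ := exists_eval_hornEnc hB hbs (w := w) hn.pos (E := Function.update E₀ 1 n)
      (by simp) (fun x hx => by
        rw [Function.update_of_ne (by omega), hE₀, Function.update_of_ne (by omega)])
    rw [h1, sharpDisjHornSAT_enc, h2]
    refine Eq.trans ?_ (hcount (decode R w n hn.pos) _)
    rw [← QSO.onStrings_value_enc hs, enc_decode hn]
  · have hw' : ∀ n, ¬ EncodesSize R w n := fun n hn => hw ⟨n, hn⟩
    rw [onStrings_of_forall_not_encodesSize _ hw']
    -- No size passes the test, so the output is empty, and the empty string encodes no structure.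
    rw [List.flatMap_eq_nil_iff.2 fun i _ => if_neg fun h => hw' i ((hsize i).1 h)]
    exact (onStrings_nil _).symm

/-! ### A sentence for `#DisjHornSAT` -/

namespace DisjHorn

section Formulae

/-- `P(c, x)`. -/
def fP (c x : FVar) : SO dhSig := .rel (0 : Fin 5) (![c, x] : Fin 2 → FVar)

/-- `N(c, x)`. -/
def fN (c x : FVar) : SO dhSig := .rel (1 : Fin 5) (![c, x] : Fin 2 → FVar)

/-- `V(x)`. -/
def fV (x : FVar) : SO dhSig := .rel (2 : Fin 5) (![x] : Fin 1 → FVar)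

/-- `NC(c)`. -/
def fNC (c : FVar) : SO dhSig := .rel (3 : Fin 5) (![c] : Fin 1 → FVar)

/-- `D(d, c)`. -/
def fD (d c : FVar) : SO dhSig := .rel (4 : Fin 5) (![d, c] : Fin 2 → FVar)

/-- The set of true variables. -/
def trueVar : SVar := ⟨1, 0⟩

/-- The pairs of a clause and an element that does not make the clause true as a negative
literal. -/
def notSat : SVar := ⟨2, 0⟩

/-- `x` is true. -/
def fT (x : FVar) : SO dhSig := .app trueVar (![x] : Fin 1 → FVar)

/-- `¬ x` does not make `c` true. -/
def fW (c x : FVar) : SO dhSig := .app notSat (![c, x] : Fin 2 → FVar)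

variable {S : OrdStruct dhSig} (v : FAssign S.A) (W : SAssign S.A)

theorem comp_pair {A : Type} (v : FVar → A) (a b : FVar) :
    (fun j => v ((![a, b] : Fin 2 → FVar) j)) = ![v a, v b] := by
  funext j; fin_cases j <;> rfl

theorem comp_single {A : Type} (v : FVar → A) (a : FVar) :
    (fun j => v ((![a] : Fin 1 → FVar) j)) = ![v a] := by
  funext j; fin_cases j; rfl

theorem sat_fP (c x : FVar) : (fP c x).Sat S v W ↔ P S (v c) (v x) :=
  iff_of_eq (congrArg (fun t : Fin 2 → S.A => t ∈ S.rel (0 : Fin 5)) (comp_pair v c x))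

theorem sat_fN (c x : FVar) : (fN c x).Sat S v W ↔ N S (v c) (v x) :=
  iff_of_eq (congrArg (fun t : Fin 2 → S.A => t ∈ S.rel (1 : Fin 5)) (comp_pair v c x))

theorem sat_fV (x : FVar) : (fV x).Sat S v W ↔ V S (v x) :=
  iff_of_eq (congrArg (fun t : Fin 1 → S.A => t ∈ S.rel (2 : Fin 5)) (comp_single v x))

theorem sat_fNC (c : FVar) : (fNC c).Sat S v W ↔ NC S (v c) :=
  iff_of_eq (congrArg (fun t : Fin 1 → S.A => t ∈ S.rel (3 : Fin 5)) (comp_single v c))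

theorem sat_fD (d c : FVar) : (fD d c).Sat S v W ↔ D S (v d) (v c) :=
  iff_of_eq (congrArg (fun t : Fin 2 → S.A => t ∈ S.rel (4 : Fin 5)) (comp_pair v d c))

theorem sat_fT (x : FVar) : (fT x).Sat S v W ↔ (![v x] : Fin 1 → S.A) ∈ W trueVar :=
  iff_of_eq (congrArg (fun t : Fin 1 → S.A => t ∈ W trueVar) (comp_single v x))

theorem sat_fW (c x : FVar) : (fW c x).Sat S v W ↔ (![v c, v x] : Fin 2 → S.A) ∈ W notSat :=
  iff_of_eq (congrArg (fun t : Fin 2 → S.A => t ∈ W notSat) (comp_pair v c x))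

/-- The structure represents a disjunction of Horn formulae. -/
def fInstance : SO dhSig :=
  .conj (.all 1 (.all 2 (.disj (.neg (.disj (fP 1 2) (fN 1 2))) (.conj (.ex 0 (fD 0 1)) (fV 2)))))
  <|
  .conj (.all 1 (.disj (.neg (fNC 1)) (.conj (.ex 0 (fD 0 1)) (.neg (.ex 2 (fP 1 2)))))) <|
  .conj (.all 1 (.disj (fNC 1) (.neg (.conj (.ex 0 (fD 0 1)) (.neg (.ex 2 (fP 1 2))))))) <|
  .all 1 (.all 2 (.all 3 (.disj (.neg (.conj (fP 1 2) (fP 1 3))) (.eq 2 3))))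

theorem _root_.SO.sat_conj {R : Signature} {S : OrdStruct R} (φ ψ : SO R) (v : FAssign S.A)
    (W : SAssign S.A) : (SO.conj φ ψ).Sat S v W ↔ φ.Sat S v W ∧ ψ.Sat S v W := by
  simp [SO.conj, SO.Sat]

theorem _root_.SO.sat_all {R : Signature} {S : OrdStruct R} (x : FVar) (φ : SO R) (v : FAssign S.A)
    (W : SAssign S.A) : (SO.all x φ).Sat S v W ↔ ∀ a, φ.Sat S (Function.update v x a) W := by
  simp [SO.all, SO.Sat]

/-- The typing of `P` allows the Horn condition to be stated for all elements instead of clauses of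
disjuncts and propositional variables, which makes it first-order at once. -/
theorem isInstance_iff (S : OrdStruct dhSig) : IsInstance S ↔
    (∀ c x, P S c x ∨ N S c x → (∃ d, D S d c) ∧ V S x) ∧
    (∀ c, NC S c ↔ (∃ d, D S d c) ∧ ∀ x, ¬ P S c x) ∧
    ∀ c x y, P S c x → P S c y → x = y := by
  constructor
  · rintro ⟨h1, h2, h3, h4⟩
    refine ⟨fun c x h => h.elim (h1 c x) (h2 c x), h3, fun c x y hx hy => ?_⟩
    obtain ⟨⟨d, hd⟩, hVx⟩ := h1 c x hx
    have := h4 _ ⟨d, ⟨c, hd⟩, rfl⟩ _ ⟨c, hd, rfl⟩ (x := ⟨x, hVx⟩) hx (y := ⟨y, (h1 c y hy).2⟩) hy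
    exact congrArg Subtype.val this
  · rintro ⟨h1, h2, h3⟩
    refine ⟨fun c x h => h1 c x (.inl h), fun c x h => h1 c x (.inr h), h2, ?_⟩
    rintro _ ⟨d, -, rfl⟩ _ ⟨c, -, rfl⟩ x hx y hy
    exact Subtype.ext (h3 c x y hx hy)

theorem sat_fInstance : fInstance.Sat S v W ↔ IsInstance S := by
  rw [isInstance_iff]
  simp only [fInstance, SO.sat_conj, SO.sat_all, SO.Sat, sat_fP, sat_fN, sat_fV, sat_fNC, sat_fD]
  simp only [Function.update, eq_rec_constant, dite_eq_ite]
  norm_num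
  constructor
  · rintro ⟨h1, h2, h3, h4⟩
    exact ⟨by grind, by grind, by grind⟩
  · rintro ⟨h1, h2, h3⟩
    exact ⟨by grind, by grind, by grind, by grind⟩

/-- Horn clauses saying that the disjunct `0` is true. -/
def hornClauses : List (List FVar × List (SO dhSig)) := [
  ([], [fInstance]),
  ([], [.ex 1 (fD 0 1)]),
  ([2], [fV 2, .neg (fT 2)]),
  -- This clause and the next two define `notSat(c, x)` as `N(c, x) → T(x)`, with at most one
  -- positive literal each.
  ([1, 2], [fW 1 2, fN 1 2]),
  ([1, 2], [fW 1 2, .neg (fT 2)]),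
  ([1, 2], [fT 2, .neg (fW 1 2), .neg (fN 1 2)]),
  -- A clause of the disjunct is true if its only positive variable is true or some negative literal
  -- is; the last formula treats the clauses without positive variable, for which `NC` provides a
  -- first-order test.
  ([1, 2], [fT 2, .neg (fD 0 1), .neg (fP 1 2), .ex 3 (.neg (fW 1 3))]),
  ([1], [.neg (fD 0 1), .neg (fNC 1), .ex 3 (.neg (fW 1 3))])]

/-- Some disjunct is true. -/
def fSat : SO dhSig :=
  .exs [0] (.bigAnd (hornClauses.map fun c => .alls c.1 (.bigOr c.2)))

/-- The number of satisfying assignments. -/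
def qsoCount : QSO dhSig := .sumSO trueVar (.sumSO notSat (.form fSat))

theorem freeFO_fP (c x : FVar) : (fP c x).freeFO = {c, x} := Matrix.range_cons_cons_empty c x _

theorem freeFO_fN (c x : FVar) : (fN c x).freeFO = {c, x} := Matrix.range_cons_cons_empty c x _

theorem freeFO_fV (x : FVar) : (fV x).freeFO = {x} := Matrix.range_cons_empty x _

theorem freeFO_fNC (c : FVar) : (fNC c).freeFO = {c} := Matrix.range_cons_empty c _

theorem freeFO_fD (d c : FVar) : (fD d c).freeFO = {d, c} := Matrix.range_cons_cons_empty d c _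

theorem freeFO_fT (x : FVar) : (fT x).freeFO = {x} := Matrix.range_cons_empty x _

theorem freeFO_fW (c x : FVar) : (fW c x).freeFO = {c, x} := Matrix.range_cons_cons_empty c x _

theorem isSentence_qsoCount : qsoCount.IsSentence := by
  constructor
  · simp only [qsoCount, QSO.freeFO, fSat, hornClauses, SO.exs, SO.alls, SO.bigOr, SO.bigAnd,
      SO.conj, SO.all, SO.freeFO, fInstance, freeFO_fP, freeFO_fN, freeFO_fV, freeFO_fNC, freeFO_fD,
      freeFO_fT, freeFO_fW, List.map_cons, List.map_nil, List.foldr_cons, List.foldr_nil]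
    ext x
    simp only [Set.mem_sdiff, Set.mem_union, Set.mem_insert_iff, Set.mem_singleton_iff,
      Set.mem_empty_iff_false, iff_false]
    tauto
  · simp [qsoCount, QSO.freeSO, fSat, hornClauses, SO.exs, SO.alls, SO.bigOr, SO.bigAnd, SO.conj,
      SO.all, SO.freeSO, fInstance, fP, fN, fV, fNC, fD, fT, fW]

theorem isHornClause_of_pos {xs : List FVar} {φ : SO dhSig} {l : List (SO dhSig)}
    (hφ : φ.IsPosLit ∨ φ.IsNegLit ∨ φ.IsFO)
    (hl : ∀ ψ ∈ l, ¬ ψ.IsPosLit ∧ (ψ.IsNegLit ∨ ψ.IsFO)) :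
    (SO.alls xs (.bigOr (φ :: l))).IsHornClause := by
  refine ⟨xs, φ :: l, rfl, ?_, ?_⟩
  · rintro ψ hψ
    rcases List.mem_cons.1 hψ with rfl | hψ
    · exact hφ
    · exact .inr (hl ψ hψ).2
  · rw [List.pairwise_cons]
    exact ⟨fun ψ hψ h => (hl ψ hψ).1 h.2,
      List.pairwise_of_forall_mem_list fun ψ hψ χ _ h => (hl ψ hψ).1 h.1⟩

theorem isPosLit_fT (x : FVar) : (fT x).IsPosLit := ⟨_, _, rfl⟩

theorem isPosLit_fW (c x : FVar) : (fW c x).IsPosLit := ⟨_, _, rfl⟩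

theorem isNegLit_fT (x : FVar) : (SO.neg (fT x)).IsNegLit := ⟨_, _, [x], [], rfl, rfl⟩

theorem isNegLit_fW (c x : FVar) : (SO.neg (fW c x)).IsNegLit := ⟨_, _, [c, x], [], rfl, rfl⟩

theorem isNegLit_ex_fW (c x : FVar) : (SO.ex x (.neg (fW c x))).IsNegLit :=
  ⟨_, _, [c], [x], rfl, rfl⟩

theorem isFO_fInstance : fInstance.IsFO := by
  simp [fInstance, SO.IsFO, SO.conj, SO.all, fP, fN, fV, fNC, fD]

theorem isSigma_qsoCount : qsoCount.IsSigma (ExistsHorn dhSig) := by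
  refine ⟨[0], _, ⟨_, rfl, ?_⟩, rfl⟩
  have h1 : ∀ φ : SO dhSig, ¬ (SO.neg φ).IsPosLit := by rintro φ ⟨_, _, h⟩; cases h
  have h2 : ∀ x (φ : SO dhSig), ¬ (SO.ex x φ).IsPosLit := by rintro x φ ⟨_, _, h⟩; cases h
  have h3 : ∀ c x, ¬ (fN c x).IsPosLit := by rintro c x ⟨_, _, h⟩; cases h
  simp only [hornClauses, List.map_cons, List.map_nil, List.forall_mem_cons, List.not_mem_nil,
    false_imp_iff, implies_true, and_true]
  refine ⟨isHornClause_of_pos (.inr (.inr isFO_fInstance)) ?_,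
    isHornClause_of_pos (.inr (.inr trivial)) ?_, isHornClause_of_pos (.inr (.inr trivial)) ?_,
    isHornClause_of_pos (.inl (isPosLit_fW 1 2)) ?_, isHornClause_of_pos (.inl (isPosLit_fW 1 2))
    ?_,
    isHornClause_of_pos (.inl (isPosLit_fT 2)) ?_, isHornClause_of_pos (.inl (isPosLit_fT 2)) ?_,
    isHornClause_of_pos (.inr (.inr trivial)) ?_⟩ <;>
  simp only [List.forall_mem_cons, List.not_mem_nil, false_imp_iff, implies_true, and_true, h1, h2,
    h3, isNegLit_fT, isNegLit_fW, isNegLit_ex_fW, not_false_eq_true, true_and, true_or]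
  exacts [.inr trivial, .inr trivial, ⟨.inr trivial, .inr trivial⟩, .inr trivial]

/-- The value of `notSat` is pinned to a function of `trueVar`. Given that, quantifying universally
over the positive variable of a clause agrees with an existential statement, because such a variable
is unique if it exists, and `NC` covers the case that it does not. -/
theorem sat_fSat : fSat.Sat S v W ↔ IsInstance S ∧
    W notSat = {t : Fin 2 → S.A | N S (t 0) (t 1) → (![t 1] : Fin 1 → S.A) ∈ W trueVar} ∧
    (∀ x, (![x] : Fin 1 → S.A) ∈ W trueVar → V S x) ∧
    ∃ d, (∃ c, D S d c) ∧ ∀ c, D S d c → (∃ x, P S c x ∧ (![x] : Fin 1 → S.A) ∈ W trueVar) ∨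
      ∃ x, N S c x ∧ (![x] : Fin 1 → S.A) ∉ W trueVar := by
  rw [fSat]
  simp only [SO.exs, List.foldr_cons, List.foldr_nil, SO.Sat, SO.sat_bigAnd, hornClauses,
    List.map_cons, List.map_nil, List.forall_mem_cons, List.not_mem_nil,
    false_imp_iff, implies_true, and_true, SO.alls, SO.sat_all, SO.sat_bigOr, sat_fP, sat_fN,
    sat_fV, sat_fNC, sat_fD,
    sat_fT, sat_fW, sat_fInstance, exists_mem_cons_and, false_and, exists_false, or_false]
  simp only [Function.update, eq_rec_constant, dite_eq_ite]
  norm_num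
  intro hI
  have h1 : W notSat = {t : Fin 2 → S.A | N S (t 0) (t 1) → (![t 1] : Fin 1 → S.A) ∈ W trueVar} ↔
      ∀ a b, (![a, b] : Fin 2 → S.A) ∈ W notSat ↔ (N S a b → (![b] : Fin 1 → S.A) ∈ W trueVar) := by
    constructor
    · intro h a b
      rw [h]
      exact Iff.rfl
    · intro h
      refine Set.ext fun (t : Fin 2 → S.A) => ?_
      have ht : (![t 0, t 1] : Fin 2 → S.A) = t := by funext j; fin_cases j <;> rfl
      have := h (t 0) (t 1)
      rwa [ht] at this
  rw [h1]
  obtain ⟨i1, i2, i3⟩ := (isInstance_iff S).1 hI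
  constructor
  · rintro ⟨d, h2, h3, h4, h5, h6, h7, h8⟩
    have h9 : ∀ a b, (![a, b] : Fin 2 → S.A) ∈ W notSat ↔
        (N S a b → (![b] : Fin 1 → S.A) ∈ W trueVar) := by grind
    refine ⟨h9, by grind, d, h2, fun c hc => ?_⟩
    by_cases hP : ∃ x, P S c x
    · obtain ⟨x, hx⟩ := hP
      have := h7 c x
      grind
    · have := h8 c
      have := i2 c
      grind
  · rintro ⟨h9, h3, d, h2, h4⟩
    refine ⟨d, h2, by grind, by grind, by grind, by grind, fun c x => ?_, fun c => ?_⟩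
    · have := h4 c
      have := i3 c
      grind
    · have := h4 c
      have := i2 c
      grind

end Formulae

/-! ### The value of the sentence -/

variable (S : OrdStruct dhSig)

/-- The variables in `B` are propositional variables that make some disjunct true. -/
def Good (B : Set (Fin 1 → S.A)) : Prop := (∀ x, ![x] ∈ B → V S x) ∧
  ∃ d, (∃ c, D S d c) ∧ ∀ c, D S d c → (∃ x, P S c x ∧ ![x] ∈ B) ∨ ∃ x, N S c x ∧ ![x] ∉ B

theorem card_good (hS : IsInstance S) :
    Nat.card {B : Set (Fin 1 → S.A) // Good S B} = numSat (formulaOf S) := by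
  rw [numSat_formulaOf]
  let F : Set (Fin 1 → S.A) → Set {x : S.A // V S x} := fun B => {x | ![x.1] ∈ B}
  let G : Set {x : S.A // V S x} → Set (Fin 1 → S.A) := fun τ => {t | ∃ h : V S (t 0), ⟨t 0, h⟩ ∈ τ}
  have hGV : ∀ τ x, ![x] ∈ G τ → V S x := fun τ x h => h.1
  have hFG : ∀ τ, F (G τ) = τ := by
    intro τ
    ext x
    exact ⟨fun h => h.2, fun h => ⟨x.2, h⟩⟩
  have hGF : ∀ B, (∀ x, ![x] ∈ B → V S x) → G (F B) = B := by
    intro B hB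
    ext t
    have ht : t = ![t 0] := by funext j; fin_cases j; rfl
    constructor
    · rintro ⟨h1, h2⟩
      rw [ht]
      exact h2
    · intro h
      rw [ht] at h
      exact ⟨hB _ h, h⟩
  have key : ∀ B, (∀ x, ![x] ∈ B → V S x) → (Good S B ↔
      ∃ d, (∃ c, D S d c) ∧ ∀ c, D S d c → (clauseOf S c).Holds (F B)) := by
    intro B hB
    refine (and_iff_right hB).trans (exists_congr fun d => and_congr_right fun _ =>
      forall_congr' fun c => imp_congr_right fun _ => or_congr ?_ ?_)
    · constructor
      · rintro ⟨x, h1, h2⟩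
        exact ⟨⟨x, hB x h2⟩, h1, h2⟩
      · rintro ⟨x, h1, h2⟩
        exact ⟨x, h1, h2⟩
    · constructor
      · rintro ⟨x, h1, h2⟩
        -- Here `x` lies outside `B`, so that it is a propositional variable has to come from the
        -- typing of `N`.
        exact ⟨⟨x, (hS.neg_typed c x h1).2⟩, h1, h2⟩
      · rintro ⟨x, h1, h2⟩
        exact ⟨x, h1, h2⟩
  refine Nat.card_congr ⟨fun B => ⟨F B.1, (key _ B.2.1).1 B.2⟩, fun τ => ⟨G τ.1,
    (key _ (hGV _)).2 (by rw [hFG]; exact τ.2)⟩, fun B => Subtype.ext (hGF _ B.2.1),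
    fun τ => Subtype.ext (hFG _)⟩

/-- Collapses the sum over `notSat`, whose value is determined by that of `trueVar`. -/
theorem sum_ite_and_eq {α : Type} [Fintype α] (p q : Prop) (a : α)
    [∀ c, Decidable (p ∧ c = a ∧ q)] [Decidable (p ∧ q)] :
    (∑ c : α, if p ∧ c = a ∧ q then 1 else 0) = if p ∧ q then 1 else 0 := by
  rw [Finset.sum_eq_single a (fun c _ h => if_neg fun h' => h h'.2.1) (by simp)]
  simp

theorem value_qsoCount : qsoCount.value S = count S := by
  classical
  have hne : trueVar ≠ notSat := by decide
  have h : ∀ (v : FAssign S.A) (W : SAssign S.A) (B : Set (Fin 1 → S.A)) (C : Set (Fin 2 → S.A)),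
      fSat.Sat S v (Function.update (Function.update W trueVar B) notSat C) ↔ IsInstance S ∧
        C = {t : Fin 2 → S.A | N S (t 0) (t 1) → (![t 1] : Fin 1 → S.A) ∈ B} ∧ Good S B := by
    intro v W B C
    have key : ∀ (B' : Set (Fin 1 → S.A)) (C' : Set (Fin 2 → S.A)), B' = B → C' = C →
        (IsInstance S ∧ C' = {t : Fin 2 → S.A | N S (t 0) (t 1) → (![t 1] : Fin 1 → S.A) ∈ B'} ∧
          Good S B' ↔ IsInstance S ∧
            C = {t : Fin 2 → S.A | N S (t 0) (t 1) → (![t 1] : Fin 1 → S.A) ∈ B} ∧ Good S B) := by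
      rintro _ _ rfl rfl
      exact Iff.rfl
    exact (sat_fSat _ _).trans (key _ _
      ((Function.update_of_ne hne _ _).trans (Function.update_self _ _ _))
      (Function.update_self _ _ _))
  have h1 : qsoCount.value S =
      ∑ B : Set (Fin 1 → S.A), if IsInstance S ∧ Good S B then 1 else 0 := by
    refine Finset.sum_congr rfl fun B _ =>
      (Finset.sum_congr rfl fun C _ => if_congr (h _ _ B C) rfl rfl).trans
        (sum_ite_and_eq _ _ _)
  rw [h1, count]
  by_cases hS : IsInstance S
  · simp only [hS, true_and, if_true]
    rw [← card_good S hS, Finset.sum_boole, Nat.card_eq_fintype_card, Fintype.card_subtype]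
    rfl
  · simp [hS]

/-- `#DisjHornSAT` belongs to the class. -/
theorem _root_.sharpDisjHornSAT_mem : sharpDisjHornSAT ∈ SigmaQSOClass ExistsHorn :=
  ⟨dhSig, qsoCount, isSigma_qsoCount, isSentence_qsoCount,
    congrArg onStrings (funext fun S => (value_qsoCount S).symm)⟩

end DisjHorn

theorem mainTheorem7 : ParsimoniouslyComplete (SigmaQSOClass ExistsHorn) sharpDisjHornSAT :=
  ⟨sharpDisjHornSAT_mem, fun _ hf => parsimoniouslyReducible_sharpDisjHornSAT hf⟩
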